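/- **Setting.** Let $G$ be a group with a finite symmetrized presentation $\mathcal P=\langle A\mid R\rangle$: $A$ is a finite set of letters representing generators of $G$, closed under formal inversion, no letter represents the identity $\epsilon$ of $G$, and $R$ is a finite set of nonempty words over $A$ (not necessarily freely reduced), closed under inversion and cyclic conjugation. Write $v=_Gw$ if the words $v,w\in A^*$ represent the same element of $G$, and $l(w)$ for the length of $w$. Let $X$ be the Cayley complex, whose 1-skeleton is the Cayley graph, and let $E(X)$ be its set of undirected edges. Let $\mathbb N[\frac14]=\{k/4\mid k\in\mathbb N\}$. Functions $f,g:\mathbb N[\frac14]\to\mathbb N[\frac14]$ are *Lipschitz equivalent* if there is a constant $C\in\mathbb N$ with $f(n)\le C\,g(Cn+C)+C$ and $g(n)\le C\,f(Cn+C)+C$ for all $n$. A *van Kampen diagram* $\Delta$ for a word $w=_G\epsilon$ is a finite, planar, contractible combinatorial 2-complex with a base vertex $*$ and edges directed and labeled by $A$ (an edge labeled $a$ in one direction is labeled $a^{-1}$ in the other), such that the counterclockwise boundary path from $*$ is labeled $w$ and every 2-cell has boundary label in $R$. Let $\pi_\Delta:\Delta\to X$ be the canonical label-preserving map with $\pi_\Delta(*)=\epsilon$,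 and let $\Delta^0,\Delta^1$ be the vertex set and the 1-skeleton. The *coarse distance* $\tilde d_\Delta(*,p)$ is: the path metric distance in $\Delta^1$ if $p$ is a vertex; the minimum of the values at the two endpoints plus $\frac12$ if $p$ is interior to an edge; and, if $p$ is interior to a 2-cell, the maximum of the values in the interiors of the edges of its boundary, minus $\frac14$. For a space $Z$, a continuous map $\alpha:Z\times[0,1]\to\Delta$ with $\alpha(p,0)=*$ for all $p\in Z$ is *intrinsically $f$-tame* if $\tilde d_\Delta(*,\alpha(p,s))\le f(\tilde d_\Delta(*,\alpha(p,t)))$ for all $p\in Z$ and $0\le s<t\le1$. * A *van Kampen homotopy* of $\Delta$ is a continuous $\Psi:\partial\Delta\times[0,1]\to\Delta$ with $\Psi(p,0)=*$, $\Psi(p,1)=p$ and $\Psi(*,t)=*$ for all $p,t$, and $\Psi(p,t)\in\Delta^1$ for all $t$ if $p$ is a vertex. $(G,\mathcal P)$ satisfies an *intrinsic tame filling inequality* for $f$ if each word $w=_G\epsilon$ has a van Kampen diagram with an intrinsically $f$-tame van Kampen homotopy. * Let $C_n$ be the circle with $n$ vertices, one of them a basepoint $b$, and $n$ edges (a point if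 $n=0$). For a diagram $\Delta$ for $w$ with $n=l(w)$, let $\vartheta_\Delta:C_n\to\partial\Delta$ send $b$ to $*$ and, going around counterclockwise, send the successive edges of $C_n$ onto the successive edges of the boundary path labeled $w$. A *disk homotopy* of $\Delta$ is a continuous $\Phi:C_n\times[0,1]\to\Delta$ with $\Phi(p,0)=*$, $\Phi(p,1)=\vartheta_\Delta(p)$ and $\Phi(b,t)=*$ for all $p,t$, and $\Phi(p,t)\in\Delta^1$ for all $t$ if $p$ is a vertex. $(G,\mathcal P)$ satisfies an *intrinsic relaxed tame filling inequality* for $f$ if each word $w=_G\epsilon$ has a van Kampen diagram with an intrinsically $f$-tame disk homotopy. * If $\Delta$ is a diagram for $w_1aw_2^{-1}$ with $a\in A$, and $\hat e$ is the boundary edge corresponding to $a$, from $v_1$ to $v_2$, an *edge homotopy* of $\hat e$ is a continuous $\Theta:\hat e\times[0,1]\to\Delta$ with $\Theta(p,0)=*$ and $\Theta(p,1)=p$ for all $p$, such that for $i=1,2$ the path $\Theta(v_i,\cdot)$ follows, up to a continuous nondecreasing reparametrization, the boundary path from $*$ to $v_i$ labeled $w_i$. A *combed normal filling* consists of normal forms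 $y_g\in A^*$ $(g\in G)$ labeling simple paths in the Cayley graph, with $y_g$ representing $g$, and, for each $e\in E(X)$, of a choice of direction of $e$, say from $g$ to $h$ with label $a$, a van Kampen diagram $\Delta_e$ for $y_g\,a\,y_h^{-1}$, and an edge homotopy $\Theta_e$ of the edge $\hat e$ of $\partial\Delta_e$ corresponding to $a$, such that, whenever $e,e'$ share an endpoint $g$ and $\hat g_e,\hat g_{e'}$ are the corresponding endpoints of $\hat e,\hat e'$, one has $\pi_{\Delta_e}(\Theta_e(\hat g_e,t))=\pi_{\Delta_{e'}}(\Theta_{e'}(\hat g_{e'},t))$ for all $t$. $(G,\mathcal P)$ satisfies an *intrinsic geodesic tame normal inequality* for $f$ if there is a combed normal filling in which all words $y_g$ label geodesics in the Cayley graph and all $\Theta_e$ are intrinsically $f$-tame. **Proposition.** Let $f:\mathbb N[\frac14]\to\mathbb N[\frac14]$ be nondecreasing. The following are equivalent up to Lipschitz equivalence of $f$; that is, if one of them holds for some nondecreasing function Lipschitz equivalent to $f$, then each of the others holds for some (possibly different) nondecreasing function Lipschitz equivalent to $f$: 1. $(G,\mathcal P)$ satisfies an intrinsic tame filling inequality with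 respect to $f$. 2. $(G,\mathcal P)$ satisfies an intrinsic relaxed tame filling inequality with respect to $f$. 3. $(G,\mathcal P)$ satisfies an intrinsic geodesic tame normal inequality with respect to $f$. -/

import Mathlib

open scoped unitInterval

namespace TameFilling

universe u v w x

/-! ### The numbers `0, 1/4, 1/2, 3/4, 1, …` and Lipschitz equivalence -/

/-- The set `ℕ[1/4] = {k / 4 | k ∈ ℕ}` of values of coarse distances. -/
def quarterNat : AddSubmonoid ℚ := AddSubmonoid.multiples (1 / 4 : ℚ)

/-- The elements of `ℕ[1/4]`, with the order induced from `ℚ`. -/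
abbrev QuarterNat : Type := quarterNat

theorem mem_quarterNat {q : ℚ} : q ∈ quarterNat ↔ ∃ k : ℕ, (k : ℚ) / 4 = q := by
  simp only [quarterNat, AddSubmonoid.mem_multiples_iff, nsmul_eq_mul]
  constructor <;> rintro ⟨k, hk⟩ <;> exact ⟨k, by rw [← hk]; ring⟩

/-- The map `n ↦ C n + C` on `ℕ[1/4]`. -/
def QuarterNat.affine (C : ℕ) (n : QuarterNat) : QuarterNat :=
  ⟨C * (n : ℚ) + C, by
    obtain ⟨k, hk⟩ := mem_quarterNat.1 n.2
    exact mem_quarterNat.2 ⟨C * k + 4 * C, by rw [← hk]; push_cast; ring⟩⟩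

/-- Lipschitz equivalence of functions on `ℕ[1/4]`. -/
def LipschitzEquivalent (f g : QuarterNat → QuarterNat) : Prop :=
  ∃ C : ℕ, ∀ n : QuarterNat,
    (f n : ℚ) ≤ C * (g (n.affine C) : ℚ) + C ∧ (g n : ℚ) ≤ C * (f (n.affine C) : ℚ) + C

/-! ### Finite symmetrized presentations -/

/-- A finite symmetrized presentation `⟨A | R⟩` of the group `G` on the (finite) alphabet `A`.
The alphabet carries the formal inversion `inv` of letters; `val a` is the element of `G`
represented by the letter `a`, which is never trivial.  Relators are nonempty words over `A`, not
necessarily freely reduced. -/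
structure SymmetrizedPresentation (G : Type u) [Group G] (A : Type v) where
  inv : A → A
  inv_inv : ∀ a, inv (inv a) = a
  val : A → G
  val_inv : ∀ a, val (inv a) = (val a)⁻¹
  val_ne_one : ∀ a, val a ≠ 1
  rels : Set (List A)
  rels_finite : rels.Finite
  nil_notMem : [] ∉ rels
  rels_rotate : ∀ r ∈ rels, ∀ n : ℕ, r.rotate n ∈ rels
  rels_inverse : ∀ r ∈ rels, (r.map inv).reverse ∈ rels
  generates : Function.Surjective (FreeGroup.lift val)
  presents : (FreeGroup.lift val).ker = Subgroup.normalClosure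
    ({z | ∃ a, z = FreeGroup.of a * FreeGroup.of (inv a)} ∪
      {z | ∃ r ∈ rels, z = (r.map FreeGroup.of).prod})

namespace SymmetrizedPresentation

variable {G : Type u} [Group G] {A : Type v} (P : SymmetrizedPresentation G A)

/-- The element of `G` represented by a word. -/
def wordVal (l : List A) : G := (l.map P.val).prod

/-- The formal inverse of a word. -/
def wordInv (l : List A) : List A := (l.map P.inv).reverse

/-- A word is simple if the path that it labels in the Cayley graph repeats no vertex. -/
def IsSimpleWord (l : List A) : Prop := (l.inits.map P.wordVal).Nodup

/-- A word is geodesic if the path that it labels in the Cayley graph is as short as possible. -/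
def IsGeodesicWord (l : List A) : Prop :=
  ∀ l' : List A, P.wordVal l' = P.wordVal l → l.length ≤ l'.length

end SymmetrizedPresentation

/-! ### Graphs with directed edges, and their geometric realizations -/

/-- A graph, as a set `V` of vertices with a set `E` of directed edges; `rev` reverses directed
edges, so that a 1-cell is a pair `{e, rev e}`. -/
structure DGraph where
  V : Type u
  E : Type v
  src : E → V
  rev : E → E
  rev_rev : ∀ e, rev (rev e) = e

namespace DGraph

variable (Γ : DGraph.{u, v})

/-- The terminal vertex of a directed edge. -/
def tgt (e : Γ.E) : Γ.V := Γ.src (Γ.rev e)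

/-- The underlying simple graph; its `dist` is the path metric on vertices. -/
def simple : SimpleGraph Γ.V := SimpleGraph.fromRel fun a b => ∃ e, Γ.src e = a ∧ Γ.tgt e = b

/-- The identifications that glue the intervals `{e} × [0,1]` to the vertices and to each other. -/
inductive Glue : Γ.V ⊕ (Γ.E × I) → Γ.V ⊕ (Γ.E × I) → Prop
  | start (e : Γ.E) : Glue (.inr (e, 0)) (.inl (Γ.src e))
  | flip (e : Γ.E) (s : I) : Glue (.inr (e, s)) (.inr (Γ.rev e, σ s))

/-- The geometric realization of the graph, a 1-dimensional CW complex. -/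
def Point : Type (max u v) := Quot Γ.Glue

/-- The quotient topology, with `V` and `E` discrete. -/
instance : TopologicalSpace Γ.Point :=
  letI : TopologicalSpace Γ.V := ⊥
  letI : TopologicalSpace Γ.E := ⊥
  inferInstanceAs (TopologicalSpace (Quot Γ.Glue))

/-- A vertex, as a point of the realization. -/
def vertex (a : Γ.V) : Γ.Point := Quot.mk _ (.inl a)

/-- The point at parameter `s` on the directed edge `e`. -/
def edgePoint (e : Γ.E) (s : I) : Γ.Point := Quot.mk _ (.inr (e, s))

/-- The edge path `e₁ e₂ …` that starts at `a`, run at unit speed: the point at time `t`. -/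
noncomputable def walkPoint : Γ.V → List Γ.E → ℝ → Γ.Point
  | a, [], _ => Γ.vertex a
  | _, e :: l, t =>
      open Classical in
      if t ≤ 1 then Γ.edgePoint e (Set.projIcc 0 1 zero_le_one t)
      else walkPoint (Γ.tgt e) l (t - 1)

/-- A morphism of graphs. -/
structure Hom (Γ : DGraph.{u, v}) (Γ' : DGraph.{w, x}) where
  onV : Γ.V → Γ'.V
  onE : Γ.E → Γ'.E
  src_onE : ∀ e, Γ'.src (onE e) = onV (Γ.src e)
  rev_onE : ∀ e, Γ'.rev (onE e) = onE (Γ.rev e)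

/-- The cellular map of geometric realizations that a morphism of graphs induces. -/
def Hom.map {Γ : DGraph.{u, v}} {Γ' : DGraph.{w, x}} (φ : Hom Γ Γ') : Γ.Point → Γ'.Point :=
  Quot.lift (Sum.elim (fun a => Γ'.vertex (φ.onV a)) (fun z => Γ'.edgePoint (φ.onE z.1) z.2)) (by
    rintro _ _ (e | ⟨e, s⟩)
    · have h := Quot.sound (Glue.start (Γ := Γ') (φ.onE e))
      rw [φ.src_onE] at h
      exact h
    · have h := Quot.sound (Glue.flip (Γ := Γ') (φ.onE e) s)
      rw [φ.rev_onE] at h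
      exact h)

/-- The coarse distance from the vertex `b` to the points of the graph: the path metric on
vertices, and the smaller of the values at the two ends plus `1/2` inside an edge. -/
noncomputable def preCoarse (b : Γ.V) : Γ.V ⊕ (Γ.E × I) → ℚ
  | .inl a => Γ.simple.dist b a
  | .inr (e, s) =>
      open Classical in
      if s = 0 then Γ.simple.dist b (Γ.src e)
      else if s = 1 then Γ.simple.dist b (Γ.tgt e)
      else (min (Γ.simple.dist b (Γ.src e)) (Γ.simple.dist b (Γ.tgt e)) : ℕ) + 1 / 2

theorem preCoarse_glue (b : Γ.V) (y z : Γ.V ⊕ (Γ.E × I)) (h : Γ.Glue y z) :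
    Γ.preCoarse b y = Γ.preCoarse b z := by
  rcases h with e | ⟨e, s⟩
  · simp [preCoarse]
  · by_cases h0 : s = 0
    · subst h0; simp [preCoarse, tgt, Γ.rev_rev]
    · by_cases h1 : s = 1
      · subst h1; simp [preCoarse, tgt]
      · have h0' : σ s ≠ 0 := fun h => h1 (by simpa using h)
        have h1' : σ s ≠ 1 := fun h => h0 (by simpa using h)
        simp [preCoarse, h0, h1, h0', h1', tgt, Γ.rev_rev, min_comm]

/-- The coarse distance on the realization of the graph. -/
noncomputable def coarse (b : Γ.V) : Γ.Point → ℚ :=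
  Quot.lift (Γ.preCoarse b) (Γ.preCoarse_glue b)

theorem coarse_mem (b : Γ.V) (p : Γ.Point) : Γ.coarse b p ∈ quarterNat := by
  induction p using Quot.ind with
  | mk y =>
    rcases y with a | ⟨e, s⟩
    · exact mem_quarterNat.2 ⟨4 * Γ.simple.dist b a, by
        simp [coarse, preCoarse]⟩
    · simp only [coarse, preCoarse]
      split_ifs
      · exact mem_quarterNat.2 ⟨4 * Γ.simple.dist b (Γ.src e), by simp⟩
      · exact mem_quarterNat.2 ⟨4 * Γ.simple.dist b (Γ.tgt e), by simp⟩
      · exact mem_quarterNat.2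
          ⟨4 * min (Γ.simple.dist b (Γ.src e)) (Γ.simple.dist b (Γ.tgt e)) + 2, by
            push_cast; ring⟩

end DGraph

/-- The Cayley graph: a directed edge `(g, a)` goes from `g` to `g a` and carries the label `a`; its
reverse is `(g a, a⁻¹)`. -/
def SymmetrizedPresentation.cayleyGraph {G : Type u} [Group G] {A : Type v}
    (P : SymmetrizedPresentation G A) : DGraph.{u, max u v} where
  V := G
  E := G × A
  src e := e.1
  rev e := (e.1 * P.val e.2, P.inv e.2)
  rev_rev e := by simp [P.val_inv, P.inv_inv]

/-! ### Van Kampen diagrams -/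

/-- A finite connected graph drawn on an oriented closed surface, with edges labelled in `A`, a
base vertex, and a distinguished face, the outer one.

`next e` is the directed edge that follows `e` along the boundary of the face on the right-hand
side of `e`; the faces are the cycles of `next`.  The permutation `e ↦ next (rev e)` turns around the
initial vertex of `e`, and `rotation` says that it permutes the edges leaving a vertex cyclically.
`bdry` is the cycle of the outer face, read from the base vertex.  As the outer face lies to its
right and all other faces lie to its left, this is the counterclockwise boundary path of the
complement of the outer face. -/
structure LabelledMap (A : Type v) (inv : A → A) extends DGraph.{0, 0} where
  finV : Fintype V
  finE : Fintype E
  rev_ne : ∀ e, rev e ≠ e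
  label : E → A
  label_rev : ∀ e, label (rev e) = inv (label e)
  connected : toDGraph.simple.Connected
  next : Equiv.Perm E
  src_next : ∀ e, src (next e) = src (rev e)
  rotation : ∀ e e', src e = src e' → ∃ n : ℕ, (fun d => next (rev d))^[n] e = e'
  base : V
  bdry : List E
  bdry_nodup : bdry.Nodup
  bdry_next : ∀ (i : ℕ) (h : i < bdry.length),
    next bdry[i] = bdry[(i + 1) % bdry.length]'(Nat.mod_lt _ (by omega))
  bdry_base : ∀ e ∈ bdry.head?, src e = base
  bdry_nil : bdry = [] → IsEmpty E

namespace LabelledMap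

variable {A : Type v} {inv : A → A} (Δ : LabelledMap.{v} A inv)

instance : Fintype Δ.V := Δ.finV
instance : Fintype Δ.E := Δ.finE

/-- A directed edge with an inner face on its right-hand side. -/
def Corner : Type := {e : Δ.E // e ∉ Δ.bdry}

/-- Two corners belong to the same inner face. -/
def faceSetoid : Setoid Δ.Corner := (Equiv.Perm.SameCycle.setoid Δ.next).comap Subtype.val

/-- The inner faces, which are the 2-cells. -/
def Face : Type := Quotient Δ.faceSetoid

/-- The word read around the face on the right-hand side of `e`, starting with `e`. -/
noncomputable def faceWord (e : Δ.E) : List A :=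
  (List.iterate Δ.next e (Function.minimalPeriod Δ.next e)).map Δ.label

/-- The identifications of the 2-complex.  The 2-cell of an inner face is the cone over its boundary
circle: `(c, s, r)` is the point at height `r` of the cone above the point `s` of the edge `c`, with
`r = 0` on the boundary and `r = 1` at the apex. -/
inductive Glue : Δ.toDGraph.Point ⊕ (Δ.Corner × I × I) →
    Δ.toDGraph.Point ⊕ (Δ.Corner × I × I) → Prop
  | rim (c : Δ.Corner) (s : I) : Glue (.inr (c, s, 0)) (.inl (Δ.toDGraph.edgePoint c.1 s))
  | seam (c c' : Δ.Corner) (h : c'.1 = Δ.next c.1) (r : I) :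
      Glue (.inr (c, 1, r)) (.inr (c', 0, r))
  | apex (c : Δ.Corner) (s s' : I) : Glue (.inr (c, s, 1)) (.inr (c, s', 1))

/-- The underlying space of the 2-complex: the 1-skeleton with a disk attached along the boundary of
every inner face. -/
def Space : Type := Quot Δ.Glue

instance : TopologicalSpace Δ.Space :=
  letI : TopologicalSpace Δ.Corner := ⊥
  inferInstanceAs (TopologicalSpace (Quot Δ.Glue))

/-- The inclusion of the 1-skeleton. -/
def incl (p : Δ.toDGraph.Point) : Δ.Space := Quot.mk _ (.inl p)

/-- A vertex, as a point of the 2-complex. -/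
def vertexPt (a : Δ.V) : Δ.Space := Δ.incl (Δ.toDGraph.vertex a)

/-- The point at parameter `s` on the directed edge `e`. -/
def edgePt (e : Δ.E) (s : I) : Δ.Space := Δ.incl (Δ.toDGraph.edgePoint e s)

/-- The basepoint `*`. -/
def basePt : Δ.Space := Δ.vertexPt Δ.base

/-- The 1-skeleton, as a subset. -/
def oneSkeleton : Set Δ.Space := Set.range Δ.incl

/-- The boundary, as a subset. -/
def boundary : Set Δ.Space := {Δ.basePt} ∪ {p | ∃ e ∈ Δ.bdry, ∃ s : I, p = Δ.edgePt e s}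

/-- The closed 1-cell underlying the directed edge `e`. -/
def closedEdge (e : Δ.E) : Set Δ.Space := Set.range (Δ.edgePt e)

theorem basePt_mem_boundary : Δ.basePt ∈ Δ.boundary := Or.inl rfl

theorem src_mem_closedEdge (e : Δ.E) : Δ.vertexPt (Δ.src e) ∈ Δ.closedEdge e :=
  ⟨0, congrArg Δ.incl (Quot.sound (DGraph.Glue.start e))⟩

theorem tgt_mem_closedEdge (e : Δ.E) :
    Δ.vertexPt (Δ.toDGraph.tgt e) ∈ Δ.closedEdge e :=
  ⟨1, congrArg Δ.incl ((Quot.sound (DGraph.Glue.flip e 1)).trans (by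
    rw [unitInterval.symm_one]; exact Quot.sound (DGraph.Glue.start (Δ.rev e))))⟩

/-- The edge path `l` from the base vertex, at time `t`. -/
noncomputable def walkPt (l : List Δ.E) (t : ℝ) : Δ.Space :=
  Δ.incl (Δ.toDGraph.walkPoint Δ.base l t)

/-- The distance from the base vertex to the closer end of an edge. -/
noncomputable def edgeLow (e : Δ.E) : ℕ :=
  min (Δ.toDGraph.simple.dist Δ.base (Δ.src e))
    (Δ.toDGraph.simple.dist Δ.base (Δ.toDGraph.tgt e))

open Classical in
/-- The largest value of `edgeLow` on the boundary of the face at `e`. -/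
noncomputable def faceLow (e : Δ.E) : ℕ :=
  (Finset.univ.filter fun e' => Δ.next.SameCycle e e').sup Δ.edgeLow

/-- The coarse distance to the basepoint; inside a 2-cell, it is the largest coarse distance inside
an edge of the boundary of the cell, minus `1/4`. -/
noncomputable def preCoarse : Δ.toDGraph.Point ⊕ (Δ.Corner × I × I) → ℚ
  | .inl p => Δ.toDGraph.coarse Δ.base p
  | .inr (c, s, r) =>
      open Classical in
      if r = 0 then Δ.toDGraph.coarse Δ.base (Δ.toDGraph.edgePoint c.1 s)
      else ((Δ.faceLow c.1 : ℚ) + 1 / 2) - 1 / 4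

theorem preCoarse_glue (y z : Δ.toDGraph.Point ⊕ (Δ.Corner × I × I)) (h : Δ.Glue y z) :
    Δ.preCoarse y = Δ.preCoarse z := by
  rcases h with ⟨c, s⟩ | ⟨c, c', h, r⟩ | ⟨c, s, s'⟩
  · simp [preCoarse]
  · by_cases h0 : r = 0
    · subst h0
      simp only [preCoarse, if_true]
      simp [DGraph.coarse, DGraph.edgePoint, DGraph.preCoarse, h, Δ.src_next, DGraph.tgt]
    · have key : Δ.faceLow c.1 = Δ.faceLow c'.1 := by
        unfold faceLow
        congr 1
        ext e'
        simp [h]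
      simp [preCoarse, h0, key]
  · simp [preCoarse]

/-- The coarse distance to the basepoint, as a rational number. -/
noncomputable def coarseRat : Δ.Space → ℚ := Quot.lift Δ.preCoarse Δ.preCoarse_glue

theorem coarseRat_mem (p : Δ.Space) : Δ.coarseRat p ∈ quarterNat := by
  induction p using Quot.ind with
  | mk y =>
    rcases y with p | ⟨c, s, r⟩
    · exact Δ.toDGraph.coarse_mem _ _
    · simp only [coarseRat, preCoarse]
      split_ifs
      · exact Δ.toDGraph.coarse_mem _ _
      · exact mem_quarterNat.2 ⟨4 * Δ.faceLow c.1 + 1, by push_cast; ring⟩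

/-- The coarse distance to the basepoint. -/
noncomputable def coarseDist (p : Δ.Space) : QuarterNat := ⟨Δ.coarseRat p, Δ.coarseRat_mem p⟩

/-- A homotopy with target the 2-complex is intrinsically `f`-tame if along each of its paths the
coarse distance to the basepoint at an earlier time is at most `f` of the one at a later time. -/
def IsTame {Z : Type*} [TopologicalSpace Z] (f : QuarterNat → QuarterNat)
    (α : C(Z × I, Δ.Space)) : Prop :=
  ∀ (p : Z) (s t : I), s < t → Δ.coarseDist (α (p, s)) ≤ f (Δ.coarseDist (α (p, t)))

end LabelledMap

variable {G : Type u} [Group G] {A : Type v}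

/-- A van Kampen diagram over `P`: a finite planar contractible labelled 2-complex, each of whose
2-cells has a boundary word in `R`.

By `euler`, the 2-complex (the union of the vertices, edges and inner faces) has Euler
characteristic `1`; with the outer face filled in, the surface is a sphere.  So the complex is the
complement of an open disk in a sphere tiled by faces, that is, it is planar and contractible, and
every finite planar contractible 2-complex is of this form.

`pos` is the canonical map to the Cayley complex on vertices: it sends the base vertex to `1` and
respects labels.  It is determined by this, and it always exists since the complex is simply
connected and relators represent `1`. -/
structure VanKampenDiagram (P : SymmetrizedPresentation G A) extends
    LabelledMap.{v} A P.inv where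
  euler : 2 * Nat.card V + 2 * Nat.card toLabelledMap.Face = Nat.card E + 2
  relator : ∀ e, e ∉ bdry → toLabelledMap.faceWord e ∈ P.rels
  pos : V → G
  pos_base : pos base = 1
  pos_tgt : ∀ e, pos (toDGraph.tgt e) = pos (src e) * P.val (label e)

namespace VanKampenDiagram

variable {P : SymmetrizedPresentation G A} (Δ : VanKampenDiagram P)

/-- The word along the boundary, read counterclockwise from the basepoint. -/
def bdryWord : List A := Δ.bdry.map Δ.label

/-- The canonical label-preserving morphism from the 1-skeleton of the diagram to the Cayley graph,
which is the 1-skeleton of the Cayley complex. -/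
def proj : DGraph.Hom Δ.toDGraph P.cayleyGraph where
  onV := Δ.pos
  onE e := (Δ.pos (Δ.src e), Δ.label e)
  src_onE _ := rfl
  rev_onE e := Prod.ext (Δ.pos_tgt e).symm (Δ.label_rev e).symm

/-- A van Kampen homotopy: a continuous choice of paths from the basepoint to the points of the
boundary of the diagram. -/
structure IsVanKampenHomotopy (Ψ : C(Δ.boundary × I, Δ.Space)) : Prop where
  map_zero : ∀ p, Ψ (p, 0) = Δ.basePt
  map_one : ∀ p, Ψ (p, 1) = p
  map_base : ∀ t, Ψ (⟨Δ.basePt, Δ.basePt_mem_boundary⟩, t) = Δ.basePt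
  map_vertex : ∀ (p : Δ.boundary) (a : Δ.V), (p : Δ.Space) = Δ.vertexPt a →
    ∀ t, Ψ (p, t) ∈ Δ.oneSkeleton

end VanKampenDiagram

/-- The circle `C_n` with `n` vertices and `n` edges, as the interval `[0, n]` with its ends
identified; the vertices are the integers, and the basepoint is `0`.  (For `n = 0`, it is a
point.) -/
def Circle (n : ℕ) : Type :=
  Quot fun y z : Set.Icc (0 : ℝ) n => (y : ℝ) = 0 ∧ (z : ℝ) = n

instance (n : ℕ) : TopologicalSpace (Circle n) :=
  inferInstanceAs (TopologicalSpace (Quot _))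

/-- The point of the circle `C_n` at distance `y` from the basepoint, counterclockwise. -/
def Circle.mk {n : ℕ} (y : Set.Icc (0 : ℝ) n) : Circle n := Quot.mk _ y

namespace VanKampenDiagram

variable {P : SymmetrizedPresentation G A} (Δ : VanKampenDiagram P)

/-- A disk homotopy: a continuous choice of paths from the basepoint to the points of the
boundary circuit of the diagram, which is parametrized by the circle `C_n`. -/
structure IsDiskHomotopy (Φ : C(Circle Δ.bdry.length × I, Δ.Space)) : Prop where
  map_zero : ∀ p, Φ (p, 0) = Δ.basePt
  map_one : ∀ y : Set.Icc (0 : ℝ) Δ.bdry.length, Φ (Circle.mk y, 1) = Δ.walkPt Δ.bdry y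
  map_base : ∀ t, Φ (Circle.mk ⟨0, le_refl _, Nat.cast_nonneg _⟩, t) = Δ.basePt
  map_vertex : ∀ (y : Set.Icc (0 : ℝ) Δ.bdry.length) (k : ℕ), (y : ℝ) = k →
    ∀ t, Φ (Circle.mk y, t) ∈ Δ.oneSkeleton

/-- The path `c` follows the edge path `l` from the base vertex to its end, up to a continuous
nondecreasing reparametrization. -/
def Follows (c : I → Δ.Space) (l : List Δ.E) : Prop :=
  ∃ ρ : I → ℝ, Continuous ρ ∧ Monotone ρ ∧ ρ 0 = 0 ∧ ρ 1 = l.length ∧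
    ∀ t, c t = Δ.walkPt l (ρ t)

/-- An edge homotopy of the `k`-th edge `e` of the boundary path (counted from `0`): a continuous
choice of paths from the basepoint to the points of `e`, such that the paths to the initial and the
terminal vertex of `e` follow the two parts of the boundary path before and after `e` (the latter
one reversed). -/
structure IsEdgeHomotopy (k : Fin Δ.bdry.length)
    (Θ : C(Δ.closedEdge Δ.bdry[k] × I, Δ.Space)) : Prop where
  map_zero : ∀ p, Θ (p, 0) = Δ.basePt
  map_one : ∀ p, Θ (p, 1) = p
  follows_src : Δ.Follows (fun t => Θ (⟨_, Δ.src_mem_closedEdge _⟩, t)) (Δ.bdry.take k)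
  follows_tgt : Δ.Follows (fun t => Θ (⟨_, Δ.tgt_mem_closedEdge _⟩, t))
    ((Δ.bdry.drop (k + 1)).map Δ.rev).reverse

end VanKampenDiagram

/-! ### Combed normal fillings -/

/-- The set of 1-cells (undirected edges) of the Cayley complex. -/
def CayleyEdge (P : SymmetrizedPresentation G A) : Type (max u v) :=
  Quot fun e e' : P.cayleyGraph.E => e' = P.cayleyGraph.rev e

/-- A combed normal filling: simple normal forms `y g`, and for each undirected edge `e` of the
Cayley complex, with a chosen direction `(g, a)`, a van Kampen diagram for the word
`y_g a y_{ga}⁻¹` with an edge homotopy of the edge that corresponds to `a`. -/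
structure CombedNormalFilling (P : SymmetrizedPresentation G A) where
  y : G → List A
  y_val : ∀ g, P.wordVal (y g) = g
  y_simple : ∀ g, P.IsSimpleWord (y g)
  dir : CayleyEdge P → P.cayleyGraph.E
  dir_mk : ∀ e, Quot.mk _ (dir e) = e
  diagram : CayleyEdge P → VanKampenDiagram P
  bdryWord_eq : ∀ e, (diagram e).bdryWord = y (P.cayleyGraph.src (dir e)) ++
    (dir e).2 :: P.wordInv (y (P.cayleyGraph.tgt (dir e)))
  index : ∀ e, Fin (diagram e).bdry.length
  index_eq : ∀ e, (index e : ℕ) = (y (P.cayleyGraph.src (dir e))).length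
  homotopy : ∀ e, C((diagram e).closedEdge (diagram e).bdry[index e] × I, (diagram e).Space)
  isEdgeHomotopy : ∀ e, (diagram e).IsEdgeHomotopy (index e) (homotopy e)
  /-- Let `g` be an endpoint of `e` and of `e'`, and let `a` and `a'` be the corresponding endpoints
  of the distinguished boundary edges of the two diagrams.  Then the homotopy paths to these project
  to the same path, with the same parametrization, in the 1-skeleton of the Cayley complex. -/
  consistent : ∀ (e e' : CayleyEdge P) (g : G)
    (a : (diagram e).closedEdge (diagram e).bdry[index e])
    (a' : (diagram e').closedEdge (diagram e').bdry[index e']),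
    (g = P.cayleyGraph.src (dir e) ∧
        (a : (diagram e).Space) =
          (diagram e).vertexPt ((diagram e).src (diagram e).bdry[index e]) ∨
      g = P.cayleyGraph.tgt (dir e) ∧
        (a : (diagram e).Space) =
          (diagram e).vertexPt ((diagram e).tgt (diagram e).bdry[index e])) →
    (g = P.cayleyGraph.src (dir e') ∧
        (a' : (diagram e').Space) =
          (diagram e').vertexPt ((diagram e').src (diagram e').bdry[index e']) ∨
      g = P.cayleyGraph.tgt (dir e') ∧
        (a' : (diagram e').Space) =
          (diagram e').vertexPt ((diagram e').tgt (diagram e').bdry[index e'])) →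
    ∀ t : I, ∃ (q : (diagram e).toDGraph.Point) (q' : (diagram e').toDGraph.Point),
      (diagram e).incl q = homotopy e (a, t) ∧ (diagram e').incl q' = homotopy e' (a', t) ∧
        (diagram e).proj.map q = (diagram e').proj.map q'

/-! ### The three inequalities -/

/-- The intrinsic tame filling inequality for `f`. -/
def IntrinsicTameFilling (P : SymmetrizedPresentation G A) (f : QuarterNat → QuarterNat) : Prop :=
  ∀ l : List A, P.wordVal l = 1 →
    ∃ Δ : VanKampenDiagram P, Δ.bdryWord = l ∧
      ∃ Ψ : C(Δ.boundary × I, Δ.Space), Δ.IsVanKampenHomotopy Ψ ∧ Δ.IsTame f Ψ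

/-- The intrinsic relaxed tame filling inequality for `f`. -/
def IntrinsicRelaxedTameFilling (P : SymmetrizedPresentation G A)
    (f : QuarterNat → QuarterNat) : Prop :=
  ∀ l : List A, P.wordVal l = 1 →
    ∃ Δ : VanKampenDiagram P, Δ.bdryWord = l ∧
      ∃ Φ : C(Circle Δ.bdry.length × I, Δ.Space), Δ.IsDiskHomotopy Φ ∧ Δ.IsTame f Φ

/-- The intrinsic geodesic tame normal inequality for `f`. -/
def IntrinsicGeodesicTameNormal (P : SymmetrizedPresentation G A)
    (f : QuarterNat → QuarterNat) : Prop :=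
  ∃ F : CombedNormalFilling P, (∀ g, P.IsGeodesicWord (F.y g)) ∧
    ∀ e, (F.diagram e).IsTame f (F.homotopy e)

end TameFilling

/-! Every loss along the way is an additive constant, absorbed by `shift f`, the function n ↦ f(n +
3) + 5; it stays in the same Lipschitz class (`LipschitzEquivalent.shift`).

(1) ⇒ (2): a van Kampen homotopy composed with the boundary circuit is a disk homotopy with the same
paths.

(2) ⇒ (3): choose geodesic normal forms y_g and take a diagram for y_g a y_{ga}⁻¹ with a tame disk
homotopy. Stretch the distinguished edge over the whole circuit; a point of the edge is reached by
following the disk homotopy to the corresponding boundary point and then sliding along the boundary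
to the edge (`exists_edgeHomotopy`). Both ends of the edge correspond to the basepoint, so only the
slides along y_g and y_{ga} remain there. Diagrams map to the Cayley graph without increasing
distances, so the two sides are geodesics in the diagram and a slide moves away from the basepoint
up to a bounded error. Tameness survives because f(m) ≥ m - 2 at the relevant distances m, a bound
that tame paths inside the 1-skeleton force (`dist_le_of_isTamePath`).

(3) ⇒ (1): the seashell construction. For a word w representing the identity, the diagrams of the
successive edges of the path w in the Cayley graph are glued along their common sides, the normal
forms of the prefixes of w. Each gluing is a wedge at the base vertices followed by folds of edge
pairs (`exists_glue`). As the glued sides are geodesics with the same label, only vertices at equal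
distance are identified, so distances from the base vertex, and with them tameness, are preserved.
The homotopies agree along the glued sides, because normal forms are simple and so the consistency
condition fixes the parametrization (`exists_param`).

The homotopies thus obtained are indexed by the boundary circuit, and two visits to the same
boundary vertex v may carry different paths. The boundary between the two visits belongs to a part
of the diagram that is attached only at v; the separation comes from the vanishing of first
cohomology modulo 2, which follows from the Euler formula. Collapsing this part to v turns the
homotopies between the visits into a strip that joins the two paths to v (`tameStrip_line_of_lt`);
tameness survives since a path into or out of the part passes through v. Inserting such strips and
straightening the result gives homotopies that depend only on points of the boundary
(`ClosedFan.exists_vanKampenHomotopy`). -/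

open scoped unitInterval

namespace TameFilling

universe u v w x

/-! ### Realizations of graphs, edge paths, and coarse distance on graphs -/

namespace DGraph
variable {Γ : DGraph.{u, v}}

theorem edgePoint_zero (e : Γ.E) : Γ.edgePoint e 0 = Γ.vertex (Γ.src e) :=
  Quot.sound (Glue.start e)

theorem edgePoint_rev (e : Γ.E) (s : I) : Γ.edgePoint (Γ.rev e) s = Γ.edgePoint e (σ s) := by
  have h : Γ.edgePoint e (σ s) = Γ.edgePoint (Γ.rev e) (σ (σ s)) := Quot.sound (Glue.flip e (σ s))
  rw [h, unitInterval.symm_symm]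

theorem src_rev (e : Γ.E) : Γ.src (Γ.rev e) = Γ.tgt e := rfl

theorem tgt_rev (e : Γ.E) : Γ.tgt (Γ.rev e) = Γ.src e := by rw [tgt, Γ.rev_rev]

theorem edgePoint_one (e : Γ.E) : Γ.edgePoint e 1 = Γ.vertex (Γ.tgt e) := by
  rw [← src_rev, ← edgePoint_zero, edgePoint_rev, unitInterval.symm_zero]

theorem point_ind {p : Γ.Point → Prop} (hv : ∀ a, p (Γ.vertex a))
    (he : ∀ e s, p (Γ.edgePoint e s)) (x : Γ.Point) : p x := by
  induction x using Quot.ind with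
  | mk y => rcases y with a | ⟨e, s⟩ <;> [exact hv a; exact he e s]

theorem continuous_edgePoint (e : Γ.E) : Continuous (Γ.edgePoint e) := by
  let _ : TopologicalSpace Γ.V := ⊥
  let _ : TopologicalSpace Γ.E := ⊥
  have h : Continuous (Quot.mk Γ.Glue) := continuous_quot_mk
  exact h.comp (continuous_inr.comp (by fun_prop))

/-- The realization is a quotient of a discrete set of vertices and a disjoint union of intervals,
so vertices impose no condition. -/
theorem continuous_of_edges {X : Type*} [TopologicalSpace X] {f : Γ.Point → X}
    (h : ∀ e, Continuous fun s => f (Γ.edgePoint e s)) : Continuous f := by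
  let _ : TopologicalSpace Γ.V := ⊥
  let _ : TopologicalSpace Γ.E := ⊥
  have : DiscreteTopology Γ.V := ⟨rfl⟩
  have : DiscreteTopology Γ.E := ⟨rfl⟩
  refine (isQuotientMap_quot_mk (r := Γ.Glue)).continuous_iff.2 (continuous_sum_dom.2 ⟨?_, ?_⟩)
  · exact continuous_of_discreteTopology
  · exact continuous_prod_of_discrete_left.2 h

/-! Edge paths. -/

/-- The edge list `l` is a path that starts at `a`. -/
def IsWalk (Γ : DGraph.{u, v}) : Γ.V → List Γ.E → Prop
  | _, [] => True
  | a, e :: l => Γ.src e = a ∧ Γ.IsWalk (Γ.tgt e) l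

/-- The end of the edge path `l` that starts at `a`. -/
def walkEnd (Γ : DGraph.{u, v}) : Γ.V → List Γ.E → Γ.V
  | a, [] => a
  | _, e :: l => Γ.walkEnd (Γ.tgt e) l

/-- The reversed edge path. -/
def walkRev (Γ : DGraph.{u, v}) (l : List Γ.E) : List Γ.E := (l.map Γ.rev).reverse

theorem walkEnd_append (a : Γ.V) (l l' : List Γ.E) :
    Γ.walkEnd a (l ++ l') = Γ.walkEnd (Γ.walkEnd a l) l' := by
  induction l generalizing a with
  | nil => rfl
  | cons e l ih => exact ih _

theorem isWalk_append {a : Γ.V} {l l' : List Γ.E} :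
    Γ.IsWalk a (l ++ l') ↔ Γ.IsWalk a l ∧ Γ.IsWalk (Γ.walkEnd a l) l' := by
  induction l generalizing a with
  | nil => simp [IsWalk, walkEnd]
  | cons e l ih => simp [IsWalk, walkEnd, ih, and_assoc]

theorem walkRev_cons (e : Γ.E) (l : List Γ.E) : Γ.walkRev (e :: l) = Γ.walkRev l ++ [Γ.rev e] := by
  simp [walkRev]

theorem walkEnd_walkRev {a : Γ.V} {l : List Γ.E} (h : Γ.IsWalk a l) :
    Γ.walkEnd (Γ.walkEnd a l) (Γ.walkRev l) = a := by
  induction l generalizing a with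
  | nil => rfl
  | cons e l ih =>
    rw [walkRev_cons, walkEnd_append]
    exact (tgt_rev e).trans h.1

theorem IsWalk.walkRev {a : Γ.V} {l : List Γ.E} (h : Γ.IsWalk a l) :
    Γ.IsWalk (Γ.walkEnd a l) (Γ.walkRev l) := by
  induction l generalizing a with
  | nil => trivial
  | cons e l ih =>
    rw [walkRev_cons, isWalk_append]
    exact ⟨ih h.2, (walkEnd_walkRev h.2).symm, trivial⟩

theorem IsWalk.src_getElem {a : Γ.V} {l : List Γ.E} (h : Γ.IsWalk a l) {k : ℕ} (hk : k < l.length) :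
    Γ.src l[k] = Γ.walkEnd a (l.take k) := by
  induction l generalizing a k with
  | nil => simp at hk
  | cons e l ih =>
    cases k with
    | zero => exact h.1
    | succ k => simpa [walkEnd] using ih h.2 (by simpa using hk)

theorem IsWalk.tgt_getElem {a : Γ.V} {l : List Γ.E} (_ : Γ.IsWalk a l) {k : ℕ}
    (hk : k < l.length) : Γ.tgt l[k] = Γ.walkEnd a (l.take (k + 1)) := by
  rw [List.take_add_one, walkEnd_append]
  simp [hk, walkEnd]

theorem IsWalk.take {a : Γ.V} {l : List Γ.E} (h : Γ.IsWalk a l) (k : ℕ) :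
    Γ.IsWalk a (l.take k) := by
  rw [← List.take_append_drop k l, isWalk_append] at h
  exact h.1

theorem IsWalk.drop {a : Γ.V} {l : List Γ.E} (h : Γ.IsWalk a l) (k : ℕ) :
    Γ.IsWalk (Γ.walkEnd a (l.take k)) (l.drop k) := by
  rw [← List.take_append_drop k l, isWalk_append] at h
  exact h.2

theorem isWalk_of_getElem {a : Γ.V} {l : List Γ.E} (h0 : ∀ e ∈ l.head?, Γ.src e = a)
    (h : ∀ i (hi : i + 1 < l.length), Γ.src l[i + 1] = Γ.tgt l[i]) : Γ.IsWalk a l := by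
  induction l generalizing a with
  | nil => trivial
  | cons e l ih =>
    refine ⟨h0 e (by simp), ih ?_ fun i hi => h (i + 1) (by simpa using hi)⟩
    intro e' he'
    rcases l with _ | ⟨d, l⟩
    · simp at he'
    · have := h 0 (by simp)
      simp at this he'
      rw [← he', this]

theorem walkPoint_of_nonpos {a : Γ.V} {l : List Γ.E} (h : Γ.IsWalk a l) {t : ℝ} (ht : t ≤ 0) :
    Γ.walkPoint a l t = Γ.vertex a := by
  cases l with
  | nil => rfl
  | cons e l =>
    rw [walkPoint, if_pos (by linarith), Set.projIcc_of_le_left _ ht, ← h.1]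
    exact edgePoint_zero e

theorem walkPoint_natCast_add {a : Γ.V} {l : List Γ.E} (h : Γ.IsWalk a l) {k : ℕ}
    (hk : k < l.length) (s : I) : Γ.walkPoint a l (k + s) = Γ.edgePoint l[k] s := by
  induction l generalizing a k with
  | nil => simp at hk
  | cons e l ih =>
    rw [walkPoint]
    cases k with
    | zero =>
      have : ((0 : ℕ) : ℝ) + s ≤ 1 := by simpa using s.2.2
      rw [if_pos this]
      simp
    | succ k =>
      have hs := s.2.1
      split_ifs with h1
      -- Here k = 0 and s = 0: the time of a junction, which `walkPoint` attributes to the end of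
      -- the first edge rather than to the start of the second.
      · have hk0 : (k : ℝ) = 0 := le_antisymm (by push_cast at h1; linarith) (Nat.cast_nonneg k)
        have hs0 : s = 0 := Subtype.ext (le_antisymm (by push_cast at h1; push_cast; linarith) hs)
        obtain rfl : k = 0 := by exact_mod_cast hk0
        have hl : 0 < l.length := by simpa using hk
        subst hs0
        have h3 : Γ.src l[0] = Γ.tgt e := by simpa [walkEnd] using h.2.src_getElem hl
        rw [List.getElem_cons_succ, edgePoint_zero, h3, ← edgePoint_one]
        simp
      · rw [show ((k + 1 : ℕ) : ℝ) + s - 1 = k + s by push_cast; ring]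
        exact ih h.2 (by simpa using hk)

theorem walkPoint_of_length_le (a : Γ.V) {l : List Γ.E} {t : ℝ} (ht : l.length ≤ t) :
    Γ.walkPoint a l t = Γ.vertex (Γ.walkEnd a l) := by
  induction l generalizing a t with
  | nil => rfl
  | cons e l ih =>
    simp only [List.length_cons, Nat.cast_add, Nat.cast_one] at ht
    rw [walkPoint, walkEnd]
    split_ifs with h1
    · have h0 : (l.length : ℝ) = 0 := le_antisymm (by linarith) (Nat.cast_nonneg _)
      have h0' : l = [] := by simpa using h0
      subst h0'
      simp only [List.length_nil, Nat.cast_zero, zero_add] at ht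
      rw [Set.projIcc_of_right_le _ ht]
      exact edgePoint_one e
    · exact ih _ (by linarith)

theorem walkPoint_natCast {a : Γ.V} {l : List Γ.E} (h : Γ.IsWalk a l) (k : ℕ) :
    Γ.walkPoint a l k = Γ.vertex (Γ.walkEnd a (l.take k)) := by
  by_cases hk : k < l.length
  · have := walkPoint_natCast_add h hk 0
    rw [edgePoint_zero, h.src_getElem hk] at this
    simpa using this
  · push Not at hk
    rw [walkPoint_of_length_le a (by exact_mod_cast hk), List.take_of_length_le hk]

theorem continuous_walkPoint {a : Γ.V} {l : List Γ.E} (h : Γ.IsWalk a l) :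
    Continuous (Γ.walkPoint a l) := by
  induction l generalizing a with
  | nil => exact continuous_const
  | cons e l ih =>
    have h1 : Γ.walkPoint a (e :: l) = fun t : ℝ =>
        if t ≤ 1 then Γ.edgePoint e (Set.projIcc 0 1 zero_le_one t)
        else Γ.walkPoint (Γ.tgt e) l (t - 1) := by
      funext t; rw [walkPoint]
    rw [h1]
    refine Continuous.if_le ((continuous_edgePoint e).comp continuous_projIcc)
      ((ih h.2).comp (by fun_prop)) continuous_id continuous_const ?_
    rintro t rfl
    rw [walkPoint_of_nonpos h.2 (by simp), Set.projIcc_right]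
    exact edgePoint_one e

/-- Reduces a time on an edge path to a position on one edge. At t = n the floor would be out of
range, so the end of the last edge is used instead. -/
theorem exists_natCast_add {n : ℕ} (hn : 0 < n) {t : ℝ} (h0 : 0 ≤ t) (h1 : t ≤ n) :
    ∃ k < n, ∃ s : I, t = k + s := by
  rcases h1.eq_or_lt with h | h
  · refine ⟨n - 1, by omega, 1, ?_⟩
    rw [h, Nat.cast_sub hn]; simp
  · refine ⟨⌊t⌋₊, (Nat.floor_lt h0).2 h, ⟨t - ⌊t⌋₊, ?_, ?_⟩, by simp⟩
    · linarith [Nat.floor_le h0]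
    · linarith [Nat.lt_floor_add_one t]

theorem walkPoint_take {a : Γ.V} {l : List Γ.E} (h : Γ.IsWalk a l) {k : ℕ} (hk : k ≤ l.length)
    {t : ℝ} (h1 : t ≤ k) : Γ.walkPoint a (l.take k) t = Γ.walkPoint a l t := by
  rcases le_total t 0 with h0 | h0
  · rw [walkPoint_of_nonpos h h0, walkPoint_of_nonpos (h.take k) h0]
  rcases Nat.eq_zero_or_pos k with rfl | hk0
  · rw [walkPoint_of_nonpos h (by simpa using h1), walkPoint_of_nonpos (h.take 0) (by simpa using h1)]
  obtain ⟨j, hj, s, rfl⟩ := exists_natCast_add hk0 h0 h1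
  rw [walkPoint_natCast_add (h.take k) (by simp; omega), walkPoint_natCast_add h (by omega)]
  simp

theorem walkPoint_walkRev {a : Γ.V} {l : List Γ.E} (h : Γ.IsWalk a l) {t : ℝ} (h0 : 0 ≤ t)
    (h1 : t ≤ l.length) :
    Γ.walkPoint (Γ.walkEnd a l) (Γ.walkRev l) t = Γ.walkPoint a l (l.length - t) := by
  rcases Nat.eq_zero_or_pos l.length with hl | hl
  · obtain rfl : l = [] := by simpa using hl
    rfl
  obtain ⟨k, hk, s, rfl⟩ := exists_natCast_add hl h0 h1
  have h2 : (l.length : ℝ) - (k + s) = ((l.length - 1 - k : ℕ) : ℝ) + (σ s : I) := by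
    rw [Nat.cast_sub (by omega), Nat.cast_sub hl, unitInterval.coe_symm_eq]; push_cast; ring
  rw [h2, walkPoint_natCast_add h (by omega),
    walkPoint_natCast_add h.walkRev (by simpa [DGraph.walkRev] using hk)]
  simp only [DGraph.walkRev, List.getElem_reverse, List.getElem_map, List.length_map]
  exact edgePoint_rev _ _

theorem Hom.tgt_onE {Γ' : DGraph.{w, x}} (φ : Hom Γ Γ') (e : Γ.E) :
    Γ'.tgt (φ.onE e) = φ.onV (Γ.tgt e) := by
  rw [tgt, φ.rev_onE, φ.src_onE]; rfl

theorem Hom.map_walkPoint {Γ' : DGraph.{w, x}} (φ : Hom Γ Γ') (a : Γ.V) (l : List Γ.E) (t : ℝ) :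
    φ.map (Γ.walkPoint a l t) = Γ'.walkPoint (φ.onV a) (l.map φ.onE) t := by
  induction l generalizing a t with
  | nil => rfl
  | cons e l ih =>
    rw [walkPoint, List.map_cons, walkPoint]
    split_ifs
    · rfl
    · rw [ih, φ.tgt_onE]

theorem Hom.isWalk {Γ' : DGraph.{w, x}} (φ : Hom Γ Γ') {a : Γ.V} {l : List Γ.E}
    (h : Γ.IsWalk a l) : Γ'.IsWalk (φ.onV a) (l.map φ.onE) := by
  induction l generalizing a with
  | nil => trivial
  | cons e l ih =>
    refine ⟨by rw [φ.src_onE, h.1], ?_⟩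
    rw [φ.tgt_onE]
    exact ih h.2

theorem Hom.walkEnd {Γ' : DGraph.{w, x}} (φ : Hom Γ Γ') (a : Γ.V) (l : List Γ.E) :
    Γ'.walkEnd (φ.onV a) (l.map φ.onE) = φ.onV (Γ.walkEnd a l) := by
  induction l generalizing a with
  | nil => rfl
  | cons e l ih =>
    rw [List.map_cons, DGraph.walkEnd, φ.tgt_onE, ih]; rfl

/-- The function on the realization with the given values at the vertices that is linear on edges,
up to the bump `s (1 - s) β`. -/
def height (Γ : DGraph.{u, v}) (φ : Γ.V → ℝ) (β : Γ.E → ℝ) (hβ : ∀ e, β (Γ.rev e) = β e) :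
    Γ.Point → ℝ :=
  Quot.lift (Sum.elim φ fun z => (1 - z.2) * φ (Γ.src z.1) + z.2 * φ (Γ.tgt z.1) +
    z.2 * (1 - z.2) * β z.1) (by
    rintro _ _ (e | ⟨e, s⟩)
    · simp
    · simp [unitInterval.coe_symm_eq, hβ, tgt_rev, src_rev]; ring)

theorem height_edgePoint (φ : Γ.V → ℝ) (β : Γ.E → ℝ) (hβ : ∀ e, β (Γ.rev e) = β e) (e : Γ.E)
    (s : I) : Γ.height φ β hβ (Γ.edgePoint e s) =
      (1 - s) * φ (Γ.src e) + s * φ (Γ.tgt e) + s * (1 - s) * β e := rfl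

theorem continuous_height (φ : Γ.V → ℝ) (β : Γ.E → ℝ) (hβ : ∀ e, β (Γ.rev e) = β e) :
    Continuous (Γ.height φ β hβ) :=
  continuous_of_edges fun e => by simp only [height_edgePoint]; fun_prop

/-- A path that visits no vertex twice is injective. -/
theorem walkPoint_injOn {a : Γ.V} {l : List Γ.E} (h : Γ.IsWalk a l)
    (hn : ∀ i ≤ l.length, ∀ j ≤ l.length,
      Γ.walkEnd a (l.take i) = Γ.walkEnd a (l.take j) → i = j)
    {t t' : ℝ} (ht : t ∈ Set.Icc (0 : ℝ) l.length) (ht' : t' ∈ Set.Icc (0 : ℝ) l.length)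
    (htt : Γ.walkPoint a l t = Γ.walkPoint a l t') : t = t' := by
  classical
  rcases Nat.eq_zero_or_pos l.length with hl | hl
  · rw [hl] at ht ht'
    simp at ht ht'
    rw [ht, ht']
  -- With φ the index of a vertex on the path (and 0 off the path), the piecewise linear extension
  -- of φ is a left inverse of the path.
  let φ : Γ.V → ℝ := fun b =>
    if hb : ∃ i ≤ l.length, Γ.walkEnd a (l.take i) = b then (hb.choose : ℝ) else 0
  have hφ : ∀ i ≤ l.length, φ (Γ.walkEnd a (l.take i)) = i := by
    intro i hi
    have hb : ∃ j ≤ l.length, Γ.walkEnd a (l.take j) = Γ.walkEnd a (l.take i) := ⟨i, hi, rfl⟩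
    simp only [φ, dif_pos hb]
    exact_mod_cast hn _ hb.choose_spec.1 _ hi hb.choose_spec.2
  have key : ∀ t ∈ Set.Icc (0 : ℝ) l.length,
      Γ.height φ (fun _ => 0) (fun _ => rfl) (Γ.walkPoint a l t) = t := by
    rintro t ⟨h0, h1⟩
    obtain ⟨k, hk, s, rfl⟩ := exists_natCast_add hl h0 h1
    rw [walkPoint_natCast_add h hk, height_edgePoint, h.src_getElem hk, h.tgt_getElem hk,
      hφ k hk.le, hφ (k + 1) hk]
    push_cast; ring
  rw [← key t ht, htt, key t' ht']

theorem coarse_vertex (b a : Γ.V) : Γ.coarse b (Γ.vertex a) = Γ.simple.dist b a := rfl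

theorem simple_adj {a b : Γ.V} :
    Γ.simple.Adj a b ↔ a ≠ b ∧ ∃ e, Γ.src e = a ∧ Γ.tgt e = b := by
  rw [simple, SimpleGraph.fromRel_adj]
  refine and_congr_right fun _ => ⟨?_, Or.inl⟩
  rintro (h | ⟨e, h1, h2⟩)
  · exact h
  · exact ⟨Γ.rev e, h2, (tgt_rev e).trans h1⟩

theorem dist_tgt_le (hc : Γ.simple.Connected) (b : Γ.V) (e : Γ.E) :
    Γ.simple.dist b (Γ.tgt e) ≤ Γ.simple.dist b (Γ.src e) + 1 := by
  by_cases h : Γ.src e = Γ.tgt e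
  · rw [h]; omega
  · have h1 : Γ.simple.Adj (Γ.src e) (Γ.tgt e) := simple_adj.2 ⟨h, e, rfl, rfl⟩
    have := hc.dist_triangle (u := b) (v := Γ.src e) (w := Γ.tgt e)
    rwa [SimpleGraph.dist_eq_one_iff_adj.2 h1] at this

theorem dist_src_le (hc : Γ.simple.Connected) (b : Γ.V) (e : Γ.E) :
    Γ.simple.dist b (Γ.src e) ≤ Γ.simple.dist b (Γ.tgt e) + 1 := by
  simpa [src_rev, tgt_rev] using dist_tgt_le hc b (Γ.rev e)

/-- A function that grows by at most `1` along each edge is bounded by the distance. -/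
theorem le_dist_of_step (hc : Γ.simple.Connected) {b : Γ.V} {D : Γ.V → ℕ} (h0 : D b = 0)
    (h : ∀ e, D (Γ.tgt e) ≤ D (Γ.src e) + 1) (a : Γ.V) : D a ≤ Γ.simple.dist b a := by
  obtain ⟨p, hp⟩ := hc.exists_walk_length_eq_dist b a
  rw [← hp]
  have : ∀ {c d : Γ.V} (p : Γ.simple.Walk c d), D d ≤ D c + p.length := by
    intro c d p
    induction p with
    | nil => simp
    | cons hadj p ih =>
      obtain ⟨_, e, rfl, rfl⟩ := simple_adj.1 hadj
      have := h e
      simp only [SimpleGraph.Walk.length_cons]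
      omega
  simpa [h0] using this p

theorem dist_walkEnd_le (hc : Γ.simple.Connected) (b : Γ.V) {a : Γ.V} {l : List Γ.E}
    (h : Γ.IsWalk a l) : Γ.simple.dist b (Γ.walkEnd a l) ≤ Γ.simple.dist b a + l.length := by
  induction l generalizing a with
  | nil => simp [DGraph.walkEnd]
  | cons e l ih =>
    have h1 := ih h.2
    have h2 := dist_tgt_le hc b e
    rw [h.1] at h2
    simp only [DGraph.walkEnd, List.length_cons]
    omega

theorem coarse_edgePoint_zero (b : Γ.V) (e : Γ.E) :
    Γ.coarse b (Γ.edgePoint e 0) = Γ.simple.dist b (Γ.src e) := by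
  rw [edgePoint_zero, coarse_vertex]

theorem coarse_edgePoint_one (b : Γ.V) (e : Γ.E) :
    Γ.coarse b (Γ.edgePoint e 1) = Γ.simple.dist b (Γ.tgt e) := by
  rw [edgePoint_one, coarse_vertex]

theorem coarse_edgePoint (b : Γ.V) (e : Γ.E) {s : I} (h0 : s ≠ 0) (h1 : s ≠ 1) :
    Γ.coarse b (Γ.edgePoint e s) =
      (min (Γ.simple.dist b (Γ.src e)) (Γ.simple.dist b (Γ.tgt e)) : ℕ) + 1 / 2 := by
  simp only [coarse, edgePoint, preCoarse, if_neg h0, if_neg h1]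

/-- Together with `coarse_edgePoint_le`: on a closed edge the coarse distance lies between the
smaller end value and that value plus 1. All later estimates of coarse distances in the 1-skeleton
are reduced in this way to estimates between integers. -/
theorem min_le_coarse_edgePoint (b : Γ.V) (e : Γ.E) (s : I) :
    ((min (Γ.simple.dist b (Γ.src e)) (Γ.simple.dist b (Γ.tgt e)) : ℕ) : ℚ) ≤
      Γ.coarse b (Γ.edgePoint e s) := by
  by_cases h0 : s = 0
  · rw [h0, coarse_edgePoint_zero]; exact_mod_cast min_le_left _ _
  by_cases h1 : s = 1
  · rw [h1, coarse_edgePoint_one]; exact_mod_cast min_le_right _ _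
  · rw [coarse_edgePoint b e h0 h1]; linarith

theorem coarse_edgePoint_le (hc : Γ.simple.Connected) (b : Γ.V) (e : Γ.E) (s : I) :
    Γ.coarse b (Γ.edgePoint e s) ≤
      (min (Γ.simple.dist b (Γ.src e)) (Γ.simple.dist b (Γ.tgt e)) : ℕ) + 1 := by
  have h2 := dist_tgt_le hc b e
  have h3 := dist_src_le hc b e
  by_cases h0 : s = 0
  · rw [h0, coarse_edgePoint_zero]; norm_cast; omega
  by_cases h1 : s = 1
  · rw [h1, coarse_edgePoint_one]; norm_cast; omega
  · rw [coarse_edgePoint b e h0 h1]; linarith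

end DGraph

/-! ### Topology of the 2-complex and its boundary circuit -/

namespace LabelledMap
variable {A : Type v} {inv : A → A} {Δ : LabelledMap.{v} A inv}

theorem edgePt_zero (e : Δ.E) : Δ.edgePt e 0 = Δ.vertexPt (Δ.src e) :=
  congrArg Δ.incl (DGraph.edgePoint_zero e)

theorem edgePt_one (e : Δ.E) : Δ.edgePt e 1 = Δ.vertexPt (Δ.toDGraph.tgt e) :=
  congrArg Δ.incl (DGraph.edgePoint_one e)

theorem edgePt_rev (e : Δ.E) (s : I) : Δ.edgePt (Δ.rev e) s = Δ.edgePt e (σ s) :=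
  congrArg Δ.incl (DGraph.edgePoint_rev e s)

/-- The point of the inner face to the right of `c` at height `r` of the cone, above the point
at `s` on the edge `c`. -/
def conePt (Δ : LabelledMap.{v} A inv) (c : Δ.Corner) (s r : I) : Δ.Space := Quot.mk _ (.inr (c, s, r))

theorem conePt_zero (c : Δ.Corner) (s : I) : Δ.conePt c s 0 = Δ.edgePt c.1 s :=
  Quot.sound (Glue.rim c s)

theorem space_ind {p : Δ.Space → Prop} (hv : ∀ a, p (Δ.vertexPt a))
    (he : ∀ e s, p (Δ.edgePt e s)) (hc : ∀ c s r, p (Δ.conePt c s r)) (x : Δ.Space) : p x := by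
  induction x using Quot.ind with
  | mk y =>
    rcases y with q | ⟨c, s, r⟩
    · exact DGraph.point_ind (p := fun q => p (Δ.incl q)) hv he q
    · exact hc c s r

theorem continuous_incl : Continuous Δ.incl := by
  let _ : TopologicalSpace Δ.Corner := ⊥
  have h : Continuous (Quot.mk Δ.Glue) := continuous_quot_mk
  exact h.comp continuous_inl

theorem continuous_edgePt (e : Δ.E) : Continuous (Δ.edgePt e) :=
  continuous_incl.comp (DGraph.continuous_edgePoint e)

theorem continuous_conePt (c : Δ.Corner) : Continuous fun z : I × I => Δ.conePt c z.1 z.2 := by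
  let _ : TopologicalSpace Δ.Corner := ⊥
  have h : Continuous (Quot.mk Δ.Glue) := continuous_quot_mk
  exact h.comp (continuous_inr.comp (by fun_prop))

theorem continuous_of_cells {X : Type*} [TopologicalSpace X] {f : Δ.Space → X}
    (he : ∀ e, Continuous fun s => f (Δ.edgePt e s))
    (hc : ∀ c, Continuous fun z : I × I => f (Δ.conePt c z.1 z.2)) : Continuous f := by
  let _ : TopologicalSpace Δ.Corner := ⊥
  have : DiscreteTopology Δ.Corner := ⟨rfl⟩
  refine (isQuotientMap_quot_mk (r := Δ.Glue)).continuous_iff.2 (continuous_sum_dom.2 ⟨?_, ?_⟩)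
  · exact DGraph.continuous_of_edges he
  · exact continuous_prod_of_discrete_left.2 hc

/-- The function on the 2-complex given by `DGraph.height` on the 1-skeleton and extended to the
cones with value `m` at the apices. -/
def height (Δ : LabelledMap.{v} A inv) (φ : Δ.V → ℝ) (β m : Δ.E → ℝ)
    (hβ : ∀ e, β (Δ.rev e) = β e) (hm : ∀ e ∉ Δ.bdry, m (Δ.next e) = m e) : Δ.Space → ℝ :=
  Quot.lift (Sum.elim (Δ.toDGraph.height φ β hβ) fun z =>
    (1 - z.2.2) * Δ.toDGraph.height φ β hβ (Δ.toDGraph.edgePoint z.1.1 z.2.1) + z.2.2 * m z.1.1) (by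
    rintro _ _ (⟨c, s⟩ | ⟨c, c', h, r⟩ | ⟨c, s, s'⟩)
    · simp
    · simp [DGraph.height_edgePoint, h, hm c.1 c.2, Δ.src_next, DGraph.tgt]
    · simp)

section height
variable (φ : Δ.V → ℝ) (β m : Δ.E → ℝ) (hβ : ∀ e, β (Δ.rev e) = β e)
  (hm : ∀ e ∉ Δ.bdry, m (Δ.next e) = m e)

theorem height_vertexPt (a : Δ.V) : Δ.height φ β m hβ hm (Δ.vertexPt a) = φ a := rfl

theorem height_edgePt (e : Δ.E) (s : I) : Δ.height φ β m hβ hm (Δ.edgePt e s) =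
    (1 - s) * φ (Δ.src e) + s * φ (Δ.toDGraph.tgt e) + s * (1 - s) * β e := rfl

theorem height_conePt (c : Δ.Corner) (s r : I) : Δ.height φ β m hβ hm (Δ.conePt c s r) =
    (1 - r) * ((1 - s) * φ (Δ.src c.1) + s * φ (Δ.toDGraph.tgt c.1) + s * (1 - s) * β c.1) +
      r * m c.1 := rfl

theorem continuous_height : Continuous (Δ.height φ β m hβ hm) :=
  continuous_of_cells (fun e => by simp only [height_edgePt]; fun_prop)
    fun c => by simp only [height_conePt]; fun_prop

end height

open Classical in
/-- The point of the 1-skeleton under a point of the 2-complex, if there is one. -/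
noncomputable def toPoint (Δ : LabelledMap.{v} A inv) : Δ.Space → Option Δ.toDGraph.Point :=
  Quot.lift (Sum.elim some fun z =>
    if z.2.2 = 0 then some (Δ.toDGraph.edgePoint z.1.1 z.2.1) else none) (by
    rintro _ _ (⟨c, s⟩ | ⟨c, c', h, r⟩ | ⟨c, s, s'⟩)
    · simp
    · simp only [Sum.elim_inr]
      rw [DGraph.edgePoint_one, DGraph.edgePoint_zero, h, Δ.src_next, DGraph.tgt]
    · simp)

theorem toPoint_incl (p : Δ.toDGraph.Point) : Δ.toPoint (Δ.incl p) = some p := rfl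

theorem incl_injective : Function.Injective Δ.incl := fun p q h => by
  simpa [toPoint_incl] using congrArg Δ.toPoint h

open Classical in
/-- Closed edges are closed. -/
theorem isClosed_closedEdge (e : Δ.E) : IsClosed (Δ.closedEdge e) := by
  -- The closed edge is exhibited as the zero set of a continuous function: φ vanishes at its ends
  -- only, the bump β vanishes on this edge only, and the value 1 at the apices makes the function
  -- positive off the 1-skeleton.
  let φ : Δ.V → ℝ := fun a => if a = Δ.src e ∨ a = Δ.toDGraph.tgt e then 0 else 1
  let β : Δ.E → ℝ := fun d => if d = e ∨ d = Δ.rev e then 0 else 1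
  have hβ : ∀ d, β (Δ.rev d) = β d := fun d => by
    have h1 : Δ.rev d = e ↔ d = Δ.rev e :=
      ⟨fun h => by rw [← h, Δ.rev_rev], fun h => by rw [h, Δ.rev_rev]⟩
    have h2 : Δ.rev d = Δ.rev e ↔ d = e :=
      ⟨fun h => by rw [← Δ.rev_rev d, h, Δ.rev_rev], fun h => by rw [h]⟩
    simp only [β, h1, h2, or_comm]
  have hφ : ∀ a, 0 ≤ φ a := fun a => by simp only [φ]; split_ifs <;> norm_num
  have hβ0 : ∀ a, 0 ≤ β a := fun a => by simp only [β]; split_ifs <;> norm_num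
  have hmem : ∀ a, φ a = 0 → Δ.vertexPt a ∈ Δ.closedEdge e := by
    intro a ha
    have : a = Δ.src e ∨ a = Δ.toDGraph.tgt e := by
      by_contra h
      simp [φ, h] at ha
    rcases this with rfl | rfl
    exacts [Δ.src_mem_closedEdge e, Δ.tgt_mem_closedEdge e]
  have hedge : ∀ (d : Δ.E) (s : I),
      (1 - (s : ℝ)) * φ (Δ.src d) + s * φ (Δ.toDGraph.tgt d) + s * (1 - s) * β d = 0 →
        Δ.edgePt d s ∈ Δ.closedEdge e := by
    intro d s h
    have hs := s.2.1
    have hs' : 0 ≤ 1 - (s : ℝ) := by linarith [s.2.2]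
    have t1 := mul_nonneg hs' (hφ (Δ.src d))
    have t2 := mul_nonneg hs (hφ (Δ.toDGraph.tgt d))
    have t3 := mul_nonneg (mul_nonneg hs hs') (hβ0 d)
    by_cases h0 : s = 0
    · subst h0; rw [edgePt_zero]; exact hmem _ (by simpa using h)
    by_cases h1 : s = 1
    · subst h1; rw [edgePt_one]; exact hmem _ (by simpa using h)
    have p0 : 0 < (s : ℝ) := lt_of_le_of_ne hs fun h => h0 (Subtype.ext h.symm)
    have p1 : 0 < 1 - (s : ℝ) := lt_of_le_of_ne hs' fun h => h1 (Subtype.ext (by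
      simp only [Set.Icc.coe_one]; linarith))
    have h3 : s * (1 - s) * β d = 0 := by linarith
    have h4 : β d = 0 := by
      rcases mul_eq_zero.1 h3 with h | h
      · exact absurd h (mul_pos p0 p1).ne'
      · exact h
    have : d = e ∨ d = Δ.rev e := by
      by_contra h
      simp [β, h] at h4
    rcases this with rfl | rfl
    · exact ⟨s, rfl⟩
    · exact ⟨σ s, (edgePt_rev e s).symm⟩
  have key : Δ.closedEdge e = {p | Δ.height φ β (fun _ => 1) hβ (fun _ _ => rfl) p = 0} := by
    ext p
    constructor
    · rintro ⟨s, rfl⟩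
      simp [height_edgePt, φ, β]
    · intro hp
      induction p using space_ind with
      | hv a => exact hmem a hp
      | he d s => exact hedge d s hp
      | hc c s r =>
        simp only [Set.mem_ofPred_eq, height_conePt] at hp
        have hs := s.2.1
        have hs' : 0 ≤ 1 - (s : ℝ) := by linarith [s.2.2]
        have hr := r.2.1
        have hr' : 0 ≤ 1 - (r : ℝ) := by linarith [r.2.2]
        have t1 := mul_nonneg hs' (hφ (Δ.src c.1))
        have t2 := mul_nonneg hs (hφ (Δ.toDGraph.tgt c.1))
        have t3 := mul_nonneg (mul_nonneg hs hs') (hβ0 c.1)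
        have t4 := mul_nonneg hr' (add_nonneg (add_nonneg t1 t2) t3)
        have hr0 : (r : ℝ) = 0 := by linarith
        obtain rfl : r = 0 := Subtype.ext hr0
        rw [conePt_zero]
        exact hedge _ _ (by simpa using hp)
  rw [key]
  exact isClosed_eq (continuous_height _ _ _ _ _) continuous_const

open Classical in
/-- The position on the edge `e`, extended continuously to the 2-complex. -/
noncomputable def coord (Δ : LabelledMap.{v} A inv) (e : Δ.E) (p : Δ.Space) : I :=
  Set.projIcc 0 1 zero_le_one (Δ.height (fun a => if a = Δ.src e then 0 else 1) (fun _ => 0)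
    (fun _ => 0) (fun _ => rfl) (fun _ _ => rfl) p)

theorem continuous_coord (e : Δ.E) : Continuous (Δ.coord e) :=
  continuous_projIcc.comp (continuous_height _ _ _ _ _)

theorem coord_edgePt {e : Δ.E} (h : Δ.toDGraph.tgt e ≠ Δ.src e) (s : I) :
    Δ.coord e (Δ.edgePt e s) = s := by
  simp [coord, height_edgePt, h]

theorem isWalk_bdry : Δ.toDGraph.IsWalk Δ.base Δ.bdry := by
  refine DGraph.isWalk_of_getElem Δ.bdry_base fun i hi => ?_
  have h := Δ.bdry_next i (by omega)
  rw [DGraph.tgt, ← Δ.src_next, h]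
  congr 2
  rw [Nat.mod_eq_of_lt hi]

theorem walkEnd_bdry : Δ.toDGraph.walkEnd Δ.base Δ.bdry = Δ.base := by
  rcases Nat.eq_zero_or_pos Δ.bdry.length with h | h
  · rw [List.length_eq_zero_iff.1 h]; rfl
  · have h1 := Δ.isWalk_bdry.tgt_getElem (k := Δ.bdry.length - 1) (by omega)
    rw [List.take_of_length_le (by omega)] at h1
    have h2 := Δ.bdry_next (Δ.bdry.length - 1) (by omega)
    have h3 := Δ.isWalk_bdry.src_getElem h
    rw [← h1, DGraph.tgt, ← Δ.src_next, h2]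
    have : (Δ.bdry.length - 1 + 1) % Δ.bdry.length = 0 := by
      rw [Nat.sub_add_cancel h, Nat.mod_self]
    simpa [this, DGraph.walkEnd] using h3

theorem coarseRat_vertexPt (a : Δ.V) :
    Δ.coarseRat (Δ.vertexPt a) = Δ.toDGraph.simple.dist Δ.base a := rfl

theorem coarseRat_conePt (c : Δ.Corner) (s : I) {r : I} (h : r ≠ 0) :
    Δ.coarseRat (Δ.conePt c s r) = (Δ.faceLow c.1 : ℚ) + 1 / 2 - 1 / 4 := by
  simp [coarseRat, conePt, preCoarse, h]

theorem coarseRat_basePt : Δ.coarseRat Δ.basePt = 0 := by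
  rw [basePt, coarseRat_vertexPt, SimpleGraph.dist_self, Nat.cast_zero]

end LabelledMap

/-! ### Lipschitz equivalence -/

/-- A natural number, as an element of `ℕ[1/4]`. -/
def QuarterNat.ofNat (k : ℕ) : QuarterNat := ⟨k, mem_quarterNat.2 ⟨4 * k, by push_cast; ring⟩⟩

@[simp]

theorem QuarterNat.coe_nonneg (n : QuarterNat) : (0 : ℚ) ≤ n := by
  obtain ⟨k, hk⟩ := mem_quarterNat.1 n.2
  rw [← hk]; positivity

/-- The function `n ↦ f (n + 3) + 5`. -/
def shift (f : QuarterNat → QuarterNat) (n : QuarterNat) : QuarterNat :=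
  f (n + QuarterNat.ofNat 3) + QuarterNat.ofNat 5

theorem coe_shift (f : QuarterNat → QuarterNat) (n : QuarterNat) :
    (shift f n : ℚ) = f (n + QuarterNat.ofNat 3) + 5 := rfl

theorem monotone_shift {f : QuarterNat → QuarterNat} (hf : Monotone f) : Monotone (shift f) := by
  intro m n h
  have h1 : m + QuarterNat.ofNat 3 ≤ n + QuarterNat.ofNat 3 := add_le_add_left h _
  have h2 : (f (m + QuarterNat.ofNat 3) : ℚ) ≤ f (n + QuarterNat.ofNat 3) := hf h1
  change (shift f m : ℚ) ≤ shift f n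
  rw [coe_shift, coe_shift]
  linarith

theorem le_shift {f : QuarterNat → QuarterNat} (hf : Monotone f) (n : QuarterNat) :
    (f n : ℚ) + 5 ≤ shift f n := by
  have h1 : n ≤ n + QuarterNat.ofNat 3 := by
    change (n : ℚ) ≤ n + 3
    linarith
  have h2 : (f n : ℚ) ≤ f (n + QuarterNat.ofNat 3) := hf h1
  rw [coe_shift]
  linarith

theorem self_le_shift {f : QuarterNat → QuarterNat} (hf : Monotone f) (n : QuarterNat) :
    f n ≤ shift f n := by
  change (f n : ℚ) ≤ shift f n
  linarith [le_shift hf n]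

theorem LipschitzEquivalent.shift {f g : QuarterNat → QuarterNat} (hf : Monotone f)
    (hg : Monotone g) (h : LipschitzEquivalent f g) : LipschitzEquivalent f (shift g) := by
  obtain ⟨C, hC⟩ := h
  -- Replacing n by n + 3 changes C n + C into C n + 4 C, and the summand 5 of `shift` is added
  -- outside.
  refine ⟨4 * C + 5, fun n => ⟨?_, ?_⟩⟩
  · have h1 : n.affine C ≤ n.affine (4 * C + 5) := by
      change (C : ℚ) * n + C ≤ ((4 * C + 5 : ℕ) : ℚ) * n + ((4 * C + 5 : ℕ) : ℚ)
      have := n.coe_nonneg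
      push_cast
      nlinarith [mul_nonneg (Nat.cast_nonneg (α := ℚ) C) this]
    have h2 : (g (n.affine C) : ℚ) ≤ g (n.affine (4 * C + 5)) := hg h1
    have h3 := le_shift hg (n.affine (4 * C + 5))
    have h4 : (g (n.affine C) : ℚ) ≤ TameFilling.shift g (n.affine (4 * C + 5)) := by linarith
    have h5 := (hC n).1
    have h6 := (TameFilling.shift g (n.affine (4 * C + 5))).coe_nonneg
    push_cast
    nlinarith [mul_le_mul_of_nonneg_left h4 (Nat.cast_nonneg (α := ℚ) C),
      mul_nonneg (Nat.cast_nonneg (α := ℚ) C) h6, Nat.cast_nonneg (α := ℚ) C]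
  · have h1 : (n + QuarterNat.ofNat 3).affine C ≤ n.affine (4 * C + 5) := by
      change (C : ℚ) * (n + 3) + C ≤ ((4 * C + 5 : ℕ) : ℚ) * n + ((4 * C + 5 : ℕ) : ℚ)
      have := n.coe_nonneg
      push_cast
      nlinarith [mul_nonneg (Nat.cast_nonneg (α := ℚ) C) this]
    have h2 : (f ((n + QuarterNat.ofNat 3).affine C) : ℚ) ≤ f (n.affine (4 * C + 5)) := hf h1
    have h5 := (hC (n + QuarterNat.ofNat 3)).2
    have h6 := (f (n.affine (4 * C + 5))).coe_nonneg
    rw [coe_shift]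
    push_cast
    nlinarith [mul_le_mul_of_nonneg_left h2 (Nat.cast_nonneg (α := ℚ) C),
      mul_nonneg (Nat.cast_nonneg (α := ℚ) C) h6, Nat.cast_nonneg (α := ℚ) C]

/-! ### Tame paths -/

/-- The concatenation of two families of paths. -/
noncomputable def pathConcat {Z X : Type*} [TopologicalSpace Z] [TopologicalSpace X]
    (Q W : C(Z × I, X)) (h : ∀ z, Q (z, 1) = W (z, 0)) : C(Z × I, X) where
  toFun z := if (z.2 : ℝ) ≤ 1 / 2 then Q (z.1, Set.projIcc 0 1 zero_le_one (2 * z.2 : ℝ))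
    else W (z.1, Set.projIcc 0 1 zero_le_one (2 * z.2 - 1 : ℝ))
  continuous_toFun := by
    refine Continuous.if_le ?_ ?_ (by fun_prop) continuous_const ?_
    · exact Q.continuous.comp (continuous_fst.prodMk (continuous_projIcc.comp (by fun_prop)))
    · exact W.continuous.comp (continuous_fst.prodMk (continuous_projIcc.comp (by fun_prop)))
    · intro z hz
      rw [hz, Set.projIcc_of_right_le _ (by norm_num), Set.projIcc_of_le_left _ (by norm_num)]
      exact h z.1

section pathConcat
variable {Z X : Type*} [TopologicalSpace Z] [TopologicalSpace X]
  {Q W : C(Z × I, X)} {h : ∀ z, Q (z, 1) = W (z, 0)}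

theorem pathConcat_of_le {z : Z} {t : I} (ht : (t : ℝ) ≤ 1 / 2) :
    pathConcat Q W h (z, t) = Q (z, Set.projIcc 0 1 zero_le_one (2 * t : ℝ)) := if_pos ht

theorem pathConcat_of_ge {z : Z} {t : I} (ht : 1 / 2 ≤ (t : ℝ)) :
    pathConcat Q W h (z, t) = W (z, Set.projIcc 0 1 zero_le_one (2 * t - 1 : ℝ)) := by
  rcases ht.eq_or_lt with h1 | h1
  · rw [pathConcat_of_le h1.ge, ← h1, Set.projIcc_of_right_le _ (by norm_num),
      Set.projIcc_of_le_left _ (by norm_num)]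
    exact h z
  · exact if_neg (not_le.2 h1)

theorem pathConcat_zero (z : Z) : pathConcat Q W h (z, 0) = Q (z, 0) := by
  rw [pathConcat_of_le (by simp)]
  simp

theorem pathConcat_one (z : Z) : pathConcat Q W h (z, 1) = W (z, 1) := by
  rw [pathConcat_of_ge (by norm_num)]
  norm_num

end pathConcat

namespace LabelledMap
variable {A : Type v} {inv : A → A} {Δ : LabelledMap.{v} A inv}

/-- Along the single path `γ`, the coarse distance at an earlier time is at most `f` of the one at
a later time. -/
def IsTamePath (Δ : LabelledMap.{v} A inv) (f : QuarterNat → QuarterNat) (γ : I → Δ.Space) : Prop :=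
  ∀ s t : I, s < t → Δ.coarseDist (γ s) ≤ f (Δ.coarseDist (γ t))

theorem IsTamePath.mono {f g : QuarterNat → QuarterNat} {γ : I → Δ.Space} (h : Δ.IsTamePath f γ)
    (hfg : ∀ n, f n ≤ g n) : Δ.IsTamePath g γ := fun s t hst => (h s t hst).trans (hfg _)

/-- The coarse distance is not continuous; the piecewise linear extension of the distance is, and it
exceeds the coarse distance by at most 1 on the 1-skeleton. This makes a continuity argument
available in `dist_le_of_isTamePath`. -/
theorem height_dist_le (p : Δ.toDGraph.Point) :
    Δ.height (fun a => (Δ.toDGraph.simple.dist Δ.base a : ℝ)) (fun _ => 0) (fun _ => 0)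
      (fun _ => rfl) (fun _ _ => rfl) (Δ.incl p) ≤ (Δ.coarseRat (Δ.incl p) : ℝ) + 1 := by
  induction p using DGraph.point_ind with
  | hv a =>
    change (Δ.toDGraph.simple.dist Δ.base a : ℝ) ≤ (((Δ.toDGraph.simple.dist Δ.base a : ℕ) : ℚ) : ℝ) + 1
    simp
  | he e s =>
    have h1 := DGraph.dist_tgt_le Δ.connected Δ.base e
    have h2 := DGraph.dist_src_le Δ.connected Δ.base e
    have h3 := Δ.toDGraph.min_le_coarse_edgePoint Δ.base e s
    set p := Δ.toDGraph.simple.dist Δ.base (Δ.src e) with hp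
    set q := Δ.toDGraph.simple.dist Δ.base (Δ.toDGraph.tgt e) with hq
    have h4 : Δ.height (fun a => (Δ.toDGraph.simple.dist Δ.base a : ℝ)) (fun _ => 0) (fun _ => 0)
      (fun _ => rfl) (fun _ _ => rfl) (Δ.incl (Δ.toDGraph.edgePoint e s)) =
        (1 - (s : ℝ)) * p + s * q + s * (1 - s) * 0 := rfl
    have h5 : (((min p q : ℕ) : ℚ) : ℝ) ≤ (Δ.coarseRat (Δ.incl (Δ.toDGraph.edgePoint e s)) : ℝ) := by
      exact_mod_cast h3
    have h6 : (p : ℝ) ≤ (min p q : ℕ) + 1 := by exact_mod_cast (by omega)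
    have h7 : (q : ℝ) ≤ (min p q : ℕ) + 1 := by exact_mod_cast (by omega)
    rw [h4]
    have hs := s.2.1
    have hs' : 0 ≤ 1 - (s : ℝ) := by linarith [s.2.2]
    push_cast at h5 h6 h7
    nlinarith [mul_le_mul_of_nonneg_left h6 hs', mul_le_mul_of_nonneg_left h7 hs]

/-- A tame path in the 1-skeleton forces a lower bound on `f` at the distance of its end. -/
theorem dist_le_of_isTamePath {f : QuarterNat → QuarterNat} {γ : I → Δ.Space} (hc : Continuous γ)
    (hs : ∀ t, γ t ∈ Δ.oneSkeleton) {a : Δ.V} (h1 : γ 1 = Δ.vertexPt a) (ht : Δ.IsTamePath f γ) :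
    (Δ.toDGraph.simple.dist Δ.base a : ℚ) ≤
      f (QuarterNat.ofNat (Δ.toDGraph.simple.dist Δ.base a)) + 2 := by
  set d := Δ.toDGraph.simple.dist Δ.base a with hd
  set H := Δ.height (fun a => (Δ.toDGraph.simple.dist Δ.base a : ℝ)) (fun _ => 0) (fun _ => 0)
      (fun _ => rfl) (fun _ _ => rfl) with hH
  have hcont : Continuous fun t => H (γ t) := (continuous_height _ _ _ _ _).comp hc
  have hend : H (γ 1) = d := by rw [h1]; rfl
  -- Tameness compares the end only with strictly earlier times. Shortly before the end the
  -- continuous height still exceeds d - 1, hence the coarse distance exceeds d - 2.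
  have hev : ∀ᶠ t in nhds (1 : I), (d : ℝ) - 1 < H (γ t) :=
    hcont.continuousAt.eventually (lt_mem_nhds (hend ▸ sub_one_lt _))
  have hne : (nhdsWithin (1 : I) (Set.Iio 1)).NeBot := nhdsLT_neBot_of_exists_lt ⟨0, zero_lt_one⟩
  obtain ⟨t, ht1, ht2⟩ := ((hev.filter_mono nhdsWithin_le_nhds).and
    (self_mem_nhdsWithin (s := Set.Iio (1 : I)))).exists
  obtain ⟨q, hq⟩ := hs t
  have h2 := height_dist_le (Δ := Δ) q
  rw [hq] at h2
  have h3 : (Δ.coarseRat (γ t) : ℚ) ≤ f (Δ.coarseDist (γ 1)) := ht t 1 ht2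
  have h4 : Δ.coarseDist (γ 1) = QuarterNat.ofNat d := by rw [h1]; rfl
  rw [h4] at h3
  have h5 : (Δ.coarseRat (γ t) : ℝ) ≤ ((f (QuarterNat.ofNat d) : ℚ) : ℝ) := by exact_mod_cast h3
  have h6 : (d : ℝ) ≤ ((f (QuarterNat.ofNat d) : ℚ) : ℝ) + 2 := by
    change _ ≤ _ at h2
    linarith
  exact_mod_cast h6

/-- The stretch `W` moves outwards up to a bounded error, measured by m. Points of `Q` are compared
with the junction, whose coarse distance is at most 3 above the current one; this is the 3 inside
`shift`. Earlier points of `W` are at most m + 3 ≤ f(m) + 5; this is the 5 outside. -/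
theorem isTame_pathConcat {Z : Type*} [TopologicalSpace Z] {f : QuarterNat → QuarterNat}
    (hf : Monotone f) {Q W : C(Z × I, Δ.Space)} {h : ∀ z, Q (z, 1) = W (z, 0)}
    (hQ : Δ.IsTame f Q)
    (hW : ∀ z t, ∃ m : ℕ, (m : ℚ) ≤ Δ.coarseRat (W (z, t)) ∧
      (m : ℚ) ≤ f (QuarterNat.ofNat m) + 2 ∧ ∀ s ≤ t, Δ.coarseRat (W (z, s)) ≤ m + 3) :
    Δ.IsTame (shift f) (pathConcat Q W h) := by
  intro z s t hst
  have hst' : (s : ℝ) < t := hst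
  by_cases ht : (t : ℝ) ≤ 1 / 2
  · rw [pathConcat_of_le ht, pathConcat_of_le (by linarith)]
    have := hQ z (Set.projIcc 0 1 zero_le_one (2 * s : ℝ)) (Set.projIcc 0 1 zero_le_one (2 * t : ℝ))
      (by
        rw [Set.projIcc_of_mem _ ⟨by linarith [s.2.1], by linarith⟩,
          Set.projIcc_of_mem _ ⟨by linarith [t.2.1], by linarith⟩]
        change (2 * s : ℝ) < 2 * t
        linarith)
    refine this.trans ?_
    have := le_shift hf (Δ.coarseDist (Q (z, Set.projIcc 0 1 zero_le_one (2 * t : ℝ))))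
    change (_ : ℚ) ≤ _
    linarith
  push Not at ht
  rw [pathConcat_of_ge ht.le]
  set t' := Set.projIcc 0 1 zero_le_one (2 * t - 1 : ℝ)
  obtain ⟨m, h1, h2, h3⟩ := hW z t'
  have hmono : (f (QuarterNat.ofNat m) : ℚ) ≤ f (Δ.coarseDist (W (z, t'))) :=
    hf (show (m : ℚ) ≤ Δ.coarseRat (W (z, t')) from h1)
  have hsh := le_shift hf (Δ.coarseDist (W (z, t')))
  change (Δ.coarseRat _ : ℚ) ≤ _
  by_cases hs : (s : ℝ) < 1 / 2
  · rw [pathConcat_of_le hs.le]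
    have h4 : Δ.coarseDist (Q (z, Set.projIcc 0 1 zero_le_one (2 * s : ℝ))) ≤
        f (Δ.coarseDist (Q (z, 1))) := hQ z _ _ (by
        rw [Set.projIcc_of_mem _ ⟨by linarith [s.2.1], by linarith⟩]
        change (_ : ℝ) < _
        simp only [Set.Icc.coe_one]
        linarith)
    rw [h] at h4
    have h5 := h3 0 t'.2.1
    have h6 : (f (Δ.coarseDist (W (z, 0))) : ℚ) ≤
        f (Δ.coarseDist (W (z, t')) + QuarterNat.ofNat 3) := hf (by
      change (Δ.coarseRat (W (z, 0)) : ℚ) ≤ Δ.coarseRat (W (z, t')) + ((3 : ℕ) : ℚ)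
      push_cast
      linarith)
    have h7 : Δ.coarseRat (Q (z, Set.projIcc 0 1 zero_le_one (2 * s : ℝ))) ≤
      f (Δ.coarseDist (W (z, 0))) := h4
    rw [coe_shift]
    linarith
  · push Not at hs
    rw [pathConcat_of_ge hs]
    have h5 := h3 (Set.projIcc 0 1 zero_le_one (2 * s - 1 : ℝ))
      (Set.monotone_projIcc _ (by linarith))
    linarith

theorem edgeLow_le_coarse (e : Δ.E) (s : I) : (Δ.edgeLow e : ℚ) ≤ Δ.coarseRat (Δ.edgePt e s) :=
  Δ.toDGraph.min_le_coarse_edgePoint Δ.base e s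

theorem coarse_le_edgeLow (e : Δ.E) (s : I) : Δ.coarseRat (Δ.edgePt e s) ≤ Δ.edgeLow e + 1 :=
  Δ.toDGraph.coarse_edgePoint_le Δ.connected Δ.base e s

theorem edgeLow_rev (e : Δ.E) : Δ.edgeLow (Δ.rev e) = Δ.edgeLow e := by
  rw [edgeLow, edgeLow, DGraph.tgt_rev, min_comm]; rfl

theorem walkPt_zero {l : List Δ.E} (h : Δ.toDGraph.IsWalk Δ.base l) : Δ.walkPt l 0 = Δ.basePt :=
  congrArg Δ.incl (DGraph.walkPoint_of_nonpos h le_rfl)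

theorem walkPt_natCast_add {l : List Δ.E} (h : Δ.toDGraph.IsWalk Δ.base l) {k : ℕ}
    (hk : k < l.length) (s : I) : Δ.walkPt l (k + s) = Δ.edgePt l[k] s :=
  congrArg Δ.incl (DGraph.walkPoint_natCast_add h hk s)

theorem walkPt_natCast {l : List Δ.E} (h : Δ.toDGraph.IsWalk Δ.base l) (k : ℕ) :
    Δ.walkPt l k = Δ.vertexPt (Δ.toDGraph.walkEnd Δ.base (l.take k)) :=
  congrArg Δ.incl (DGraph.walkPoint_natCast h k)

theorem continuous_walkPt {l : List Δ.E} (h : Δ.toDGraph.IsWalk Δ.base l) :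
    Continuous (Δ.walkPt l) := continuous_incl.comp (DGraph.continuous_walkPoint h)

theorem walkPt_mem_oneSkeleton (l : List Δ.E) (t : ℝ) : Δ.walkPt l t ∈ Δ.oneSkeleton := ⟨_, rfl⟩

end LabelledMap

/-! ### Words -/

namespace SymmetrizedPresentation
variable {G : Type u} [Group G] {A : Type v} (P : SymmetrizedPresentation G A)

theorem wordVal_append (l l' : List A) : P.wordVal (l ++ l') = P.wordVal l * P.wordVal l' := by
  simp [wordVal]

theorem wordVal_cons (a : A) (l : List A) : P.wordVal (a :: l) = P.val a * P.wordVal l := by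
  simp [wordVal]

theorem wordVal_nil : P.wordVal [] = 1 := rfl

theorem wordInv_append (l l' : List A) : P.wordInv (l ++ l') = P.wordInv l' ++ P.wordInv l := by
  simp [wordInv]

theorem wordInv_wordInv (l : List A) : P.wordInv (P.wordInv l) = l := by
  have : P.inv ∘ P.inv = id := funext P.inv_inv
  simp [wordInv, this]

theorem wordVal_wordInv (l : List A) : P.wordVal (P.wordInv l) = (P.wordVal l)⁻¹ := by
  induction l with
  | nil => simp [wordVal, wordInv]
  | cons a l ih =>
    rw [← List.singleton_append, wordInv_append, wordVal_append, ih, wordVal_append, mul_inv_rev]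
    simp [wordVal, wordInv, P.val_inv]

theorem exists_wordVal (g : G) : ∃ l, P.wordVal l = g := by
  obtain ⟨z, rfl⟩ := P.generates g
  induction z using FreeGroup.induction_on with
  | C1 => exact ⟨[], by simp [wordVal]⟩
  | of a => exact ⟨[a], by simp [wordVal]⟩
  | inv_of a _ => exact ⟨[P.inv a], by simp [wordVal, P.val_inv]⟩
  | mul x y hx hy =>
    obtain ⟨l, hl⟩ := hx
    obtain ⟨l', hl'⟩ := hy
    exact ⟨l ++ l', by rw [wordVal_append, hl, hl', map_mul]⟩

theorem exists_geodesic (g : G) : ∃ l, P.wordVal l = g ∧ P.IsGeodesicWord l := by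
  classical
  have h : ∃ n, ∃ l, P.wordVal l = g ∧ l.length = n := by
    obtain ⟨l, hl⟩ := P.exists_wordVal g
    exact ⟨_, l, hl, rfl⟩
  obtain ⟨l, hl, hn⟩ := Nat.find_spec h
  exact ⟨l, hl, fun l' hl' => hn ▸ Nat.find_min' h ⟨l', hl'.trans hl, rfl⟩⟩

variable {P}

/-- If two prefixes had the same value, the letters between them could be deleted. -/
theorem IsGeodesicWord.take_injOn {l : List A} (h : P.IsGeodesicWord l) {i j : ℕ}
    (hi : i ≤ l.length) (hj : j ≤ l.length)
    (hij : P.wordVal (l.take i) = P.wordVal (l.take j)) : i = j := by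
  have key : ∀ i j : ℕ, i ≤ l.length → j ≤ l.length →
      P.wordVal (l.take i) = P.wordVal (l.take j) → j ≤ i := by
    intro i j hi hj hij
    have h1 := h (l.take i ++ l.drop j) (by
      rw [wordVal_append, hij, ← wordVal_append, List.take_append_drop])
    simp only [List.length_append, List.length_take, List.length_drop] at h1
    omega
  exact le_antisymm (key j i hj hi hij.symm) (key i j hi hj hij)

theorem isSimpleWord_iff {l : List A} : P.IsSimpleWord l ↔
    ∀ i ≤ l.length, ∀ j ≤ l.length, P.wordVal (l.take i) = P.wordVal (l.take j) → i = j := by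
  rw [IsSimpleWord, List.nodup_iff_injective_getElem]
  have hlen : (l.inits.map P.wordVal).length = l.length + 1 := by simp
  have hget : ∀ i (hi : i < (l.inits.map P.wordVal).length),
      (l.inits.map P.wordVal)[i] = P.wordVal (l.take i) := by
    intro i hi
    simp
  constructor
  · intro h i hi j hj hij
    have := @h ⟨i, by omega⟩ ⟨j, by omega⟩ (by simpa only [hget] using hij)
    simpa using this
  · rintro h ⟨i, hi⟩ ⟨j, hj⟩ hij
    simp only [hget] at hij
    exact Fin.ext (h i (by omega) j (by omega) hij)

theorem IsGeodesicWord.isSimpleWord {l : List A} (h : P.IsGeodesicWord l) : P.IsSimpleWord l :=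
  isSimpleWord_iff.2 fun _ hi _ hj hij => h.take_injOn hi hj hij

end SymmetrizedPresentation

/-! ### Distances and geodesics in van Kampen diagrams -/

namespace VanKampenDiagram
variable {G : Type u} [Group G] {A : Type v} {P : SymmetrizedPresentation G A}
  {Δ : VanKampenDiagram P}

/-- Letters represent nontrivial elements, so a diagram has no loops. Coordinates on edges, folding
and cutting at a vertex all depend on this. -/
theorem src_ne_tgt (e : Δ.E) : Δ.src e ≠ Δ.toDGraph.tgt e := fun h => by
  have := Δ.pos_tgt e
  rw [← h, left_eq_mul] at this
  exact P.val_ne_one _ this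

theorem pos_walkEnd {a : Δ.V} {l : List Δ.E} (h : Δ.toDGraph.IsWalk a l) :
    Δ.pos (Δ.toDGraph.walkEnd a l) = Δ.pos a * P.wordVal (l.map Δ.label) := by
  induction l generalizing a with
  | nil => simp [DGraph.walkEnd, P.wordVal_nil]
  | cons e l ih =>
    rw [DGraph.walkEnd, ih h.2, Δ.pos_tgt, h.1, List.map_cons, P.wordVal_cons, mul_assoc]

theorem label_walkRev (l : List Δ.E) :
    (Δ.toDGraph.walkRev l).map Δ.label = P.wordInv (l.map Δ.label) := by
  simp [DGraph.walkRev, SymmetrizedPresentation.wordInv, Function.comp_def, Δ.label_rev]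

/-- The distance in a diagram is at least the distance in the Cayley graph. -/
theorem length_le_dist {y : G → List A} (hy : ∀ g, P.wordVal (y g) = g)
    (hg : ∀ g, P.IsGeodesicWord (y g)) (a : Δ.V) :
    (y (Δ.pos a)).length ≤ Δ.toDGraph.simple.dist Δ.base a := by
  refine DGraph.le_dist_of_step Δ.connected (D := fun a => (y (Δ.pos a)).length) ?_ ?_ a
  · have := hg 1 [] (by rw [hy]; rfl)
    rw [Δ.pos_base]
    simpa using this
  · intro e
    have := hg (Δ.pos (Δ.toDGraph.tgt e)) (y (Δ.pos (Δ.src e)) ++ [Δ.label e]) (by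
      rw [hy, P.wordVal_append, hy, Δ.pos_tgt]
      simp [SymmetrizedPresentation.wordVal])
    simpa using this

/-- A path from the base vertex that is labelled by a geodesic word is a geodesic. -/
theorem dist_of_isGeodesicWord {l : List Δ.E} (h : Δ.toDGraph.IsWalk Δ.base l)
    (hl : P.IsGeodesicWord (l.map Δ.label)) {i : ℕ} (hi : i ≤ l.length) :
    Δ.toDGraph.simple.dist Δ.base (Δ.toDGraph.walkEnd Δ.base (l.take i)) = i := by
  choose y hy hg using P.exists_geodesic
  -- The prefix reaches distance at most i and the rest adds at most its length, while the end of
  -- the path is at least as far away as in the Cayley graph, where the word is geodesic. Hence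
  -- equality throughout.
  have h1 := DGraph.dist_walkEnd_le Δ.connected Δ.base (h.take i)
  have h2 := DGraph.dist_walkEnd_le Δ.connected Δ.base (h.drop i)
  rw [← DGraph.walkEnd_append, List.take_append_drop] at h2
  have h3 := length_le_dist hy hg (Δ.toDGraph.walkEnd Δ.base l)
  have h4 := hl (y (Δ.pos (Δ.toDGraph.walkEnd Δ.base l))) (by
    rw [hy, pos_walkEnd h, Δ.pos_base, one_mul])
  simp only [List.length_map, List.length_take, List.length_drop, SimpleGraph.dist_self] at *
  omega

end VanKampenDiagram

/-- The edges of the path in the Cayley graph that starts at `g` and is labelled `l`. -/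
def SymmetrizedPresentation.cayleyPath {G : Type u} [Group G] {A : Type v}
    (P : SymmetrizedPresentation G A) : G → List A → List P.cayleyGraph.E
  | _, [] => []
  | g, a :: l => (g, a) :: P.cayleyPath (g * P.val a) l

theorem DGraph.take_walkRev {Γ : DGraph.{u, v}} (l : List Γ.E) (i : ℕ) :
    (Γ.walkRev l).take i = Γ.walkRev (l.drop (l.length - i)) := by
  simp [DGraph.walkRev, List.take_reverse]

/-! ### Projection of paths to the Cayley graph; the boundary circuit as a map of the circle -/

namespace VanKampenDiagram
variable {G : Type u} [Group G] {A : Type v} {P : SymmetrizedPresentation G A}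
  {Δ : VanKampenDiagram P}

theorem map_proj_onE {a : Δ.V} {l : List Δ.E} (h : Δ.toDGraph.IsWalk a l) :
    l.map Δ.proj.onE = P.cayleyPath (Δ.pos a) (l.map Δ.label) := by
  induction l generalizing a with
  | nil => rfl
  | cons e l ih =>
    rw [List.map_cons, List.map_cons, SymmetrizedPresentation.cayleyPath, ih h.2, Δ.pos_tgt, h.1]
    congr 1
    exact Prod.ext (congrArg Δ.pos h.1) rfl

/-- The right-hand side depends on the label of the path but not on the diagram, so paths in
different diagrams can be compared. -/
theorem proj_map_walkPoint {l : List Δ.E} (h : Δ.toDGraph.IsWalk Δ.base l) (t : ℝ) :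
    Δ.proj.map (Δ.toDGraph.walkPoint Δ.base l t) =
      P.cayleyGraph.walkPoint (1 : G) (P.cayleyPath 1 (l.map Δ.label)) t := by
  rw [DGraph.Hom.map_walkPoint, map_proj_onE h]
  congr 1
  · exact Δ.pos_base
  · rw [Δ.pos_base]

theorem walkPt_bdry_length : Δ.walkPt Δ.bdry Δ.bdry.length = Δ.basePt := by
  rw [LabelledMap.walkPt_natCast Δ.isWalk_bdry, List.take_length, Δ.walkEnd_bdry]
  rfl

theorem walkPt_bdry_mem (y : Set.Icc (0 : ℝ) Δ.bdry.length) :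
    Δ.walkPt Δ.bdry y ∈ Δ.boundary := by
  rcases Nat.eq_zero_or_pos Δ.bdry.length with h | h
  · left
    change Δ.walkPt Δ.bdry (y : ℝ) = Δ.basePt
    generalize (y : ℝ) = t
    rw [List.length_eq_zero_iff.1 h]
    rfl
  · obtain ⟨k, hk, s, hs⟩ := DGraph.exists_natCast_add h y.2.1 y.2.2
    right
    rw [hs, LabelledMap.walkPt_natCast_add Δ.isWalk_bdry hk]
    exact ⟨_, List.getElem_mem hk, s, rfl⟩

/-- The parametrization of the boundary by the circle. -/
noncomputable def circuit (Δ : VanKampenDiagram P) : Circle Δ.bdry.length → Δ.boundary :=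
  Quot.lift (fun y => ⟨Δ.walkPt Δ.bdry y, walkPt_bdry_mem y⟩) (by
    rintro y z ⟨h0, h1⟩
    ext
    simp only [h0, h1]
    rw [LabelledMap.walkPt_zero Δ.isWalk_bdry, walkPt_bdry_length])

theorem continuous_circuit : Continuous Δ.circuit := by
  refine continuous_quot_lift _ ?_
  exact ((LabelledMap.continuous_walkPt Δ.isWalk_bdry).comp continuous_subtype_val).subtype_mk _

end VanKampenDiagram

/-- Composition with `circuit`, which is continuous and takes vertices of the circle to vertices of
the diagram. No new paths appear, so f is unchanged. -/
theorem IntrinsicTameFilling.relaxed {G : Type u} [Group G] {A : Type v}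
    {P : SymmetrizedPresentation G A} {f : QuarterNat → QuarterNat}
    (h : IntrinsicTameFilling P f) : IntrinsicRelaxedTameFilling P f := by
  intro l hl
  obtain ⟨Δ, hΔ, Ψ, hΨ, ht⟩ := h l hl
  refine ⟨Δ, hΔ, ⟨fun z => Ψ (Δ.circuit z.1, z.2), ?_⟩, ⟨?_, ?_, ?_, ?_⟩, ?_⟩
  · exact Ψ.continuous.comp
      ((VanKampenDiagram.continuous_circuit.comp continuous_fst).prodMk continuous_snd)
  · exact fun p => hΨ.map_zero _
  · exact fun y => hΨ.map_one _
  · intro t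
    have : Δ.circuit (Circle.mk ⟨0, le_refl _, Nat.cast_nonneg _⟩) =
        ⟨Δ.basePt, Δ.basePt_mem_boundary⟩ :=
      Subtype.ext (LabelledMap.walkPt_zero Δ.isWalk_bdry)
    exact (congrArg (fun q => Ψ (q, t)) this).trans (hΨ.map_base t)
  · intro y k hy t
    refine hΨ.map_vertex _ (Δ.toDGraph.walkEnd Δ.base (Δ.bdry.take k)) ?_ t
    change Δ.walkPt Δ.bdry y = _
    rw [hy, LabelledMap.walkPt_natCast Δ.isWalk_bdry]
  · exact fun p s t hst => ht _ s t hst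

/-! ### From disk homotopies to edge homotopies along geodesic sides -/

namespace VanKampenDiagram
variable {G : Type u} [Group G] {A : Type v} {P : SymmetrizedPresentation G A}
  {Δ : VanKampenDiagram P}

theorem length_bdry_eq {u w : List A} {a : A} (hb : Δ.bdryWord = u ++ a :: P.wordInv w) :
    Δ.bdry.length = u.length + 1 + w.length := by
  have := congrArg List.length hb
  simp only [bdryWord, List.length_map, List.length_append, List.length_cons,
    SymmetrizedPresentation.wordInv, List.length_reverse] at this
  omega

theorem label_take_bdry {u w : List A} {a : A} (hb : Δ.bdryWord = u ++ a :: P.wordInv w) :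
    (Δ.bdry.take u.length).map Δ.label = u := by
  rw [List.map_take]
  change Δ.bdryWord.take _ = _
  rw [hb]; simp

theorem label_walkRev_drop_bdry {u w : List A} {a : A}
    (hb : Δ.bdryWord = u ++ a :: P.wordInv w) :
    (Δ.toDGraph.walkRev (Δ.bdry.drop (u.length + 1))).map Δ.label = w := by
  rw [label_walkRev, List.map_drop]
  change P.wordInv (Δ.bdryWord.drop _) = _
  rw [hb, List.drop_append, List.drop_of_length_le (by omega)]
  simp [P.wordInv_wordInv]

theorem isWalk_walkRev_drop_bdry (k : ℕ) :
    Δ.toDGraph.IsWalk Δ.base (Δ.toDGraph.walkRev (Δ.bdry.drop k)) := by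
  have := (Δ.isWalk_bdry.drop k).walkRev
  rwa [← DGraph.walkEnd_append, List.take_append_drop, Δ.walkEnd_bdry] at this

theorem walkEnd_walkRev_drop_bdry (k : ℕ) :
    Δ.toDGraph.walkEnd Δ.base (Δ.toDGraph.walkRev (Δ.bdry.drop k)) =
      Δ.toDGraph.walkEnd Δ.base (Δ.bdry.take k) := by
  have h : Δ.toDGraph.walkEnd (Δ.toDGraph.walkEnd Δ.base (Δ.bdry.take k)) (Δ.bdry.drop k) =
      Δ.base := by
    rw [← DGraph.walkEnd_append, List.take_append_drop, Δ.walkEnd_bdry]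
  have := DGraph.walkEnd_walkRev (Δ.isWalk_bdry.drop k)
  rwa [h] at this

theorem walkPt_walkRev_drop_bdry {k : ℕ} (hk : k ≤ Δ.bdry.length) {t : ℝ} (h0 : 0 ≤ t)
    (h1 : t ≤ (Δ.bdry.length - k : ℕ)) :
    Δ.walkPt (Δ.toDGraph.walkRev (Δ.bdry.drop k)) t = Δ.walkPt Δ.bdry (Δ.bdry.length - t) := by
  have h2 := DGraph.walkPoint_walkRev Δ.isWalk_bdry h0
    (h1.trans (by exact_mod_cast Nat.sub_le _ _))
  have h3 := Δ.isWalk_bdry.walkRev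
  rw [Δ.walkEnd_bdry] at h2 h3
  have h4 := DGraph.walkPoint_take h3 (k := Δ.bdry.length - k) (by simp [DGraph.walkRev]) h1
  rw [DGraph.take_walkRev, Nat.sub_sub_self hk] at h4
  exact congrArg Δ.incl (h4.trans h2)

/-- A path from the base vertex with geodesic label is geodesic in the diagram as well. `dist_right`
is the same for the other side, read backwards from the end of the boundary circuit. -/
theorem dist_left {u w : List A} {a : A} (hb : Δ.bdryWord = u ++ a :: P.wordInv w)
    (hu : P.IsGeodesicWord u) {j : ℕ} (hj : j ≤ u.length) :
    Δ.toDGraph.simple.dist Δ.base (Δ.toDGraph.walkEnd Δ.base (Δ.bdry.take j)) = j := by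
  have h1 := length_bdry_eq hb
  have := dist_of_isGeodesicWord (Δ.isWalk_bdry.take u.length)
    (by rwa [label_take_bdry hb]) (i := j) (by rw [List.length_take]; omega)
  rwa [List.take_take, min_eq_left hj] at this

theorem dist_right {u w : List A} {a : A} (hb : Δ.bdryWord = u ++ a :: P.wordInv w)
    (hw : P.IsGeodesicWord w) {j : ℕ} (hj : u.length + 1 ≤ j) (hj' : j ≤ Δ.bdry.length) :
    Δ.toDGraph.simple.dist Δ.base (Δ.toDGraph.walkEnd Δ.base (Δ.bdry.take j)) =
      Δ.bdry.length - j := by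
  have h1 := length_bdry_eq hb
  have := dist_of_isGeodesicWord (isWalk_walkRev_drop_bdry (u.length + 1))
    (by rwa [label_walkRev_drop_bdry hb]) (i := Δ.bdry.length - j)
    (by simp [DGraph.walkRev]; omega)
  rw [DGraph.take_walkRev, List.drop_drop, List.length_drop] at this
  rw [show u.length + 1 + (Δ.bdry.length - (u.length + 1) - (Δ.bdry.length - j)) = j by omega,
    walkEnd_walkRev_drop_bdry] at this
  exact this

theorem edgeLow_getElem {j : ℕ} (hj : j < Δ.bdry.length) : Δ.edgeLow Δ.bdry[j] =
    min (Δ.toDGraph.simple.dist Δ.base (Δ.toDGraph.walkEnd Δ.base (Δ.bdry.take j)))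
      (Δ.toDGraph.simple.dist Δ.base (Δ.toDGraph.walkEnd Δ.base (Δ.bdry.take (j + 1)))) := by
  rw [LabelledMap.edgeLow, Δ.isWalk_bdry.src_getElem hj, Δ.isWalk_bdry.tgt_getElem hj]

/-- The case j = |u|, the distinguished edge itself, is included. Its far end may be nearer to the
base vertex than its start, whence the slack of 1. -/
theorem edgeLow_left {u w : List A} {a : A} (hb : Δ.bdryWord = u ++ a :: P.wordInv w)
    (hu : P.IsGeodesicWord u) {j : ℕ} (hj : j ≤ u.length) (hj' : j < Δ.bdry.length) :
    Δ.edgeLow Δ.bdry[j] ≤ j ∧ j ≤ Δ.edgeLow Δ.bdry[j] + 1 := by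
  have h1 := dist_left hb hu hj
  have h2 := DGraph.dist_src_le Δ.connected Δ.base Δ.bdry[j]
  rw [Δ.isWalk_bdry.src_getElem hj', Δ.isWalk_bdry.tgt_getElem hj'] at h2
  rw [edgeLow_getElem]
  omega

theorem edgeLow_right {u w : List A} {a : A} (hb : Δ.bdryWord = u ++ a :: P.wordInv w)
    (hw : P.IsGeodesicWord w) {j : ℕ} (hj : u.length ≤ j) (hj' : j < Δ.bdry.length) :
    Δ.edgeLow Δ.bdry[j] ≤ Δ.bdry.length - (j + 1) ∧
      Δ.bdry.length - (j + 1) ≤ Δ.edgeLow Δ.bdry[j] + 1 := by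
  have h1 := dist_right hb hw (j := j + 1) (by omega) hj'
  have h2 := DGraph.dist_tgt_le Δ.connected Δ.base Δ.bdry[j]
  rw [Δ.isWalk_bdry.src_getElem hj', Δ.isWalk_bdry.tgt_getElem hj'] at h2
  rw [edgeLow_getElem]
  omega

/-- If the paths to the vertices of the boundary are tame, then `f` is large at the distance of a
boundary edge. -/
theorem IsDiskHomotopy.edgeLow_le {f : QuarterNat → QuarterNat}
    {Φ : C(Circle Δ.bdry.length × I, Δ.Space)} (hΦ : Δ.IsDiskHomotopy Φ) (ht : Δ.IsTame f Φ)
    {j : ℕ} (hj : j < Δ.bdry.length) :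
    (Δ.edgeLow Δ.bdry[j] : ℚ) ≤ f (QuarterNat.ofNat (Δ.edgeLow Δ.bdry[j])) + 2 := by
  have key : ∀ i ≤ Δ.bdry.length, ∀ m,
      Δ.toDGraph.simple.dist Δ.base (Δ.toDGraph.walkEnd Δ.base (Δ.bdry.take i)) = m →
        (m : ℚ) ≤ f (QuarterNat.ofNat m) + 2 := by
    rintro i hi m rfl
    let y : Set.Icc (0 : ℝ) Δ.bdry.length := ⟨i, Nat.cast_nonneg _, by exact_mod_cast hi⟩
    refine LabelledMap.dist_le_of_isTamePath (γ := fun t => Φ (Circle.mk y, t))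
      (Φ.continuous.comp (by fun_prop)) (hΦ.map_vertex y i rfl) ?_ (ht _)
    exact (hΦ.map_one y).trans (LabelledMap.walkPt_natCast Δ.isWalk_bdry i)
  rcases min_choice
    (Δ.toDGraph.simple.dist Δ.base (Δ.toDGraph.walkEnd Δ.base (Δ.bdry.take j)))
    (Δ.toDGraph.simple.dist Δ.base (Δ.toDGraph.walkEnd Δ.base (Δ.bdry.take (j + 1)))) with h | h
  · exact key j hj.le _ ((edgeLow_getElem hj).trans h).symm
  · exact key (j + 1) hj _ ((edgeLow_getElem hj).trans h).symm

/-- The sides of the boundary before and after the distinguished edge are geodesics, so moving along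
them towards the distinguished edge does not decrease the coarse distance much. -/
theorem coarse_walkPt_left {f : QuarterNat → QuarterNat} {u w : List A} {a : A}
    (hb : Δ.bdryWord = u ++ a :: P.wordInv w) (hu : P.IsGeodesicWord u)
    (hf : ∀ j (hj : j < Δ.bdry.length),
      (Δ.edgeLow Δ.bdry[j] : ℚ) ≤ f (QuarterNat.ofNat (Δ.edgeLow Δ.bdry[j])) + 2)
    {z : ℝ} (hz : 0 ≤ z) (hz' : z ≤ u.length + 1) :
    ∃ m : ℕ, (m : ℚ) ≤ Δ.coarseRat (Δ.walkPt Δ.bdry z) ∧ (m : ℚ) ≤ f (QuarterNat.ofNat m) + 2 ∧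
      ∀ z', 0 ≤ z' → z' ≤ z → Δ.coarseRat (Δ.walkPt Δ.bdry z') ≤ m + 3 := by
  have hn := length_bdry_eq hb
  obtain ⟨j, hj, s, rfl⟩ := DGraph.exists_natCast_add (n := u.length + 1) (by omega) hz
    (by push_cast; exact hz')
  have hj' : j < Δ.bdry.length := by omega
  -- The witness m is the low value of the edge containing z. An earlier edge, of index i ≤ j, has
  -- low value at most i ≤ m + 1, so the coarse distance on it is at most m + 2.
  refine ⟨Δ.edgeLow Δ.bdry[j], ?_, hf j hj', ?_⟩
  · rw [LabelledMap.walkPt_natCast_add Δ.isWalk_bdry hj']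
    exact LabelledMap.edgeLow_le_coarse _ _
  · intro z' h0 h1
    obtain ⟨i, hi, r, rfl⟩ := DGraph.exists_natCast_add (n := j + 1) (by omega) h0
      (h1.trans (by push_cast; linarith [s.2.2]))
    have hi' : i < Δ.bdry.length := by omega
    rw [LabelledMap.walkPt_natCast_add Δ.isWalk_bdry hi']
    refine (LabelledMap.coarse_le_edgeLow _ _).trans ?_
    have h2 := edgeLow_left hb hu (j := j) (by omega) hj'
    have h3 := edgeLow_left hb hu (j := i) (by omega) hi'
    norm_cast
    omega

theorem coarse_walkPt_right {f : QuarterNat → QuarterNat} {u w : List A} {a : A}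
    (hb : Δ.bdryWord = u ++ a :: P.wordInv w) (hw : P.IsGeodesicWord w)
    (hf : ∀ j (hj : j < Δ.bdry.length),
      (Δ.edgeLow Δ.bdry[j] : ℚ) ≤ f (QuarterNat.ofNat (Δ.edgeLow Δ.bdry[j])) + 2)
    {z : ℝ} (hz : u.length ≤ z) (hz' : z ≤ Δ.bdry.length) :
    ∃ m : ℕ, (m : ℚ) ≤ Δ.coarseRat (Δ.walkPt Δ.bdry z) ∧ (m : ℚ) ≤ f (QuarterNat.ofNat m) + 2 ∧
      ∀ z', z ≤ z' → z' ≤ Δ.bdry.length → Δ.coarseRat (Δ.walkPt Δ.bdry z') ≤ m + 3 := by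
  have hn := length_bdry_eq hb
  -- The lower bound k on the index is first used with k = |u| for z, and then with the index of z
  -- for the later time z'.
  have hkey : ∀ z : ℝ, u.length ≤ z → z ≤ Δ.bdry.length → ∀ k : ℕ, u.length ≤ k →
      k < Δ.bdry.length → (k : ℝ) ≤ z → ∃ j : ℕ, k ≤ j ∧ j < Δ.bdry.length ∧ ∃ s : I, z = j + s := by
    intro z _ h1 k _ hk h2
    obtain ⟨i, hi, s, hs⟩ := DGraph.exists_natCast_add (n := Δ.bdry.length - k) (t := z - k)
      (by omega) (by linarith) (by rw [Nat.cast_sub hk.le]; linarith)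
    exact ⟨k + i, by omega, by omega, s, by push_cast; linarith⟩
  obtain ⟨j, hj, hj', s, rfl⟩ := hkey z hz hz' u.length le_rfl (by omega) hz
  refine ⟨Δ.edgeLow Δ.bdry[j], ?_, hf j hj', ?_⟩
  · rw [LabelledMap.walkPt_natCast_add Δ.isWalk_bdry hj']
    exact LabelledMap.edgeLow_le_coarse _ _
  · intro z' h0 h1
    obtain ⟨i, hi, hi', r, rfl⟩ := hkey z' (hz.trans h0) h1 j hj hj' (by linarith [s.2.1])
    rw [LabelledMap.walkPt_natCast_add Δ.isWalk_bdry hi']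
    refine (LabelledMap.coarse_le_edgeLow _ _).trans ?_
    have h2 := edgeLow_right hb hw (j := j) (by omega) hj'
    have h3 := edgeLow_right hb hw (j := i) (by omega) hi'
    norm_cast
    omega

/-- The common parametrization of the normal forms: wait, then move at constant speed. -/
noncomputable def ramp (n : ℕ) (t : I) : ℝ := max 0 (2 * t - 1 : ℝ) * n

theorem continuous_ramp (n : ℕ) : Continuous (ramp n) := by unfold ramp; fun_prop

theorem ramp_mem (n : ℕ) (t : I) : ramp n t ∈ Set.Icc (0 : ℝ) n := by
  have h := t.2.2
  constructor
  · exact mul_nonneg (le_max_left _ _) (Nat.cast_nonneg _)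
  · exact mul_le_of_le_one_left (Nat.cast_nonneg _) (max_le zero_le_one (by linarith))

theorem monotone_ramp (n : ℕ) : Monotone (ramp n) := fun s t h =>
  mul_le_mul_of_nonneg_right (max_le_max le_rfl (by linarith [show (s : ℝ) ≤ t from h]))
    (Nat.cast_nonneg _)

theorem ramp_zero (n : ℕ) : ramp n 0 = 0 := by simp [ramp]

theorem ramp_one (n : ℕ) : ramp n 1 = n := by norm_num [ramp]

/-- With n the length of the circuit, the point at coordinate c of the k-th edge is reached by the
path `Q` of the disk homotopy to the circle point at n c, followed by the slide `W` along the
circuit from time n c to time k + c. For c = 0 and c = 1 the circle point is the basepoint, the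
first stretch is constant, and the slide runs along one side of the boundary; this yields the
parametrization `ramp`. -/
theorem IsDiskHomotopy.exists_edgeHomotopy {f : QuarterNat → QuarterNat} (hf : Monotone f)
    {Φ : C(Circle Δ.bdry.length × I, Δ.Space)} (hΦ : Δ.IsDiskHomotopy Φ) (ht : Δ.IsTame f Φ)
    {u w : List A} {a : A} (hb : Δ.bdryWord = u ++ a :: P.wordInv w)
    (hu : P.IsGeodesicWord u) (hw : P.IsGeodesicWord w) (k : Fin Δ.bdry.length)
    (hk : (k : ℕ) = u.length) :
    ∃ Θ : C(Δ.closedEdge Δ.bdry[k] × I, Δ.Space), Δ.IsEdgeHomotopy k Θ ∧ Δ.IsTame (shift f) Θ ∧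
      (∀ t, Θ (⟨_, Δ.src_mem_closedEdge _⟩, t) = Δ.walkPt (Δ.bdry.take k) (ramp u.length t)) ∧
      ∀ t, Θ (⟨_, Δ.tgt_mem_closedEdge _⟩, t) =
        Δ.walkPt (Δ.toDGraph.walkRev (Δ.bdry.drop (k + 1))) (ramp w.length t) := by
  have hn := length_bdry_eq hb
  have hnR : (Δ.bdry.length : ℝ) = u.length + 1 + w.length := by exact_mod_cast hn
  set e := Δ.bdry[k] with he
  have hne : Δ.toDGraph.tgt e ≠ Δ.src e := (src_ne_tgt e).symm
  let c : Δ.closedEdge e → I := fun p => Δ.coord e p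
  have hc : Continuous c := (LabelledMap.continuous_coord e).comp continuous_subtype_val
  have hcmem : ∀ p, (Δ.bdry.length * (c p : ℝ)) ∈ Set.Icc (0 : ℝ) Δ.bdry.length := fun p =>
    ⟨mul_nonneg (Nat.cast_nonneg _) (c p).2.1,
      mul_le_of_le_one_right (Nat.cast_nonneg _) (c p).2.2⟩
  have hcp : ∀ p, Δ.edgePt e (c p) = p := by
    rintro ⟨_, s, rfl⟩
    simp only [c, LabelledMap.coord_edgePt hne]
  have hcs : c ⟨_, Δ.src_mem_closedEdge e⟩ = 0 := by
    simp only [c]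
    rw [← LabelledMap.edgePt_zero, LabelledMap.coord_edgePt hne]
  have hct : c ⟨_, Δ.tgt_mem_closedEdge e⟩ = 1 := by
    simp only [c]
    rw [← LabelledMap.edgePt_one, LabelledMap.coord_edgePt hne]
  let Q : C(Δ.closedEdge e × I, Δ.Space) :=
    ⟨fun z => Φ (Circle.mk ⟨_, hcmem z.1⟩, z.2), by
      refine Φ.continuous.comp (Continuous.prodMk ?_ continuous_snd)
      exact continuous_quot_mk.comp (Continuous.subtype_mk (by fun_prop) _)⟩
  let W : C(Δ.closedEdge e × I, Δ.Space) :=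
    ⟨fun z => Δ.walkPt Δ.bdry (Δ.bdry.length * (c z.1 : ℝ) +
        z.2 * (k + (c z.1 : ℝ) - Δ.bdry.length * (c z.1 : ℝ))), by
      refine (LabelledMap.continuous_walkPt Δ.isWalk_bdry).comp (by fun_prop)⟩
  have hQW : ∀ z, Q (z, 1) = W (z, 0) := fun z => by
    refine (hΦ.map_one _).trans ?_
    change _ = Δ.walkPt Δ.bdry _
    simp
  have hsrc : ∀ t, pathConcat Q W hQW (⟨_, Δ.src_mem_closedEdge e⟩, t) =
      Δ.walkPt (Δ.bdry.take k) (ramp u.length t) := by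
    intro t
    have h1 : Δ.walkPt (Δ.bdry.take k) (ramp u.length t) = Δ.walkPt Δ.bdry (ramp u.length t) :=
      congrArg Δ.incl (DGraph.walkPoint_take Δ.isWalk_bdry k.2.le (hk ▸ (ramp_mem _ t).2))
    rw [h1]
    rcases le_total (t : ℝ) (1 / 2) with h | h
    · rw [pathConcat_of_le h]
      have : ramp u.length t = 0 := by
        rw [ramp, max_eq_left (by linarith), zero_mul]
      rw [this, LabelledMap.walkPt_zero Δ.isWalk_bdry]
      refine Eq.trans ?_ (hΦ.map_base (Set.projIcc 0 1 zero_le_one (2 * t : ℝ)))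
      change Φ (Circle.mk ⟨Δ.bdry.length * (c _ : ℝ), _⟩, _) = _
      congr 3
      ext
      simp [hcs]
    · rw [pathConcat_of_ge h]
      change Δ.walkPt Δ.bdry _ = _
      rw [ramp, max_eq_right (by linarith), hcs,
        Set.projIcc_of_mem _ ⟨by linarith, by linarith [t.2.2]⟩]
      simp [hk]
  have htgt : ∀ t, pathConcat Q W hQW (⟨_, Δ.tgt_mem_closedEdge e⟩, t) =
      Δ.walkPt (Δ.toDGraph.walkRev (Δ.bdry.drop (k + 1))) (ramp w.length t) := by
    intro t
    rw [walkPt_walkRev_drop_bdry k.2 (ramp_mem _ t).1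
      (by rw [show Δ.bdry.length - (k + 1) = w.length by omega]; exact (ramp_mem _ t).2)]
    rcases le_total (t : ℝ) (1 / 2) with h | h
    · rw [pathConcat_of_le h]
      have : ramp w.length t = 0 := by
        rw [ramp, max_eq_left (by linarith), zero_mul]
      rw [this, sub_zero, walkPt_bdry_length]
      refine Eq.trans ?_ (hΦ.map_base (Set.projIcc 0 1 zero_le_one (2 * t : ℝ)))
      change Φ (Circle.mk ⟨Δ.bdry.length * (c _ : ℝ), _⟩, _) = _
      congr 2
      -- For c = 1 the circle point is the one at n, which is glued to the one at 0.
      symm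
      refine Quot.sound ⟨rfl, ?_⟩
      simp [hct]
    · rw [pathConcat_of_ge h]
      change Δ.walkPt Δ.bdry _ = _
      rw [ramp, max_eq_right (by linarith), hct,
        Set.projIcc_of_mem _ ⟨by linarith, by linarith [t.2.2]⟩]
      congr 1
      simp only [hk, hnR, Set.Icc.coe_one]
      ring
  refine ⟨pathConcat Q W hQW, ⟨?_, ?_, ?_, ?_⟩, ?_, hsrc, htgt⟩
  · intro p
    rw [pathConcat_zero]
    exact hΦ.map_zero _
  · intro p
    rw [pathConcat_one]
    change Δ.walkPt Δ.bdry _ = _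
    rw [← hcp p]
    simp only [Set.Icc.coe_one, one_mul, add_sub_cancel]
    rw [LabelledMap.walkPt_natCast_add Δ.isWalk_bdry k.2]
    rfl
  · refine ⟨ramp u.length, continuous_ramp _, monotone_ramp _, ramp_zero _, ?_, hsrc⟩
    rw [ramp_one, List.length_take, min_eq_left k.2.le, hk]
  · refine ⟨ramp w.length, continuous_ramp _, monotone_ramp _, ramp_zero _, ?_, htgt⟩
    rw [ramp_one, List.length_reverse, List.length_map, List.length_drop]
    congr 1
    omega
  · have hQ : Δ.IsTame f Q := fun z s t hst => ht (Circle.mk ⟨_, hcmem z⟩) s t hst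
    refine LabelledMap.isTame_pathConcat hf hQ fun z t => ?_
    have hLow := fun j (hj : j < Δ.bdry.length) => hΦ.edgeLow_le ht hj
    have hc0 := (c z).2.1
    have hc1 := (c z).2.2
    have ht0 := t.2.1
    have ht1 := t.2.2
    have hX := hcmem z
    set X : ℝ := Δ.bdry.length * (c z : ℝ) with hXdef
    have hkR : ((k : ℕ) : ℝ) = u.length := by exact_mod_cast hk
    have hw0 : (0 : ℝ) ≤ w.length := Nat.cast_nonneg _
    have hu0 : (0 : ℝ) ≤ u.length := Nat.cast_nonneg _
    have hX1 := hX.1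
    have hX2 := hX.2
    change ∃ m : ℕ, (m : ℚ) ≤ Δ.coarseRat (Δ.walkPt Δ.bdry (X + t * (k + (c z : ℝ) - X))) ∧
      (m : ℚ) ≤ f (QuarterNat.ofNat m) + 2 ∧ ∀ s ≤ t,
        Δ.coarseRat (Δ.walkPt Δ.bdry (X + s * (k + (c z : ℝ) - X))) ≤ m + 3
    -- A slide that starts before its target k + c runs forwards, on the first side and the
    -- distinguished edge; otherwise it runs backwards, on the second side and the distinguished
    -- edge.
    rcases le_total X (k + (c z : ℝ)) with hle | hle
    · obtain ⟨m, h1, h2, h3⟩ := coarse_walkPt_left hb hu hLow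
        (z := X + t * (k + (c z : ℝ) - X)) (by nlinarith) (by nlinarith)
      refine ⟨m, h1, h2, fun s hs => h3 _ ?_ ?_⟩
      · nlinarith [mul_nonneg s.2.1 (sub_nonneg.2 hle)]
      · nlinarith [mul_le_mul_of_nonneg_right (show (s : ℝ) ≤ t from hs) (sub_nonneg.2 hle)]
    · obtain ⟨m, h1, h2, h3⟩ := coarse_walkPt_right hb hw hLow
        (z := X + t * (k + (c z : ℝ) - X)) (by nlinarith) (by nlinarith)
      refine ⟨m, h1, h2, fun s hs => h3 _ ?_ ?_⟩
      · nlinarith [mul_le_mul_of_nonneg_right (show (s : ℝ) ≤ t from hs) (sub_nonneg.2 hle)]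
      · nlinarith [mul_nonneg s.2.1 (sub_nonneg.2 hle)]

end VanKampenDiagram

/-- The path to an end g of the distinguished edge runs along y_g with parametrization `ramp`, which
depends only on the length of y_g. Its projection to the Cayley graph therefore depends only on g,
which is the consistency condition. -/
theorem IntrinsicRelaxedTameFilling.geodesic {G : Type u} [Group G] {A : Type v}
    {P : SymmetrizedPresentation G A} {f : QuarterNat → QuarterNat} (hf : Monotone f)
    (h : IntrinsicRelaxedTameFilling P f) : IntrinsicGeodesicTameNormal P (shift f) := by
  choose y hy hg using P.exists_geodesic
  have key : ∀ e : P.cayleyGraph.E, ∃ Δ : VanKampenDiagram P,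
      Δ.bdryWord = y (P.cayleyGraph.src e) ++ e.2 :: P.wordInv (y (P.cayleyGraph.tgt e)) ∧
      ∃ k : Fin Δ.bdry.length, (k : ℕ) = (y (P.cayleyGraph.src e)).length ∧
      ∃ Θ : C(Δ.closedEdge Δ.bdry[k] × I, Δ.Space), Δ.IsEdgeHomotopy k Θ ∧
        Δ.IsTame (shift f) Θ ∧
      (∀ t, Θ (⟨_, Δ.src_mem_closedEdge _⟩, t) = Δ.walkPt (Δ.bdry.take k)
        (VanKampenDiagram.ramp (y (P.cayleyGraph.src e)).length t)) ∧
      ∀ t, Θ (⟨_, Δ.tgt_mem_closedEdge _⟩, t) =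
        Δ.walkPt (Δ.toDGraph.walkRev (Δ.bdry.drop (k + 1)))
          (VanKampenDiagram.ramp (y (P.cayleyGraph.tgt e)).length t) := by
    rintro ⟨g, a⟩
    obtain ⟨Δ, hΔ, Φ, hΦ, ht⟩ := h (y g ++ a :: P.wordInv (y (g * P.val a))) (by
      rw [P.wordVal_append, P.wordVal_cons, P.wordVal_wordInv, hy, hy]; group)
    have hlen := VanKampenDiagram.length_bdry_eq hΔ
    obtain ⟨Θ, h1, h2, h3, h4⟩ := hΦ.exists_edgeHomotopy hf ht hΔ (hg _) (hg _)
      ⟨(y g).length, by omega⟩ rfl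
    exact ⟨Δ, hΔ, ⟨(y g).length, by omega⟩, rfl, Θ, h1, h2, h3, h4⟩
  choose Δ hΔ k hk Θ hΘ ht hsrc htgt using key
  -- Fillings were built for directed edges; one direction of each undirected edge is kept.
  let out : CayleyEdge P → P.cayleyGraph.E := fun e => e.exists_rep.choose
  have hout : ∀ e, Quot.mk _ (out e) = e := fun e => e.exists_rep.choose_spec
  have side : ∀ (e : P.cayleyGraph.E) (g : G) (a : (Δ e).closedEdge (Δ e).bdry[k e]),
      (g = P.cayleyGraph.src e ∧
        (a : (Δ e).Space) = (Δ e).vertexPt ((Δ e).src (Δ e).bdry[k e]) ∨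
      g = P.cayleyGraph.tgt e ∧
        (a : (Δ e).Space) = (Δ e).vertexPt ((Δ e).tgt (Δ e).bdry[k e])) →
      ∀ t : I, ∃ q : (Δ e).toDGraph.Point, (Δ e).incl q = Θ e (a, t) ∧
        (Δ e).proj.map q = P.cayleyGraph.walkPoint (1 : G) (P.cayleyPath 1 (y g))
          (VanKampenDiagram.ramp (y g).length t) := by
    intro e g a ha t
    rcases ha with ⟨rfl, ha⟩ | ⟨rfl, ha⟩
    · obtain rfl : a = ⟨_, (Δ e).src_mem_closedEdge _⟩ := Subtype.ext ha
      refine ⟨_, (hsrc e t).symm, ?_⟩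
      rw [VanKampenDiagram.proj_map_walkPoint ((Δ e).isWalk_bdry.take _), hk,
        VanKampenDiagram.label_take_bdry (hΔ e)]
    · obtain rfl : a = ⟨_, (Δ e).tgt_mem_closedEdge _⟩ := Subtype.ext ha
      refine ⟨_, (htgt e t).symm, ?_⟩
      rw [VanKampenDiagram.proj_map_walkPoint
        (VanKampenDiagram.isWalk_walkRev_drop_bdry _), hk,
        VanKampenDiagram.label_walkRev_drop_bdry (hΔ e)]
  refine ⟨{
    y := y
    y_val := hy
    y_simple := fun g => (hg g).isSimpleWord
    dir := out
    dir_mk := hout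
    diagram := fun e => Δ (out e)
    bdryWord_eq := fun e => hΔ (out e)
    index := fun e => k (out e)
    index_eq := fun e => hk (out e)
    homotopy := fun e => Θ (out e)
    isEdgeHomotopy := fun e => hΘ (out e)
    consistent := ?_ }, hg, fun e => ht (out e)⟩
  intro e e' g a a' ha ha' t
  obtain ⟨q, h1, h2⟩ := side (out e) g a ha t
  obtain ⟨q', h1', h2'⟩ := side (out e') g a' ha' t
  exact ⟨q, q', h1, h1', h2.trans h2'.symm⟩

/-- A nonempty list is a cycle of `f` if and only if `f` maps each entry to the next one, also after
the first entry is appended. -/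
theorem getElem_succ_mod_iff_isChain {α : Type*} {f : α → α} {x : α} {m l : List α}
    (hl : l = x :: m) :
    (∀ (i : ℕ) (h : i < l.length),
      f l[i] = l[(i + 1) % l.length]'(Nat.mod_lt _ (by omega))) ↔
      List.IsChain (fun a b => f a = b) (l ++ [x]) := by
  subst hl
  rw [List.isChain_iff_getElem]
  have key : ∀ i (h : i < (x :: m).length) (h' : i + 1 < (x :: m ++ [x]).length),
      (x :: m)[(i + 1) % (x :: m).length]'(Nat.mod_lt _ (by simp)) = (x :: m ++ [x])[i + 1] := by
    intro i h h'
    rcases Nat.lt_or_ge (i + 1) (x :: m).length with h1 | h1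
    · rw [List.getElem_append_left h1]
      congr 1
      exact Nat.mod_eq_of_lt h1
    · have h2 : i + 1 = (x :: m).length := by omega
      rw [List.getElem_append_right h1]
      simp only [h2, Nat.mod_self]
      simp
  constructor
  · intro h i hi
    have hi' : i < (x :: m).length := by simp at hi ⊢; omega
    rw [← key i hi' hi, List.getElem_append_left hi']
    exact h i hi'
  · intro h i hi
    have hi' : i + 1 < (x :: m ++ [x]).length := by simp at hi ⊢; omega
    rw [key i hi hi', ← h i hi', List.getElem_append_left hi]

/-! ### Cellular maps of diagrams and preservation of coarse distance -/

namespace LabelledMap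
variable {A : Type v} {inv : A → A} {Δ Δ' Δ'' : LabelledMap.{v} A inv}

theorem next_mem_bdry {e : Δ.E} : Δ.next e ∈ Δ.bdry ↔ e ∈ Δ.bdry := by
  constructor
  · intro h
    obtain ⟨i, hi, h⟩ := List.getElem_of_mem h
    rcases Nat.eq_zero_or_pos i with rfl | h0
    · have h1 := Δ.bdry_next (Δ.bdry.length - 1) (by omega)
      have h2 : (Δ.bdry.length - 1 + 1) % Δ.bdry.length = 0 := by
        rw [Nat.sub_add_cancel (by omega), Nat.mod_self]
      simp only [h2] at h1
      rw [← Δ.next.injective (h1.trans h)]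
      exact List.getElem_mem _
    · have h1 := Δ.bdry_next (i - 1) (by omega)
      have h2 : (i - 1 + 1) % Δ.bdry.length = i := by
        rw [Nat.sub_add_cancel (by omega), Nat.mod_eq_of_lt hi]
      simp only [h2] at h1
      rw [← Δ.next.injective (h1.trans h)]
      exact List.getElem_mem _
  · intro h
    obtain ⟨i, hi, rfl⟩ := List.getElem_of_mem h
    rw [Δ.bdry_next i hi]
    exact List.getElem_mem _

theorem next_pow_mem_bdry {e : Δ.E} (n : ℕ) : (Δ.next ^ n) e ∈ Δ.bdry ↔ e ∈ Δ.bdry := by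
  induction n with
  | zero => rfl
  | succ n ih => rw [pow_succ', Equiv.Perm.mul_apply, next_mem_bdry, ih]

/-- A cellular map of diagrams that preserves the labels and the orientation. -/
structure CellMap (Δ Δ' : LabelledMap.{v} A inv) extends DGraph.Hom Δ.toDGraph Δ'.toDGraph where
  label_onE : ∀ e, Δ'.label (onE e) = Δ.label e
  onV_base : onV Δ.base = Δ'.base
  onE_notMem : ∀ e ∉ Δ.bdry, onE e ∉ Δ'.bdry
  next_onE : ∀ e ∉ Δ.bdry, Δ'.next (onE e) = onE (Δ.next e)

namespace CellMap

/-- The composition of two cellular maps. -/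
def comp (ψ : CellMap Δ' Δ'') (φ : CellMap Δ Δ') : CellMap Δ Δ'' where
  onV := ψ.onV ∘ φ.onV
  onE := ψ.onE ∘ φ.onE
  src_onE e := by simp [ψ.src_onE, φ.src_onE]
  rev_onE e := by simp [ψ.rev_onE, φ.rev_onE]
  label_onE e := by simp [ψ.label_onE, φ.label_onE]
  onV_base := by simp [ψ.onV_base, φ.onV_base]
  onE_notMem e he := ψ.onE_notMem _ (φ.onE_notMem _ he)
  next_onE e he := by
    simp [ψ.next_onE _ (φ.onE_notMem _ he), φ.next_onE _ he]

/-- The map of 2-complexes that a cellular map induces. -/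
def map (φ : CellMap Δ Δ') : Δ.Space → Δ'.Space :=
  Quot.lift (Sum.elim (fun p => Δ'.incl (φ.toHom.map p))
    fun z => Δ'.conePt ⟨φ.onE z.1.1, φ.onE_notMem _ z.1.2⟩ z.2.1 z.2.2) (by
    rintro _ _ (⟨c, s⟩ | ⟨c, c', h, r⟩ | ⟨c, s, s'⟩)
    · exact conePt_zero _ _
    · exact Quot.sound (Glue.seam _ _
        (show φ.onE c'.1 = Δ'.next (φ.onE c.1) by rw [φ.next_onE _ c.2, h]) r)
    · exact Quot.sound (Glue.apex _ s s'))

variable (φ : CellMap Δ Δ')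

theorem map_incl (p : Δ.toDGraph.Point) : φ.map (Δ.incl p) = Δ'.incl (φ.toHom.map p) := rfl

theorem map_edgePt (e : Δ.E) (s : I) : φ.map (Δ.edgePt e s) = Δ'.edgePt (φ.onE e) s := rfl

theorem map_vertexPt (a : Δ.V) : φ.map (Δ.vertexPt a) = Δ'.vertexPt (φ.onV a) := rfl

theorem map_conePt (c : Δ.Corner) (s r : I) :
    φ.map (Δ.conePt c s r) = Δ'.conePt ⟨φ.onE c.1, φ.onE_notMem _ c.2⟩ s r := rfl

theorem map_basePt : φ.map Δ.basePt = Δ'.basePt := by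
  rw [basePt, map_vertexPt, φ.onV_base]; rfl

theorem continuous_map : Continuous φ.map :=
  continuous_of_cells (fun e => by simp only [map_edgePt]; exact continuous_edgePt _)
    fun c => by simp only [map_conePt]; exact continuous_conePt _

theorem map_walkPt (l : List Δ.E) (t : ℝ) :
    φ.map (Δ.walkPt l t) = Δ'.walkPt (l.map φ.onE) t := by
  rw [walkPt, map_incl, φ.toHom.map_walkPoint, φ.onV_base]; rfl

theorem isWalk {l : List Δ.E} (h : Δ.toDGraph.IsWalk Δ.base l) :
    Δ'.toDGraph.IsWalk Δ'.base (l.map φ.onE) := by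
  rw [← φ.onV_base]
  exact φ.toHom.isWalk h

theorem map_label (l : List Δ.E) : (l.map φ.onE).map Δ'.label = l.map Δ.label := by
  simp [Function.comp_def, φ.label_onE]

theorem map_walkRev (l : List Δ.E) :
    (Δ.toDGraph.walkRev l).map φ.onE = Δ'.toDGraph.walkRev (l.map φ.onE) := by
  simp [DGraph.walkRev, Function.comp_def, φ.rev_onE]

theorem next_pow_onE {e : Δ.E} (he : e ∉ Δ.bdry) (n : ℕ) :
    (Δ'.next ^ n) (φ.onE e) = φ.onE ((Δ.next ^ n) e) := by
  induction n with
  | zero => rfl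
  | succ n ih =>
    rw [pow_succ', Equiv.Perm.mul_apply, ih, φ.next_onE _ (by rwa [next_pow_mem_bdry]),
      pow_succ', Equiv.Perm.mul_apply]

/-- The cellular map preserves distances from the base vertex. -/
def IsRadial : Prop :=
  ∀ a, Δ'.toDGraph.simple.dist Δ'.base (φ.onV a) = Δ.toDGraph.simple.dist Δ.base a

theorem IsRadial.comp {ψ : CellMap Δ' Δ''} {φ : CellMap Δ Δ'} (hψ : ψ.IsRadial) (hφ : φ.IsRadial) :
    (ψ.comp φ).IsRadial := fun a => (hψ _).trans (hφ a)

/-- A cellular map is radial if the distance function of the domain descends to the codomain. -/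
theorem isRadial_of_step {D : Δ'.V → ℕ}
    (hD : ∀ a, D (φ.onV a) = Δ.toDGraph.simple.dist Δ.base a)
    (hstep : ∀ e, D (Δ'.toDGraph.tgt e) ≤ D (Δ'.src e) + 1) : φ.IsRadial := by
  intro a
  refine le_antisymm ?_ ?_
  -- A cellular map does not increase distances. The opposite inequality holds because `D` grows by
  -- at most 1 along each edge of the codomain.
  · refine DGraph.le_dist_of_step Δ.connected
      (D := fun a => Δ'.toDGraph.simple.dist Δ'.base (φ.onV a)) ?_ ?_ a
    · rw [φ.onV_base, SimpleGraph.dist_self]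
    · intro e
      rw [← φ.tgt_onE, ← φ.src_onE]
      exact DGraph.dist_tgt_le Δ'.connected _ _
  · rw [← hD]
    refine DGraph.le_dist_of_step Δ'.connected ?_ hstep _
    rw [← φ.onV_base, hD, SimpleGraph.dist_self]

variable {φ}

theorem IsRadial.edgeLow (h : φ.IsRadial) (e : Δ.E) : Δ'.edgeLow (φ.onE e) = Δ.edgeLow e := by
  rw [LabelledMap.edgeLow, LabelledMap.edgeLow, φ.src_onE, φ.tgt_onE, h, h]

/-- An inner face is carried onto an inner face, cycle onto cycle, so both maxima run over the same
values. -/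
theorem IsRadial.faceLow (h : φ.IsRadial) {e : Δ.E} (he : e ∉ Δ.bdry) :
    Δ'.faceLow (φ.onE e) = Δ.faceLow e := by
  classical
  unfold LabelledMap.faceLow
  refine le_antisymm (Finset.sup_le fun d hd => ?_) (Finset.sup_le fun d hd => ?_)
  · obtain ⟨n, rfl⟩ := (Finset.mem_filter.1 hd).2.exists_nat_pow_eq
    rw [φ.next_pow_onE he, h.edgeLow]
    exact Finset.le_sup (f := Δ.edgeLow)
      (Finset.mem_filter.2 ⟨Finset.mem_univ _, ⟨n, by simp⟩⟩)
  · obtain ⟨n, rfl⟩ := (Finset.mem_filter.1 hd).2.exists_nat_pow_eq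
    rw [← h.edgeLow, ← φ.next_pow_onE he]
    exact Finset.le_sup (f := Δ'.edgeLow)
      (Finset.mem_filter.2 ⟨Finset.mem_univ _, ⟨n, by simp⟩⟩)

theorem IsRadial.coarseRat_edgePt (h : φ.IsRadial) (e : Δ.E) (s : I) :
    Δ'.coarseRat (φ.map (Δ.edgePt e s)) = Δ.coarseRat (Δ.edgePt e s) := by
  change DGraph.coarse _ _ (DGraph.edgePoint _ _ _) = DGraph.coarse _ _ (DGraph.edgePoint _ _ _)
  simp only [DGraph.coarse, DGraph.edgePoint, DGraph.preCoarse, φ.src_onE, φ.tgt_onE, h _]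

/-- A radial cellular map preserves coarse distances. -/
theorem IsRadial.coarseDist (h : φ.IsRadial) (p : Δ.Space) :
    Δ'.coarseDist (φ.map p) = Δ.coarseDist p := by
  refine Subtype.ext ?_
  change Δ'.coarseRat _ = Δ.coarseRat _
  induction p using space_ind with
  | hv a => rw [map_vertexPt, coarseRat_vertexPt, coarseRat_vertexPt, h]
  | he e s => exact h.coarseRat_edgePt e s
  | hc c s r =>
    by_cases hr : r = 0
    · subst hr
      rw [conePt_zero]
      exact h.coarseRat_edgePt _ s
    · rw [coarseRat_conePt _ _ hr, ← h.faceLow c.2]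
      exact coarseRat_conePt _ _ hr

theorem IsRadial.isTamePath (h : φ.IsRadial) {f : QuarterNat → QuarterNat} {γ : I → Δ.Space}
    (ht : Δ.IsTamePath f γ) : Δ'.IsTamePath f fun t => φ.map (γ t) := fun s t hst => by
  rw [h.coarseDist, h.coarseDist]
  exact ht s t hst

variable (φ)

/-- The induced map on inner faces. -/
def faceMap : Δ.Face → Δ'.Face :=
  Quotient.map (fun c => ⟨φ.onE c.1, φ.onE_notMem _ c.2⟩) (by
    rintro ⟨c, hc⟩ ⟨c', hc'⟩ h
    obtain ⟨n, rfl⟩ := Equiv.Perm.SameCycle.exists_nat_pow_eq h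
    exact ⟨n, by simp [φ.next_pow_onE hc]⟩)

/-- The cellular map is injective on corners. -/
def CornerInjective : Prop :=
  ∀ e ∉ Δ.bdry, ∀ e' ∉ Δ.bdry, φ.onE e = φ.onE e' → e = e'

variable {φ}

theorem CornerInjective.faceMap_injective (h : φ.CornerInjective) :
    Function.Injective φ.faceMap := by
  intro F F'
  induction F, F' using Quotient.inductionOn₂ with
  | h c c' =>
    intro hF
    obtain ⟨n, hn⟩ := Equiv.Perm.SameCycle.exists_nat_pow_eq (Quotient.exact hF)
    rw [φ.next_pow_onE c.2] at hn
    refine Quotient.sound ⟨n, ?_⟩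
    simpa using h _ (by rw [next_pow_mem_bdry]; exact c.2) _ c'.2 hn

/-- Injectivity on corners prevents a face from being wrapped several times around its image, so the
two cycles have equal length. -/
theorem CornerInjective.faceWord (h : φ.CornerInjective) {e : Δ.E} (he : e ∉ Δ.bdry) :
    Δ'.faceWord (φ.onE e) = Δ.faceWord e := by
  have hit : ∀ n, Δ'.next^[n] (φ.onE e) = φ.onE (Δ.next^[n] e) := fun n => by
    simpa only [Equiv.Perm.iterate_eq_pow] using φ.next_pow_onE he n
  have hper : Function.minimalPeriod Δ'.next (φ.onE e) = Function.minimalPeriod Δ.next e := by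
    refine Function.minimalPeriod_eq_minimalPeriod_iff.2 fun n => ?_
    unfold Function.IsPeriodicPt Function.IsFixedPt
    rw [hit]
    refine ⟨fun h' => h _ ?_ _ he h', fun h' => by rw [h']⟩
    rw [Equiv.Perm.iterate_eq_pow, next_pow_mem_bdry]
    exact he
  unfold LabelledMap.faceWord
  rw [hper]
  refine List.ext_getElem (by simp) fun i h1 h2 => ?_
  simp [hit, φ.label_onE]

end CellMap
end LabelledMap

namespace DGraph
variable {Γ : DGraph.{u, v}} {Γ' : DGraph.{w, x}}

theorem Hom.reachable (φ : Hom Γ Γ') {a b : Γ.V} (h : Γ.simple.Reachable a b) :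
    Γ'.simple.Reachable (φ.onV a) (φ.onV b) := by
  obtain ⟨p⟩ := h
  induction p with
  | nil => exact SimpleGraph.Reachable.refl _
  | cons hadj p ih =>
    obtain ⟨_, e, rfl, rfl⟩ := simple_adj.1 hadj
    refine SimpleGraph.Reachable.trans ?_ ih
    by_cases h : φ.onV (Γ.src e) = φ.onV (Γ.tgt e)
    · rw [h]
    · exact (simple_adj.2 ⟨h, φ.onE e, φ.src_onE e, φ.tgt_onE e⟩).reachable

end DGraph

namespace LabelledMap
variable {A : Type v} {inv : A → A} {Δ Δ' : LabelledMap.{v} A inv}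

/-- Two cyclically ordered sets of edges at a vertex: the turn around the initial vertex. -/
def turn (Δ : LabelledMap.{v} A inv) : Equiv.Perm Δ.E :=
  (Function.Involutive.toPerm Δ.rev Δ.rev_rev).trans Δ.next

theorem turn_apply (e : Δ.E) : Δ.turn e = Δ.next (Δ.rev e) := rfl

theorem src_turn (e : Δ.E) : Δ.src (Δ.turn e) = Δ.src e := by
  rw [turn_apply, Δ.src_next, Δ.rev_rev]

theorem turn_rev (e : Δ.E) : Δ.turn (Δ.rev e) = Δ.next e := by rw [turn_apply, Δ.rev_rev]

theorem exists_turn_iterate {e e' : Δ.E} (h : Δ.src e = Δ.src e') : ∃ n : ℕ, Δ.turn^[n] e = e' :=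
  Δ.rotation e e' h

end LabelledMap

/-! ### Folding two consecutive boundary edges -/

namespace VanKampenDiagram
variable {G : Type u} [Group G] {A : Type v} {P : SymmetrizedPresentation G A}

/-- Two consecutive boundary edges with inverse labels that can be folded together. -/
structure FoldData (Δ : VanKampenDiagram P) where
  b : Δ.E
  c : Δ.E
  l₁ : List Δ.E
  l₂ : List Δ.E
  bdry_eq : Δ.bdry = l₁ ++ b :: c :: l₂
  -- Keeps the folded boundary circuit nonempty and starting at the base vertex.
  ne_nil : l₁ ≠ []
  label_eq : Δ.label c = P.inv (Δ.label b)
  -- If the path `b c` were closed, folding would identify no vertices but still lose an undirected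
  -- edge, and the Euler formula would fail.
  src_ne : Δ.src b ≠ Δ.toDGraph.tgt c

namespace FoldData
variable {Δ : VanKampenDiagram P} (F : FoldData Δ)
open Classical

theorem next_b : Δ.next F.b = F.c := by
  have h := Δ.bdry_next F.l₁.length (by rw [F.bdry_eq]; simp)
  have h1 : (F.l₁.length + 1) % Δ.bdry.length = F.l₁.length + 1 :=
    Nat.mod_eq_of_lt (by rw [F.bdry_eq]; simp)
  simp only [h1] at h
  simpa [F.bdry_eq] using h

theorem src_c : Δ.src F.c = Δ.toDGraph.tgt F.b := by
  rw [← F.next_b, Δ.src_next]; rfl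

theorem b_ne_c : F.b ≠ F.c := fun h => src_ne_tgt F.b (by rw [← F.src_c, ← h])

theorem rev_b_ne_c : Δ.rev F.b ≠ F.c := fun h => F.src_ne (by
  rw [← h, DGraph.tgt_rev])

theorem rev_c_ne_b : Δ.rev F.c ≠ F.b := fun h => F.rev_b_ne_c (by rw [← h, Δ.rev_rev])

theorem next_c_ne_b : Δ.next F.c ≠ F.b := fun h => F.src_ne (by
  rw [← h, Δ.src_next]; rfl)

theorem next_c_ne_c : Δ.next F.c ≠ F.c := fun h => src_ne_tgt F.c (by
  conv_lhs => rw [← h, Δ.src_next]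
  rfl)

theorem nodup : (F.l₁ ++ F.b :: F.c :: F.l₂).Nodup := F.bdry_eq ▸ Δ.bdry_nodup

theorem mem_bdry {e : Δ.E} : e ∈ Δ.bdry ↔ e = F.b ∨ e = F.c ∨ e ∈ F.l₁ ++ F.l₂ := by
  rw [F.bdry_eq]
  simp only [List.mem_append, List.mem_cons]
  tauto

/-- The vertices of the folded diagram. -/
abbrev V' : Type := {a : Δ.V // a ≠ Δ.toDGraph.tgt F.c}

/-- The edges of the folded diagram. -/
abbrev E' : Type := {e : Δ.E // e ≠ F.b ∧ e ≠ F.c}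

/-- The quotient map on vertices. -/
noncomputable def vmap (a : Δ.V) : F.V' :=
  if h : a = Δ.toDGraph.tgt F.c then ⟨Δ.src F.b, F.src_ne⟩ else ⟨a, h⟩

/-- The quotient map on edges. -/
noncomputable def emap (e : Δ.E) : F.E' :=
  -- The corners `b` and `c` of the outer face disappear. Their reversals survive and become each
  -- other's reversals.
  if e = F.b then ⟨Δ.rev F.c, F.rev_c_ne_b, Δ.rev_ne _⟩
  else if e = F.c then ⟨Δ.rev F.b, Δ.rev_ne _, F.rev_b_ne_c⟩
  -- The last alternative never occurs; it only makes the definition total.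
  else if h : e ≠ F.b ∧ e ≠ F.c then ⟨e, h⟩ else ⟨Δ.rev F.b, Δ.rev_ne _, F.rev_b_ne_c⟩

theorem emap_b : F.emap F.b = ⟨Δ.rev F.c, F.rev_c_ne_b, Δ.rev_ne _⟩ := if_pos rfl

theorem emap_c : F.emap F.c = ⟨Δ.rev F.b, Δ.rev_ne _, F.rev_b_ne_c⟩ := by
  rw [emap, if_neg F.b_ne_c.symm, if_pos rfl]

theorem emap_of_ne {e : Δ.E} (hb : e ≠ F.b) (hc : e ≠ F.c) : F.emap e = ⟨e, hb, hc⟩ := by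
  rw [emap, if_neg hb, if_neg hc, dif_pos ⟨hb, hc⟩]

theorem emap_coe (e : F.E') : F.emap e = e := F.emap_of_ne e.2.1 e.2.2

theorem vmap_tgt_c : F.vmap (Δ.toDGraph.tgt F.c) = F.vmap (Δ.src F.b) := by
  rw [vmap, dif_pos rfl, vmap, dif_neg F.src_ne]

theorem vmap_coe (a : F.V') : F.vmap a = a := by rw [vmap, dif_neg a.2]

theorem vmap_eq {a a' : Δ.V} (h : F.vmap a = F.vmap a') :
    a = a' ∨ a = Δ.src F.b ∧ a' = Δ.toDGraph.tgt F.c ∨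
      a = Δ.toDGraph.tgt F.c ∧ a' = Δ.src F.b := by
  unfold vmap at h
  split_ifs at h with h1 h2 h2
  · exact Or.inl (h1.trans h2.symm)
  · exact Or.inr (Or.inr ⟨h1, (congrArg Subtype.val h).symm⟩)
  · exact Or.inr (Or.inl ⟨congrArg Subtype.val h, h2⟩)
  · exact Or.inl (congrArg Subtype.val h)

/-- The reversal in the folded diagram. -/
noncomputable def rev' (e : F.E') : F.E' :=
  F.emap (Δ.rev e)

theorem rev'_emap (e : Δ.E) : F.rev' (F.emap e) = F.emap (Δ.rev e) := by
  unfold rev'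
  by_cases hb : e = F.b
  · subst hb
    rw [emap_b, Δ.rev_rev, emap_c, F.emap_of_ne (Δ.rev_ne _) F.rev_b_ne_c]
  by_cases hc : e = F.c
  · subst hc
    rw [emap_c, Δ.rev_rev, emap_b, F.emap_of_ne F.rev_c_ne_b (Δ.rev_ne _)]
  rw [F.emap_of_ne hb hc]

theorem src_emap (e : Δ.E) : F.vmap (Δ.src (F.emap e)) = F.vmap (Δ.src e) := by
  by_cases hb : e = F.b
  · subst hb
    rw [emap_b, ← F.vmap_tgt_c]; rfl
  by_cases hc : e = F.c
  · subst hc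
    rw [emap_c, F.src_c]; rfl
  rw [F.emap_of_ne hb hc]

theorem rev'_rev' (e : F.E') : F.rev' (F.rev' e) = e := by
  rw [show F.rev' e = F.emap (Δ.rev e.1) from rfl, rev'_emap, Δ.rev_rev, emap_coe]

/-- The graph of the folded diagram. -/
noncomputable def graph : DGraph.{0, 0} where
  V := F.V'
  E := F.E'
  src e := F.vmap (Δ.src e.1)
  rev := F.rev'
  rev_rev := F.rev'_rev'

/-- The quotient map of graphs. -/
noncomputable def hom : DGraph.Hom Δ.toDGraph F.graph where
  onV := F.vmap
  onE := F.emap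
  src_onE := F.src_emap
  rev_onE := F.rev'_emap

theorem next_eq_c {e : Δ.E} : Δ.next e = F.c ↔ e = F.b := by
  rw [← F.next_b]
  exact Δ.next.injective.eq_iff

/-- The boundary permutation of the folded diagram. -/
noncomputable def next' : Equiv.Perm F.E' :=
  Equiv.Perm.subtypePerm
    -- The two swaps redirect the predecessor of `b` to the successor of `c` and make `b` and `c`
    -- fixed points, so that the permutation restricts to the remaining edges.
    (Equiv.swap F.c (Δ.next F.c) * Equiv.swap F.b F.c * Δ.next) (by
    have hb : (Equiv.swap F.c (Δ.next F.c) * Equiv.swap F.b F.c * Δ.next) F.b = F.b := by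
      simp [F.next_b, Equiv.swap_apply_of_ne_of_ne F.b_ne_c F.next_c_ne_b.symm]
    have hc : (Equiv.swap F.c (Δ.next F.c) * Equiv.swap F.b F.c * Δ.next) F.c = F.c := by
      simp [Equiv.swap_apply_of_ne_of_ne F.next_c_ne_b F.next_c_ne_c]
    intro e
    generalize Equiv.swap F.c (Δ.next F.c) * Equiv.swap F.b F.c * Δ.next = τ at hb hc
    have h1 : τ e = F.b ↔ e = F.b := by conv_lhs => rw [← hb, τ.apply_eq_iff_eq]
    have h2 : τ e = F.c ↔ e = F.c := by conv_lhs => rw [← hc, τ.apply_eq_iff_eq]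
    rw [Ne, Ne, h1, h2])

theorem next'_of_ne {e : F.E'} (h : Δ.next e ≠ F.b) : (F.next' e : Δ.E) = Δ.next e := by
  have h1 : Δ.next e ≠ F.c := fun h => e.2.1 (F.next_eq_c.1 h)
  have h2 : Δ.next e ≠ Δ.next F.c := fun h => e.2.2 (Δ.next.injective h)
  simp [next', Equiv.swap_apply_of_ne_of_ne h h1, Equiv.swap_apply_of_ne_of_ne h1 h2]

theorem next'_of_eq {e : F.E'} (h : Δ.next e = F.b) : (F.next' e : Δ.E) = Δ.next F.c := by
  simp [next', h]

theorem next'_emap {e : Δ.E} (hb : e ≠ F.b) (hc : e ≠ F.c) (h : Δ.next e ≠ F.b) :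
    F.next' (F.emap e) = F.emap (Δ.next e) := by
  have h1 : Δ.next e ≠ F.c := fun h => hb (F.next_eq_c.1 h)
  rw [F.emap_of_ne hb hc, F.emap_of_ne h h1]
  exact Subtype.ext (F.next'_of_ne h)

theorem next'_emap_of_eq {e : Δ.E} (hb : e ≠ F.b) (hc : e ≠ F.c) (h : Δ.next e = F.b) :
    F.next' (F.emap e) = F.emap (Δ.next F.c) := by
  rw [F.emap_of_ne hb hc, F.emap_of_ne F.next_c_ne_b F.next_c_ne_c]
  exact Subtype.ext (F.next'_of_eq h)

theorem src_next' (e : F.E') : F.vmap (Δ.src (F.next' e)) = F.vmap (Δ.src (F.rev' e)) := by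
  rw [rev', src_emap]
  by_cases h : Δ.next e = F.b
  · rw [F.next'_of_eq h, Δ.src_next, ← Δ.src_next e, h, ← F.vmap_tgt_c]; rfl
  · rw [F.next'_of_ne h, Δ.src_next]

/-- The turn in the folded diagram. -/
noncomputable def turn' : Equiv.Perm F.E' :=
  (Function.Involutive.toPerm F.rev' F.rev'_rev').trans F.next'

theorem turn'_apply (e : F.E') : F.turn' e = F.next' (F.rev' e) := rfl

theorem turn'_emap {e : Δ.E} (h : Δ.turn e ≠ F.b) (hb : e ≠ Δ.rev F.b) (hc : e ≠ Δ.rev F.c) :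
    F.turn' (F.emap e) = F.emap (Δ.turn e) := by
  rw [turn'_apply, rev'_emap]
  refine F.next'_emap ?_ ?_ h
  · exact fun h => hb (by rw [← h, Δ.rev_rev])
  · exact fun h => hc (by rw [← h, Δ.rev_rev])

theorem turn'_emap_of_eq {e : Δ.E} (h : Δ.turn e = F.b) (hb : e ≠ Δ.rev F.b)
    (hc : e ≠ Δ.rev F.c) : F.turn' (F.emap e) = F.emap (Δ.next F.c) := by
  rw [turn'_apply, rev'_emap]
  refine F.next'_emap_of_eq ?_ ?_ h
  · exact fun h => hb (by rw [← h, Δ.rev_rev])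
  · exact fun h => hc (by rw [← h, Δ.rev_rev])

theorem sameCycle_turn' {e e' : F.E'} (h : F.turn' e = e') : F.turn'.SameCycle e e' :=
  ⟨1, by simpa using h⟩

theorem emap_rev_c : F.emap (Δ.rev F.c) = F.emap F.b := by
  rw [emap_b, F.emap_of_ne F.rev_c_ne_b (Δ.rev_ne _)]

theorem emap_rev_b : F.emap (Δ.rev F.b) = F.emap F.c := by
  rw [emap_c, F.emap_of_ne (Δ.rev_ne _) F.rev_b_ne_c]

theorem turn_rev_b : Δ.turn (Δ.rev F.b) = F.c := by rw [Δ.turn_rev, F.next_b]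

/-- At the end vertex of `c` the turn is unaffected until it reaches `rev c`, which is identified
with `b`. In this way the cyclic orders at the two merged vertices are spliced into one. -/
theorem sameCycle_rev_c (n : ℕ) (e : Δ.E) (he : Δ.src e = Δ.toDGraph.tgt F.c)
    (hn : Δ.turn^[n] e = Δ.rev F.c) : F.turn'.SameCycle (F.emap e) (F.emap (Δ.rev F.c)) := by
  induction n generalizing e with
  | zero => rw [← hn]; exact Equiv.Perm.SameCycle.refl _ _
  | succ n ih =>
    by_cases hc : e = Δ.rev F.c
    · rw [hc]
    have h1 : Δ.src (Δ.turn e) = Δ.toDGraph.tgt F.c := (Δ.src_turn e).trans he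
    refine (F.sameCycle_turn' (F.turn'_emap ?_ ?_ hc)).trans (ih _ h1 hn)
    · exact fun h => F.src_ne (by rw [← h, h1])
    · exact fun h => src_ne_tgt F.c (by rw [F.src_c, ← he, h]; rfl)

theorem sameCycle_next_c : F.turn'.SameCycle (F.emap (Δ.next F.c)) (F.emap F.b) := by
  rw [← emap_rev_c]
  have h : Δ.src (Δ.next F.c) = Δ.src (Δ.rev F.c) := Δ.src_next _
  obtain ⟨n, hn⟩ := LabelledMap.exists_turn_iterate h
  exact F.sameCycle_rev_c n _ h hn

theorem sameCycle_turn (e : Δ.E) : F.turn'.SameCycle (F.emap e) (F.emap (Δ.turn e)) := by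
  by_cases hb : e = Δ.rev F.b
  · rw [hb, turn_rev_b, emap_rev_b]
  by_cases hc : e = Δ.rev F.c
  · rw [hc, emap_rev_c, Δ.turn_rev]
    exact F.sameCycle_next_c.symm
  by_cases h : Δ.turn e = F.b
  · rw [h]
    exact (F.sameCycle_turn' (F.turn'_emap_of_eq h hb hc)).trans F.sameCycle_next_c
  · exact F.sameCycle_turn' (F.turn'_emap h hb hc)

theorem sameCycle_of_src {e e' : Δ.E} (h : Δ.src e = Δ.src e') :
    F.turn'.SameCycle (F.emap e) (F.emap e') := by
  obtain ⟨n, rfl⟩ := LabelledMap.exists_turn_iterate h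
  clear h
  induction n generalizing e with
  | zero => exact Equiv.Perm.SameCycle.refl _ _
  | succ n ih => exact (F.sameCycle_turn e).trans ih

theorem rotation' (e e' : F.E') (h : F.vmap (Δ.src e) = F.vmap (Δ.src e')) :
    F.turn'.SameCycle e e' := by
  have hbc : ∀ d d' : F.E', Δ.src d = Δ.src F.b → Δ.src d' = Δ.toDGraph.tgt F.c →
      F.turn'.SameCycle d d' := by
    intro d d' h1 h2
    have h3 := F.sameCycle_of_src h1
    have h4 := F.sameCycle_of_src (e := Δ.rev F.c) (e' := d') h2.symm
    rw [emap_coe] at h3 h4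
    rw [emap_rev_c] at h4
    exact h3.trans h4
  rcases F.vmap_eq h with h | ⟨h1, h2⟩ | ⟨h1, h2⟩
  · simpa only [emap_coe] using F.sameCycle_of_src h
  · exact hbc _ _ h1 h2
  · exact (hbc _ _ h2 h1).symm

theorem ne_of_mem {e : Δ.E} (he : e ∈ F.l₁ ++ F.l₂) : e ≠ F.b ∧ e ≠ F.c := by
  have := F.nodup
  simp only [List.nodup_append, List.nodup_cons, List.mem_cons] at this
  rcases List.mem_append.1 he with h | h
  · exact ⟨this.2.2 e h F.b (Or.inl rfl), this.2.2 e h F.c (Or.inr (Or.inl rfl))⟩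
  · constructor
    · rintro rfl; exact this.2.1.1 (Or.inr h)
    · rintro rfl; exact this.2.1.2.1 h

theorem emap_injOn : ∀ e ∈ F.l₁ ++ F.l₂, ∀ e' ∈ F.l₁ ++ F.l₂, F.emap e = F.emap e' → e = e' := by
  intro e he e' he' h
  rw [F.emap_of_ne (F.ne_of_mem he).1 (F.ne_of_mem he).2,
    F.emap_of_ne (F.ne_of_mem he').1 (F.ne_of_mem he').2] at h
  exact congrArg Subtype.val h

theorem isChain' {x : Δ.E} {m : List Δ.E} (hm : F.l₁ = x :: m) :
    List.IsChain (fun a b => F.next' a = b)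
      ((F.l₁ ++ F.l₂).map F.emap ++ [F.emap x]) := by
  have hx : x ∈ F.l₁ ++ F.l₂ := by rw [hm]; simp
  have h0 : List.IsChain (fun a b => Δ.next a = b) (F.l₁ ++ F.b :: F.c :: F.l₂ ++ [x]) := by
    rw [← F.bdry_eq]
    exact (getElem_succ_mod_iff_isChain (m := m ++ F.b :: F.c :: F.l₂)
      (by rw [F.bdry_eq, hm]; rfl)).1 Δ.bdry_next
  have hstep : ∀ a ∈ F.l₁ ++ F.l₂, ∀ b ∈ F.l₁ ++ F.l₂, Δ.next a = b →
      F.next' (F.emap a) = F.emap b := by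
    rintro a ha _ hb rfl
    exact F.next'_emap (F.ne_of_mem ha).1 (F.ne_of_mem ha).2 (F.ne_of_mem hb).1
  have hmap : (F.l₁ ++ F.l₂).map F.emap ++ [F.emap x] = (F.l₁ ++ (F.l₂ ++ [x])).map F.emap := by
    simp
  rw [hmap, List.isChain_map]
  rw [List.append_assoc, List.cons_append, List.isChain_split, List.isChain_append] at h0
  obtain ⟨⟨h1, -, h2⟩, h3⟩ := h0
  rw [List.cons_append, List.isChain_cons_cons] at h3
  have h4 := h3.2
  rw [List.isChain_cons] at h4
  have imp : ∀ l : List Δ.E, (∀ a ∈ l, a ∈ F.l₁ ++ F.l₂) → l.IsChain (fun a b => Δ.next a = b) →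
      l.IsChain (fun a b => F.next' (F.emap a) = F.emap b) := by
    intro l hl h
    induction h with
    | nil => exact List.IsChain.nil
    | singleton a => exact List.IsChain.singleton a
    | cons_cons hab _ ih =>
      exact List.IsChain.cons_cons (hstep _ (hl _ (by simp)) _ (hl _ (by simp)) hab)
        (ih fun a ha => hl a (List.mem_cons_of_mem _ ha))
  rw [List.isChain_append]
  refine ⟨imp _ (fun a ha => List.mem_append_left _ ha) h1, imp _ ?_ h4.2, ?_⟩
  · intro a ha
    rcases List.mem_append.1 ha with h | h
    · exact List.mem_append_right _ h
    · rw [List.mem_singleton.1 h]; exact hx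
  · intro a ha b hb
    have h5 := h2 a ha F.b (by simp)
    have h6 := F.ne_of_mem (e := a) (List.mem_append_left _ (List.mem_of_mem_getLast? ha))
    rw [F.next'_emap_of_eq h6.1 h6.2 h5, h4.1 b hb]

theorem rev'_ne (e : F.E') : F.rev' e ≠ e := by
  intro h
  have h' : F.emap (Δ.rev e.1) = e := h
  by_cases hb : Δ.rev e.1 = F.b
  · rw [hb, emap_b] at h'
    have : (e : Δ.E) = Δ.rev F.b := (Δ.rev_rev _).symm.trans (congrArg _ hb)
    rw [← h'] at this
    exact F.b_ne_c (by rw [← Δ.rev_rev F.b, ← this, Δ.rev_rev])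
  by_cases hc : Δ.rev e.1 = F.c
  · rw [hc, emap_c] at h'
    have : (e : Δ.E) = Δ.rev F.c := (Δ.rev_rev _).symm.trans (congrArg _ hc)
    rw [← h'] at this
    exact F.b_ne_c (by rw [← Δ.rev_rev F.b, show Δ.rev F.b = Δ.rev F.c from this, Δ.rev_rev])
  · rw [F.emap_of_ne hb hc] at h'
    exact Δ.rev_ne _ (congrArg Subtype.val h')

theorem label_emap (e : Δ.E) : Δ.label (F.emap e).1 = Δ.label e := by
  by_cases hb : e = F.b
  · rw [hb, emap_b, Δ.label_rev, F.label_eq, P.inv_inv]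
  by_cases hc : e = F.c
  · rw [hc, emap_c, Δ.label_rev, F.label_eq]
  rw [F.emap_of_ne hb hc]

theorem label_rev' (e : F.E') : Δ.label (F.rev' e).1 = P.inv (Δ.label e.1) := by
  rw [rev', label_emap, Δ.label_rev]

theorem graph_connected : F.graph.simple.Connected := by
  have : Nonempty F.graph.V := ⟨F.vmap Δ.base⟩
  refine ⟨fun (a : F.V') (b : F.V') => ?_⟩
  have h : F.graph.simple.Reachable (F.vmap a.1) (F.vmap b.1) :=
    F.hom.reachable (Δ.connected.preconnected a.1 b.1)
  rwa [F.vmap_coe, F.vmap_coe] at h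

theorem iterate_turn' (e e' : F.E') (h : F.vmap (Δ.src e.1) = F.vmap (Δ.src e'.1)) :
    ∃ n : ℕ, (fun d => F.next' (F.rev' d))^[n] e = e' := by
  obtain ⟨n, hn⟩ := (F.rotation' e e' h).exists_nat_pow_eq
  rw [← Equiv.Perm.iterate_eq_pow] at hn
  exact ⟨n, hn⟩

/-- The boundary circuit of the folded diagram. -/
noncomputable def bdry' : List F.E' := (F.l₁ ++ F.l₂).map F.emap

theorem bdry'_nodup : F.bdry'.Nodup := List.Nodup.map_on F.emap_injOn (by
  have := F.nodup
  simp only [List.nodup_append, List.nodup_cons, List.mem_cons] at this ⊢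
  exact ⟨this.1, this.2.1.2.2, fun a ha b hb => this.2.2 a ha b (Or.inr (Or.inr hb))⟩)

theorem bdry'_next : ∀ (i : ℕ) (h : i < F.bdry'.length), F.next' F.bdry'[i] =
    F.bdry'[(i + 1) % F.bdry'.length]'(Nat.mod_lt _ (by omega)) := by
  obtain ⟨x, m, hm⟩ := List.exists_cons_of_ne_nil F.ne_nil
  exact (getElem_succ_mod_iff_isChain (m := (m ++ F.l₂).map F.emap) (by simp [bdry', hm])).2
    (F.isChain' hm)

theorem bdry'_base (e : F.E') (he : e ∈ F.bdry'.head?) : F.vmap (Δ.src e.1) = F.vmap Δ.base := by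
  obtain ⟨x, m, hm⟩ := List.exists_cons_of_ne_nil F.ne_nil
  rw [bdry', hm] at he
  obtain rfl : F.emap x = e := by simpa using he
  refine (F.src_emap x).trans (congrArg F.vmap (Δ.bdry_base x ?_))
  simp [F.bdry_eq, hm]

theorem bdry'_ne_nil : F.bdry' ≠ [] := by simp [bdry', F.ne_nil]

noncomputable instance fintypeV' : Fintype F.V' := inferInstance

noncomputable instance fintypeE' : Fintype F.E' := inferInstance

/-- The folded diagram, as a labelled map. -/
noncomputable def labelledMap : LabelledMap.{v} A P.inv where
  toDGraph := F.graph
  finV := F.fintypeV'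
  finE := F.fintypeE'
  rev_ne := F.rev'_ne
  label := fun e : F.E' => Δ.label e.1
  label_rev := F.label_rev'
  connected := F.graph_connected
  next := F.next'
  src_next := F.src_next'
  rotation := F.iterate_turn'
  base := F.vmap Δ.base
  bdry := F.bdry'
  bdry_nodup := F.bdry'_nodup
  bdry_next := F.bdry'_next
  bdry_base := F.bdry'_base
  bdry_nil h := absurd h F.bdry'_ne_nil

theorem emap_notMem {e : Δ.E} (he : e ∉ Δ.bdry) : F.emap e ∉ F.bdry' := by
  intro h
  rw [F.mem_bdry, not_or, not_or] at he
  obtain ⟨d, hd, h⟩ := List.mem_map.1 h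
  have h1 := F.ne_of_mem hd
  rw [F.emap_of_ne h1.1 h1.2, F.emap_of_ne he.1 he.2.1] at h
  have h2 : d = e := congrArg Subtype.val h
  exact he.2.2 (h2 ▸ hd)

theorem next'_emap_of_notMem {e : Δ.E} (he : e ∉ Δ.bdry) :
    F.next' (F.emap e) = F.emap (Δ.next e) := by
  have h1 : Δ.next e ≠ F.b := fun h =>
    he (LabelledMap.next_mem_bdry.1 (h ▸ F.mem_bdry.2 (Or.inl rfl)))
  rw [F.mem_bdry, not_or, not_or] at he
  exact F.next'_emap he.1 he.2.1 h1

/-- The folding map. -/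
noncomputable def cellMap : LabelledMap.CellMap Δ.toLabelledMap F.labelledMap where
  toHom := F.hom
  label_onE := F.label_emap
  onV_base := rfl
  onE_notMem _ he := F.emap_notMem he
  next_onE _ he := F.next'_emap_of_notMem he

theorem cornerInjective : F.cellMap.CornerInjective := by
  intro e he e' he' h
  rw [F.mem_bdry, not_or, not_or] at he he'
  have h' : F.emap e = F.emap e' := h
  rw [F.emap_of_ne he.1 he.2.1, F.emap_of_ne he'.1 he'.2.1] at h'
  exact congrArg Subtype.val h'

theorem exists_corner (e : F.E') (he : e ∉ F.bdry') :
    ∃ d ∉ Δ.bdry, F.emap d = e := by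
  refine ⟨e.1, ?_, F.emap_coe e⟩
  rw [F.mem_bdry, not_or, not_or]
  refine ⟨e.2.1, e.2.2, fun h => he ?_⟩
  exact List.mem_map.2 ⟨_, h, F.emap_coe e⟩

theorem card_face : Nat.card F.labelledMap.Face = Nat.card Δ.toLabelledMap.Face := by
  refine (Nat.card_eq_of_bijective F.cellMap.faceMap
    ⟨F.cornerInjective.faceMap_injective, fun Φ => ?_⟩).symm
  induction Φ using Quotient.ind with
  | _ c =>
    obtain ⟨d, hd, h⟩ := F.exists_corner c.1 c.2
    exact ⟨Quotient.mk _ ⟨d, hd⟩, congrArg (Quotient.mk _) (Subtype.ext h)⟩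

/-- The labels of `b` and `c` are inverse to each other, so the two merged vertices have the same
image in G. -/
theorem pos_vmap (a : Δ.V) : Δ.pos (F.vmap a).1 = Δ.pos a := by
  unfold vmap
  split_ifs with h
  · rw [h, Δ.pos_tgt, F.label_eq, P.val_inv, F.src_c, Δ.pos_tgt]
    simp
  · rfl

theorem card_V' : Nat.card F.V' + 1 = Nat.card Δ.V := by
  have : Nat.card F.V' = Nat.card Δ.V - 1 := by
    rw [Nat.card_eq_fintype_card, Nat.card_eq_fintype_card, Fintype.card_subtype_compl,
      Fintype.card_subtype_eq]
  have hp : 0 < Nat.card Δ.V := Nat.card_pos_iff.2 ⟨⟨Δ.base⟩, inferInstance⟩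
  omega

theorem card_E' : Nat.card F.E' + 2 = Nat.card Δ.E := by
  have h3 : Nat.card F.E' = Nat.card Δ.E - 2 := by
    have h4 := Fintype.card_subtype_compl (fun e => e ∈ ({F.b, F.c} : Finset Δ.E))
    rw [Fintype.card_coe, Finset.card_pair F.b_ne_c] at h4
    rw [Nat.card_eq_fintype_card, Nat.card_eq_fintype_card, ← h4]
    refine Fintype.card_congr (Equiv.subtypeEquivRight fun e => ?_)
    simp
  have h5 : 2 ≤ Nat.card Δ.E := by
    rw [Nat.card_eq_fintype_card, ← Finset.card_pair F.b_ne_c]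
    exact Finset.card_le_univ _
  omega

/-- One vertex and one undirected edge are lost, and inner faces correspond bijectively. -/
theorem euler' :
    2 * Nat.card F.V' + 2 * Nat.card F.labelledMap.Face = Nat.card F.E' + 2 := by
  have h1 := F.card_V'
  have h2 := F.card_E'
  have := Δ.euler
  rw [F.card_face]
  omega

theorem relator' (e : F.E') (he : e ∉ F.bdry') : F.labelledMap.faceWord e ∈ P.rels := by
  obtain ⟨d, hd, rfl⟩ := F.exists_corner e he
  have := F.cornerInjective.faceWord hd
  change F.labelledMap.faceWord (F.emap d) = _ at this
  rw [this]
  exact Δ.relator d hd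

theorem pos_tgt' (e : F.E') : Δ.pos (F.vmap (Δ.src (F.rev' e).1)).1 =
    Δ.pos (F.vmap (Δ.src e.1)).1 * P.val (Δ.label e.1) := by
  rw [rev', F.src_emap, F.pos_vmap, F.pos_vmap]
  exact Δ.pos_tgt _

/-- The folded diagram. -/
noncomputable def diagram : VanKampenDiagram P where
  toLabelledMap := F.labelledMap
  euler := F.euler'
  relator := F.relator'
  pos := fun a : F.V' => Δ.pos a.1
  pos_base := (F.pos_vmap _).trans Δ.pos_base
  pos_tgt := F.pos_tgt'

/-- The merged vertices are equally far from the base vertex, so the distance function descends to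
the quotient. -/
theorem isRadial_cellMap (hdist : Δ.toDGraph.simple.dist Δ.base (Δ.src F.b) =
      Δ.toDGraph.simple.dist Δ.base (Δ.toDGraph.tgt F.c)) : F.cellMap.IsRadial := by
  have hD : ∀ a, Δ.toDGraph.simple.dist Δ.base (F.vmap a).1 =
      Δ.toDGraph.simple.dist Δ.base a := by
    intro a
    unfold vmap
    split_ifs with h
    · rw [h]; exact hdist
    · rfl
  refine LabelledMap.CellMap.isRadial_of_step _
    (D := fun a : F.V' => Δ.toDGraph.simple.dist Δ.base a.1) hD fun (e : F.E') => ?_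
  change Δ.toDGraph.simple.dist Δ.base (F.vmap (Δ.src (F.emap (Δ.rev e.1)).1)).1 ≤
    Δ.toDGraph.simple.dist Δ.base (F.vmap (Δ.src e.1)).1 + 1
  rw [F.src_emap, hD, hD]
  exact DGraph.dist_tgt_le Δ.connected _ _

end FoldData

/-- Two consecutive boundary edges with inverse labels and different ends can be folded together; if
the ends have the same distance from the base vertex, then all distances are preserved. -/
theorem exists_fold {Δ : VanKampenDiagram P} {b c : Δ.E} {l₁ l₂ : List Δ.E}
    (hbdry : Δ.bdry = l₁ ++ b :: c :: l₂) (hl : l₁ ≠ [])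
    (hlabel : Δ.label c = P.inv (Δ.label b)) (hne : Δ.src b ≠ Δ.toDGraph.tgt c)
    (hdist : Δ.toDGraph.simple.dist Δ.base (Δ.src b) =
      Δ.toDGraph.simple.dist Δ.base (Δ.toDGraph.tgt c)) :
    ∃ (Δ' : VanKampenDiagram P) (φ : LabelledMap.CellMap Δ.toLabelledMap Δ'.toLabelledMap),
      Δ'.bdry = (l₁ ++ l₂).map φ.onE ∧ φ.onE b = Δ'.rev (φ.onE c) ∧ φ.IsRadial ∧
      (∀ a, Δ'.pos (φ.onV a) = Δ.pos a) ∧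
      ∀ a a', φ.onV a = φ.onV a' → a = a' ∨ a = Δ.src b ∧ a' = Δ.toDGraph.tgt c ∨
        a = Δ.toDGraph.tgt c ∧ a' = Δ.src b := by
  let F : FoldData Δ := ⟨b, c, l₁, l₂, hbdry, hl, hlabel, hne⟩
  refine ⟨F.diagram, F.cellMap, rfl, ?_, F.isRadial_cellMap hdist, F.pos_vmap,
    fun a a' => F.vmap_eq⟩
  change F.emap b = F.rev' (F.emap c)
  rw [F.rev'_emap]
  exact F.emap_rev_c.symm

end VanKampenDiagram

/-- The identity as a cellular map. -/
def LabelledMap.CellMap.refl {A : Type v} {inv : A → A} (Δ : LabelledMap.{v} A inv) :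
    LabelledMap.CellMap Δ Δ where
  onV := id
  onE := id
  src_onE _ := rfl
  rev_onE _ := rfl
  label_onE _ := rfl
  onV_base := rfl
  onE_notMem _ h := h
  next_onE _ _ := rfl

/-! ### Iterated folds and wedges of diagrams -/

namespace VanKampenDiagram
variable {G : Type u} [Group G] {A : Type v} {P : SymmetrizedPresentation G A}

/-- Iterated folding of a boundary path `b_m … b_1 c_1 … c_m`, where `L` lists the pairs
`(b_i, c_i)`. -/
theorem exists_zip (n : ℕ) : ∀ (Δ : VanKampenDiagram P) (L : List (Δ.E × Δ.E)) (l₁ l₂ : List Δ.E),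
    L.length = n → Δ.bdry = l₁ ++ (L.map Prod.fst).reverse ++ L.map Prod.snd ++ l₂ → l₁ ≠ [] →
    (∀ p ∈ L, Δ.label p.2 = P.inv (Δ.label p.1) ∧ Δ.src p.1 ≠ Δ.toDGraph.tgt p.2 ∧
      Δ.toDGraph.simple.dist Δ.base (Δ.src p.1) =
        Δ.toDGraph.simple.dist Δ.base (Δ.toDGraph.tgt p.2) ∧
      Δ.pos (Δ.src p.1) = Δ.pos (Δ.toDGraph.tgt p.2)) →
    (L.map fun p => Δ.pos (Δ.src p.1)).Nodup →
    ∃ (Δ' : VanKampenDiagram P) (φ : LabelledMap.CellMap Δ.toLabelledMap Δ'.toLabelledMap),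
      Δ'.bdry = (l₁ ++ l₂).map φ.onE ∧ (∀ p ∈ L, φ.onE p.1 = Δ'.rev (φ.onE p.2)) ∧ φ.IsRadial ∧
      ∀ a, Δ'.pos (φ.onV a) = Δ.pos a := by
  induction n with
  | zero =>
    intro Δ L l₁ l₂ hn hb _ _ _
    obtain rfl := List.length_eq_zero_iff.1 hn
    refine ⟨Δ, .refl _, ?_, by simp, fun _ => rfl, fun _ => rfl⟩
    rw [hb]
    simp [LabelledMap.CellMap.refl]
  | succ n ih =>
    rintro Δ (_ | ⟨⟨b, c⟩, L⟩) l₁ l₂ hn hb hl hL hnd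
    · simp at hn
    have hbc := hL (b, c) (by simp)
    obtain ⟨Δ₁, φ, h1, h2, h3, h4, h5⟩ := exists_fold (Δ := Δ) (b := b) (c := c)
      (l₁ := l₁ ++ (L.map Prod.fst).reverse) (l₂ := L.map Prod.snd ++ l₂)
      (by rw [hb]; simp) (by simp [hl]) hbc.1 hbc.2.1 hbc.2.2.1
    rw [List.map_cons, List.nodup_cons] at hnd
    obtain ⟨Δ₂, ψ, k1, k2, k3, k4⟩ := ih Δ₁ (L.map fun p => (φ.onE p.1, φ.onE p.2))
      (l₁.map φ.onE) (l₂.map φ.onE) (by simpa using hn)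
      (by rw [h1]; simp [Function.comp_def])
      (by simpa using hl) (by
        intro p' hp'
        obtain ⟨p, hp, rfl⟩ := List.mem_map.1 hp'
        obtain ⟨g1, g2, g3, g4⟩ := hL p (List.mem_cons_of_mem _ hp)
        refine ⟨by rw [φ.label_onE, φ.label_onE, g1], ?_, ?_, ?_⟩
        -- The first fold merges only the outer ends of `b` and `c`, whose image in G is not that of
        -- the ends of `p`. Hence the ends of `p` are still distinct and this pair can be folded
        -- later.
        · have hne : Δ.pos (Δ.src p.1) ≠ Δ.pos (Δ.src b) := fun h =>
            hnd.1 (h ▸ List.mem_map.2 ⟨p, hp, rfl⟩)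
          simp only [φ.src_onE, φ.tgt_onE]
          intro h
          rcases h5 _ _ h with h | h | h
          · exact g2 h
          · exact hne (congrArg Δ.pos h.1)
          · exact hne ((congrArg Δ.pos h.1).trans hbc.2.2.2.symm)
        · simp only [φ.src_onE, φ.tgt_onE, h3 _, g3]
        · simp only [φ.src_onE, φ.tgt_onE, h4, g4])
      (by simpa only [List.map_map, Function.comp_def, φ.src_onE, h4] using hnd.2)
    refine ⟨Δ₂, ψ.comp φ, ?_, ?_, k3.comp h3, fun a => (k4 _).trans (h4 _)⟩
    · rw [k1]
      simp [LabelledMap.CellMap.comp]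
    · intro p hp
      rcases List.mem_cons.1 hp with rfl | hp
      · change ψ.onE (φ.onE b) = Δ₂.rev (ψ.onE (φ.onE c))
        rw [h2, ψ.rev_onE]
      · exact k2 _ (List.mem_map.2 ⟨p, hp, rfl⟩)

/-- Two diagrams with nonempty boundary, to be joined at their base vertices. -/
structure WedgeData (P : SymmetrizedPresentation G A) where
  left : VanKampenDiagram P
  right : VanKampenDiagram P
  x₁ : left.E
  m₁ : List left.E
  bdry_left : left.bdry = x₁ :: m₁
  x₂ : right.E
  m₂ : List right.E
  bdry_right : right.bdry = x₂ :: m₂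

namespace WedgeData
variable (W : WedgeData P)
open Classical

/-- The vertices of the wedge. -/
abbrev V' : Type := W.left.V ⊕ {a : W.right.V // a ≠ W.right.base}

/-- The edges of the wedge. -/
abbrev E' : Type := W.left.E ⊕ W.right.E

/-- The inclusion of the vertices of the second diagram. -/
noncomputable def inrV (a : W.right.V) : W.V' :=
  if h : a = W.right.base then .inl W.left.base else .inr ⟨a, h⟩

theorem inrV_base : W.inrV W.right.base = .inl W.left.base := dif_pos rfl

theorem inrV_coe (a : {a : W.right.V // a ≠ W.right.base}) : W.inrV a = .inr a := dif_neg a.2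

theorem inrV_eq_inl {a : W.right.V} {b : W.left.V} (h : W.inrV a = .inl b) :
    a = W.right.base ∧ b = W.left.base := by
  unfold inrV at h
  split_ifs at h with ha
  exact ⟨ha, (Sum.inl.inj h).symm⟩

theorem inrV_injective : Function.Injective W.inrV := by
  intro a b h
  unfold inrV at h
  split_ifs at h with h1 h2 h2
  · exact h1.trans h2.symm
  · exact congrArg Subtype.val (Sum.inr.inj h)

/-- The initial vertices. -/
noncomputable def src' : W.E' → W.V' :=
  Sum.elim (fun e => .inl (W.left.src e)) fun e => W.inrV (W.right.src e)

/-- The reversal. -/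
def rev' : W.E' → W.E' := Sum.map W.left.rev W.right.rev

theorem rev'_rev' (e : W.E') : W.rev' (W.rev' e) = e := by
  rcases e with e | e <;> simp [rev', DGraph.rev_rev]

/-- The boundary permutation. -/
noncomputable def next' : Equiv.Perm W.E' :=
  -- Exchanging the first edges of the two outer cycles merges these cycles into one.
  Equiv.swap (.inl W.x₁) (.inr W.x₂) * Equiv.sumCongr W.left.next W.right.next

theorem next'_inl {e : W.left.E} (h : W.left.next e ≠ W.x₁) :
    W.next' (.inl e) = .inl (W.left.next e) := by
  simp [next', Equiv.swap_apply_of_ne_of_ne, h]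

theorem next'_inl_of_eq {e : W.left.E} (h : W.left.next e = W.x₁) :
    W.next' (.inl e) = .inr W.x₂ := by
  simp [next', h]

theorem next'_inr {e : W.right.E} (h : W.right.next e ≠ W.x₂) :
    W.next' (.inr e) = .inr (W.right.next e) := by
  simp [next', Equiv.swap_apply_of_ne_of_ne, h]

theorem next'_inr_of_eq {e : W.right.E} (h : W.right.next e = W.x₂) :
    W.next' (.inr e) = .inl W.x₁ := by
  simp [next', h]

theorem src_x₁ : W.left.src W.x₁ = W.left.base := W.left.bdry_base _ (by simp [W.bdry_left])

theorem src_x₂ : W.right.src W.x₂ = W.right.base := W.right.bdry_base _ (by simp [W.bdry_right])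

theorem src'_next' (e : W.E') : W.src' (W.next' e) = W.src' (W.rev' e) := by
  rcases e with e | e
  · by_cases h : W.left.next e = W.x₁
    · rw [W.next'_inl_of_eq h]
      simp [src', rev', ← W.left.src_next, h, W.src_x₁, W.src_x₂, inrV_base]
    · rw [W.next'_inl h]
      simp [src', rev', W.left.src_next]
  · by_cases h : W.right.next e = W.x₂
    · rw [W.next'_inr_of_eq h]
      simp [src', rev', ← W.right.src_next, h, W.src_x₁, W.src_x₂, inrV_base]
    · rw [W.next'_inr h]
      simp [src', rev', W.right.src_next]

/-- The turn in the wedge. -/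
noncomputable def turn' : Equiv.Perm W.E' :=
  (Function.Involutive.toPerm W.rev' W.rev'_rev').trans W.next'

theorem sameCycle_turn' {e e' : W.E'} (h : W.turn' e = e') : W.turn'.SameCycle e e' :=
  ⟨1, by simpa using h⟩

theorem sameCycle_inr (n : ℕ) (e : W.right.E) (h : W.right.turn (W.right.turn^[n] e) = W.x₂) :
    W.turn'.SameCycle (.inr e) (.inl W.x₁) := by
  induction n generalizing e with
  | zero => exact W.sameCycle_turn' (W.next'_inr_of_eq h)
  | succ n ih =>
    by_cases h0 : W.right.turn e = W.x₂
    · exact W.sameCycle_turn' (W.next'_inr_of_eq h0)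
    · exact (W.sameCycle_turn' (W.next'_inr h0)).trans (ih _ h)

/-- The turn that starts at `x₂` runs through the edges at the base vertex of the second diagram;
the last one, instead of returning to `x₂`, leads to `x₁`. This splices the cyclic orders at the two
base vertices. -/
theorem sameCycle_x : W.turn'.SameCycle (.inr W.x₂) (.inl W.x₁) := by
  obtain ⟨n, hn⟩ := LabelledMap.exists_turn_iterate (Δ := W.right.toLabelledMap)
    (e := W.x₂) (e' := W.right.turn.symm W.x₂)
    (by rw [← LabelledMap.src_turn (W.right.turn.symm W.x₂), Equiv.apply_symm_apply])
  exact W.sameCycle_inr n _ (by rw [hn, Equiv.apply_symm_apply])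

theorem sameCycle_inl_turn (e : W.left.E) :
    W.turn'.SameCycle (.inl e) (.inl (W.left.turn e)) := by
  by_cases h : W.left.turn e = W.x₁
  · rw [h]
    exact (W.sameCycle_turn' (W.next'_inl_of_eq h)).trans W.sameCycle_x
  · exact W.sameCycle_turn' (W.next'_inl h)

theorem sameCycle_inr_turn (e : W.right.E) :
    W.turn'.SameCycle (.inr e) (.inr (W.right.turn e)) := by
  by_cases h : W.right.turn e = W.x₂
  · rw [h]
    exact (W.sameCycle_turn' (W.next'_inr_of_eq h)).trans W.sameCycle_x.symm
  · exact W.sameCycle_turn' (W.next'_inr h)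

theorem sameCycle_inl {e e' : W.left.E} (h : W.left.src e = W.left.src e') :
    W.turn'.SameCycle (.inl e) (.inl e') := by
  obtain ⟨n, rfl⟩ := LabelledMap.exists_turn_iterate h
  clear h
  induction n generalizing e with
  | zero => exact Equiv.Perm.SameCycle.refl _ _
  | succ n ih => exact (W.sameCycle_inl_turn e).trans ih

theorem sameCycle_inr_of_src {e e' : W.right.E} (h : W.right.src e = W.right.src e') :
    W.turn'.SameCycle (.inr e) (.inr e') := by
  obtain ⟨n, rfl⟩ := LabelledMap.exists_turn_iterate h
  clear h
  induction n generalizing e with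
  | zero => exact Equiv.Perm.SameCycle.refl _ _
  | succ n ih => exact (W.sameCycle_inr_turn e).trans ih

theorem rotation' (e e' : W.E') (h : W.src' e = W.src' e') :
    ∃ n : ℕ, (fun d => W.next' (W.rev' d))^[n] e = e' := by
  have key : W.turn'.SameCycle e e' := by
    have hx : ∀ (d : W.left.E) (d' : W.right.E), W.src' (.inl d) = W.src' (.inr d') →
        W.turn'.SameCycle (.inl d) (.inr d') := by
      intro d d' h
      obtain ⟨h1, h2⟩ := W.inrV_eq_inl h.symm
      exact ((W.sameCycle_inl (h2.trans W.src_x₁.symm)).trans W.sameCycle_x.symm).trans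
        (W.sameCycle_inr_of_src (W.src_x₂.trans h1.symm))
    rcases e with e | e <;> rcases e' with e' | e'
    · exact W.sameCycle_inl (Sum.inl.inj h)
    · exact hx _ _ h
    · exact (hx _ _ h.symm).symm
    · exact W.sameCycle_inr_of_src (W.inrV_injective h)
  obtain ⟨n, hn⟩ := key.exists_nat_pow_eq
  rw [← Equiv.Perm.iterate_eq_pow] at hn
  exact ⟨n, hn⟩

/-- The graph of the wedge. -/
noncomputable def graph : DGraph.{0, 0} where
  V := W.V'
  E := W.E'
  src := W.src'
  rev := W.rev'
  rev_rev := W.rev'_rev'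

/-- The inclusion of the first graph. -/
noncomputable def homLeft : DGraph.Hom W.left.toDGraph W.graph where
  onV := Sum.inl
  onE := Sum.inl
  src_onE _ := rfl
  rev_onE _ := rfl

/-- The inclusion of the second graph. -/
noncomputable def homRight : DGraph.Hom W.right.toDGraph W.graph where
  onV := W.inrV
  onE := Sum.inr
  src_onE _ := rfl
  rev_onE _ := rfl

theorem graph_connected : W.graph.simple.Connected := by
  have : Nonempty W.graph.V := ⟨Sum.inl W.left.base⟩
  have h : ∀ a : W.V', W.graph.simple.Reachable (Sum.inl W.left.base : W.V') a := by
    rintro (a | a)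
    · exact W.homLeft.reachable (W.left.connected.preconnected W.left.base a)
    · have := W.homRight.reachable (W.right.connected.preconnected W.right.base a)
      change W.graph.simple.Reachable (W.inrV W.right.base) (W.inrV a) at this
      rwa [inrV_base, inrV_coe] at this
  exact ⟨fun a b => (h a).symm.trans (h b)⟩

/-- The boundary circuit of the wedge. -/
def bdry' : List W.E' := W.left.bdry.map .inl ++ W.right.bdry.map .inr

theorem bdry'_nodup : W.bdry'.Nodup := by
  refine List.nodup_append.2 ⟨W.left.bdry_nodup.map Sum.inl_injective,
    W.right.bdry_nodup.map Sum.inr_injective, ?_⟩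
  simp

/-- Cuts a cycle open at its first entry x. Since no entry repeats, x is the successor of the last
entry only, and there `g` continues with z. -/
theorem isChain_of_cycle {α β : Type*} {f : α → α} {g : β → β} {i : α → β} {x : α} {m : List α}
    {z : β} (hnd : (x :: m).Nodup) (h : List.IsChain (fun a b => f a = b) (x :: m ++ [x]))
    (h1 : ∀ e, f e ≠ x → g (i e) = i (f e)) (h2 : ∀ e, f e = x → g (i e) = z) :
    List.IsChain (fun a b => g a = b) ((x :: m).map i ++ [z]) := by
  rw [List.isChain_append] at h ⊢
  refine ⟨?_, List.IsChain.singleton _, ?_⟩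
  · rw [List.isChain_map, List.isChain_iff_getElem]
    intro j hj
    have h3 := List.isChain_iff_getElem.1 h.1 j hj
    rw [← h3]
    refine h1 _ fun h4 => ?_
    have h5 : (x :: m)[j + 1] = (x :: m)[0] := h3.symm.trans h4
    simpa using (List.Nodup.getElem_inj_iff hnd).1 h5
  · intro a ha b hb
    obtain ⟨y, hy, rfl⟩ : ∃ y, y ∈ (x :: m).getLast? ∧ i y = a := by
      rw [List.getLast?_map] at ha
      simpa [Option.mem_def] using ha
    have : z = b := by simpa using hb
    rw [← this]
    exact h2 y (h.2.2 y hy x (by simp))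

theorem bdry'_next : ∀ (i : ℕ) (h : i < W.bdry'.length), W.next' W.bdry'[i] =
    W.bdry'[(i + 1) % W.bdry'.length]'(Nat.mod_lt _ (by omega)) := by
  refine (getElem_succ_mod_iff_isChain (x := (.inl W.x₁ : W.E'))
    (m := W.m₁.map .inl ++ W.right.bdry.map .inr) (by simp [bdry', W.bdry_left])).2 ?_
  have h1 := (getElem_succ_mod_iff_isChain W.bdry_left).1 W.left.bdry_next
  have h2 := (getElem_succ_mod_iff_isChain W.bdry_right).1 W.right.bdry_next
  have n1 := W.left.bdry_nodup
  have n2 := W.right.bdry_nodup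
  rw [W.bdry_left] at h1 n1
  rw [W.bdry_right] at h2 n2
  have k1 := isChain_of_cycle (i := (Sum.inl : _ → W.E')) (g := W.next') (z := .inr W.x₂) n1 h1
    (fun e he => W.next'_inl he) (fun e he => W.next'_inl_of_eq he)
  have k2 := isChain_of_cycle (i := (Sum.inr : _ → W.E')) (g := W.next') (z := .inl W.x₁) n2 h2
    (fun e he => W.next'_inr he) (fun e he => W.next'_inr_of_eq he)
  rw [bdry', W.bdry_left, W.bdry_right, List.append_assoc, List.map_cons (f := Sum.inr),
    List.cons_append, List.isChain_split]
  exact ⟨k1, k2⟩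

theorem bdry'_base (e : W.E') (he : e ∈ W.bdry'.head?) : W.src' e = .inl W.left.base := by
  rw [bdry', W.bdry_left] at he
  obtain rfl : Sum.inl W.x₁ = e := by simpa using he
  exact congrArg Sum.inl W.src_x₁

theorem bdry'_ne_nil : W.bdry' ≠ [] := by simp [bdry', W.bdry_left]

theorem inl_mem_bdry' {e : W.left.E} : (.inl e : W.E') ∈ W.bdry' ↔ e ∈ W.left.bdry := by
  simp [bdry']

theorem inr_mem_bdry' {e : W.right.E} : (.inr e : W.E') ∈ W.bdry' ↔ e ∈ W.right.bdry := by
  simp [bdry']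

noncomputable instance fintypeV' : Fintype W.V' := inferInstance

noncomputable instance fintypeE' : Fintype W.E' := inferInstance

/-- The wedge, as a labelled map. -/
noncomputable def labelledMap : LabelledMap.{v} A P.inv where
  toDGraph := W.graph
  finV := W.fintypeV'
  finE := W.fintypeE'
  rev_ne := by
    rintro (e | e) h
    · exact W.left.rev_ne e (Sum.inl.inj h)
    · exact W.right.rev_ne e (Sum.inr.inj h)
  label := (Sum.elim W.left.label W.right.label : W.E' → A)
  label_rev := by
    rintro (e | e)
    · exact W.left.label_rev e
    · exact W.right.label_rev e
  connected := W.graph_connected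
  next := W.next'
  src_next := W.src'_next'
  rotation := W.rotation'
  base := (Sum.inl W.left.base : W.V')
  bdry := W.bdry'
  bdry_nodup := W.bdry'_nodup
  bdry_next := W.bdry'_next
  bdry_base := W.bdry'_base
  bdry_nil h := absurd h W.bdry'_ne_nil

/-- The inclusion of the first diagram. -/
noncomputable def cellLeft : LabelledMap.CellMap W.left.toLabelledMap W.labelledMap where
  toHom := W.homLeft
  label_onE _ := rfl
  onV_base := rfl
  onE_notMem _ he h := he (W.inl_mem_bdry'.1 h)
  next_onE e he := W.next'_inl fun h => he (LabelledMap.next_mem_bdry.1 (by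
    rw [h, W.bdry_left]; simp))

/-- The inclusion of the second diagram. -/
noncomputable def cellRight : LabelledMap.CellMap W.right.toLabelledMap W.labelledMap where
  toHom := W.homRight
  label_onE _ := rfl
  onV_base := W.inrV_base
  onE_notMem _ he h := he (W.inr_mem_bdry'.1 h)
  next_onE e he := W.next'_inr fun h => he (LabelledMap.next_mem_bdry.1 (by
    rw [h, W.bdry_right]; simp))

theorem cornerInjective_left : W.cellLeft.CornerInjective := fun _ _ _ _ h => Sum.inl.inj h

theorem cornerInjective_right : W.cellRight.CornerInjective := fun _ _ _ _ h => Sum.inr.inj h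

theorem exists_next'_pow_inl {e : W.left.E} (he : e ∉ W.left.bdry) (n : ℕ) :
    ∃ d : W.left.E, (W.next' ^ n) (.inl e) = .inl d :=
  ⟨_, W.cellLeft.next_pow_onE he n⟩

theorem card_face : Nat.card W.labelledMap.Face =
    Nat.card W.left.toLabelledMap.Face + Nat.card W.right.toLabelledMap.Face := by
  have hfin : ∀ Δ : LabelledMap.{v} A P.inv, Finite Δ.Face := fun Δ => by
    have : Finite Δ.Corner := inferInstanceAs (Finite {e : Δ.E // e ∉ Δ.bdry})
    exact inferInstanceAs (Finite (Quotient Δ.faceSetoid))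
  have := hfin W.left.toLabelledMap
  have := hfin W.right.toLabelledMap
  rw [← Nat.card_sum]
  refine (Nat.card_eq_of_bijective (Sum.elim W.cellLeft.faceMap W.cellRight.faceMap) ⟨?_, ?_⟩).symm
  · refine W.cornerInjective_left.faceMap_injective.sumElim
      W.cornerInjective_right.faceMap_injective fun F F' => ?_
    induction F, F' using Quotient.inductionOn₂ with
    | h c c' =>
      intro h
      obtain ⟨n, hn⟩ := Equiv.Perm.SameCycle.exists_nat_pow_eq (Quotient.exact h)
      obtain ⟨d, hd⟩ := W.exists_next'_pow_inl c.2 n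
      have h1 : (.inl d : W.E') = .inr c'.1 := hd.symm.trans hn
      cases h1
  · intro F
    induction F using Quotient.ind with
    | _ c =>
      obtain ⟨(c | c), hc⟩ := c
      · exact ⟨.inl (Quotient.mk _ ⟨c, fun h => hc (W.inl_mem_bdry'.2 h)⟩), rfl⟩
      · exact ⟨.inr (Quotient.mk _ ⟨c, fun h => hc (W.inr_mem_bdry'.2 h)⟩), rfl⟩

theorem card_V' : Nat.card W.V' + 1 = Nat.card W.left.V + Nat.card W.right.V := by
  have h1 : Nat.card {a : W.right.V // a ≠ W.right.base} = Nat.card W.right.V - 1 := by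
    rw [Nat.card_eq_fintype_card, Nat.card_eq_fintype_card, Fintype.card_subtype_compl,
      Fintype.card_subtype_eq]
  have h2 : 0 < Nat.card W.right.V := Nat.card_pos_iff.2 ⟨⟨W.right.base⟩, inferInstance⟩
  rw [Nat.card_sum, h1]
  omega

/-- Vertices add up except for the shared base vertex; edges and inner faces simply add up. -/
theorem euler' : 2 * Nat.card W.V' + 2 * Nat.card W.labelledMap.Face = Nat.card W.E' + 2 := by
  have h1 := W.card_V'
  have h2 := W.left.euler
  have h3 := W.right.euler
  have hE : Nat.card W.E' = Nat.card W.left.E + Nat.card W.right.E := Nat.card_sum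
  rw [W.card_face]
  omega

theorem relator' (e : W.E') (he : e ∉ W.bdry') : W.labelledMap.faceWord e ∈ P.rels := by
  rcases e with e | e
  · have he' : e ∉ W.left.bdry := fun h => he (W.inl_mem_bdry'.2 h)
    have := W.cornerInjective_left.faceWord he'
    change W.labelledMap.faceWord (.inl e : W.E') = _ at this
    rw [this]
    exact W.left.relator e he'
  · have he' : e ∉ W.right.bdry := fun h => he (W.inr_mem_bdry'.2 h)
    have := W.cornerInjective_right.faceWord he'
    change W.labelledMap.faceWord (.inr e : W.E') = _ at this
    rw [this]
    exact W.right.relator e he'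

/-- The map to the Cayley graph on vertices. -/
def pos' : W.V' → G := Sum.elim W.left.pos fun a => W.right.pos a

theorem pos'_inrV (a : W.right.V) : W.pos' (W.inrV a) = W.right.pos a := by
  unfold inrV
  split_ifs with h
  · rw [h]
    exact W.left.pos_base.trans W.right.pos_base.symm
  · rfl

/-- The wedge of two diagrams at their base vertices. -/
noncomputable def diagram : VanKampenDiagram P where
  toLabelledMap := W.labelledMap
  euler := W.euler'
  relator := W.relator'
  pos := W.pos'
  pos_base := W.left.pos_base
  pos_tgt := by
    rintro (e | e)
    · exact W.left.pos_tgt e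
    · refine (W.pos'_inrV _).trans ((W.right.pos_tgt e).trans ?_)
      rw [← W.pos'_inrV (W.right.src e)]
      rfl

/-- The distance from the base vertex of the wedge. -/
noncomputable def depth : W.V' → ℕ :=
  Sum.elim (W.left.toDGraph.simple.dist W.left.base)
    fun a => W.right.toDGraph.simple.dist W.right.base a

theorem depth_inrV (a : W.right.V) :
    W.depth (W.inrV a) = W.right.toDGraph.simple.dist W.right.base a := by
  unfold inrV
  split_ifs with h
  · rw [h, SimpleGraph.dist_self]
    exact SimpleGraph.dist_self
  · rfl

theorem depth_step (e : W.E') : W.depth (W.src' (W.rev' e)) ≤ W.depth (W.src' e) + 1 := by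
  rcases e with e | e
  · exact DGraph.dist_tgt_le W.left.connected _ e
  · change W.depth (W.inrV _) ≤ W.depth (W.inrV _) + 1
    rw [depth_inrV, depth_inrV]
    exact DGraph.dist_tgt_le W.right.connected _ e

theorem isRadial_left : W.cellLeft.IsRadial :=
  LabelledMap.CellMap.isRadial_of_step _ (D := W.depth) (fun _ => rfl) W.depth_step

theorem isRadial_right : W.cellRight.IsRadial :=
  LabelledMap.CellMap.isRadial_of_step _ (D := W.depth) W.depth_inrV W.depth_step

end WedgeData
end VanKampenDiagram

/-! ### Mirror images of diagrams -/

theorem LabelledMap.isWalk_walkRev_bdry {A : Type v} {inv : A → A} (Δ : LabelledMap.{v} A inv) :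
    Δ.toDGraph.IsWalk Δ.base (Δ.toDGraph.walkRev Δ.bdry) := by
  have := Δ.isWalk_bdry.walkRev
  rwa [Δ.walkEnd_bdry] at this

namespace LabelledMap
variable {A : Type v} {inv : A → A} (Δ : LabelledMap.{v} A inv)

/-- The reversal of edges, as a permutation. -/
def revPerm : Equiv.Perm Δ.E := Function.Involutive.toPerm Δ.rev Δ.rev_rev

theorem revPerm_apply (e : Δ.E) : Δ.revPerm e = Δ.rev e := rfl

/-- The boundary permutation of the mirror image. -/
def mirrorNext : Equiv.Perm Δ.E := Δ.revPerm * Δ.next⁻¹ * Δ.revPerm⁻¹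

theorem mirrorNext_apply (e : Δ.E) : Δ.mirrorNext e = Δ.rev (Δ.next⁻¹ (Δ.rev e)) := rfl

theorem mirrorNext_rev_next (e : Δ.E) : Δ.mirrorNext (Δ.rev (Δ.next e)) = Δ.rev e := by
  rw [mirrorNext_apply, Δ.rev_rev]
  exact congrArg Δ.rev (Δ.next.symm_apply_apply e)

theorem src_mirrorNext (e : Δ.E) : Δ.src (Δ.mirrorNext e) = Δ.src (Δ.rev e) := by
  rw [mirrorNext_apply, ← Δ.src_next]
  exact congrArg Δ.src (Δ.next.apply_symm_apply _)

theorem rotation_mirror (e e' : Δ.E) (h : Δ.src e = Δ.src e') :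
    ∃ n : ℕ, (fun d => Δ.mirrorNext (Δ.rev d))^[n] e = e' := by
  have h0 : (fun d => Δ.mirrorNext (Δ.rev d)) = ⇑(Δ.turn⁻¹) := by
    funext d
    rw [Equiv.Perm.eq_inv_iff_eq, turn_apply, mirrorNext_apply, Δ.rev_rev, Δ.rev_rev]
    exact Δ.next.apply_symm_apply d
  obtain ⟨n, hn⟩ := exists_turn_iterate h
  have h1 : Δ.turn⁻¹.SameCycle e e' :=
    Equiv.Perm.sameCycle_inv.2 ⟨n, by rw [zpow_natCast, ← Equiv.Perm.iterate_eq_pow, hn]⟩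
  obtain ⟨m, hm⟩ := h1.exists_nat_pow_eq
  rw [h0]
  exact ⟨m, by rwa [Equiv.Perm.iterate_eq_pow]⟩

/-- The boundary circuit of the mirror image. -/
def mirrorBdry : List Δ.E := Δ.toDGraph.walkRev Δ.bdry

theorem mem_mirrorBdry {e : Δ.E} : e ∈ Δ.mirrorBdry ↔ Δ.rev e ∈ Δ.bdry := by
  simp only [mirrorBdry, DGraph.walkRev, List.mem_reverse, List.mem_map]
  constructor
  · rintro ⟨d, hd, rfl⟩
    rwa [Δ.rev_rev]
  · exact fun h => ⟨_, h, Δ.rev_rev e⟩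

theorem mirrorBdry_nodup : Δ.mirrorBdry.Nodup :=
  List.nodup_reverse.2 (Δ.bdry_nodup.map Δ.revPerm.injective)

theorem mirrorBdry_next (i : ℕ) (h : i < Δ.mirrorBdry.length) : Δ.mirrorNext Δ.mirrorBdry[i] =
    Δ.mirrorBdry[(i + 1) % Δ.mirrorBdry.length]'(Nat.mod_lt _ (by omega)) := by
  have hl : Δ.mirrorBdry.length = Δ.bdry.length := by simp [mirrorBdry, DGraph.walkRev]
  have hg : ∀ j (hj : j < Δ.mirrorBdry.length),
      Δ.mirrorBdry[j] = Δ.rev (Δ.bdry[Δ.bdry.length - 1 - j]'(by omega)) := fun j hj => by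
    simp [mirrorBdry, DGraph.walkRev]
  have key : ∀ a b (ha : a < Δ.bdry.length) (hb : b < Δ.bdry.length), (b + 1) % Δ.bdry.length = a →
      Δ.mirrorNext (Δ.rev Δ.bdry[a]) = Δ.rev Δ.bdry[b] := by
    rintro a b ha hb rfl
    rw [← Δ.bdry_next b hb, mirrorNext_rev_next]
  rw [hg, hg]
  refine key _ _ _ _ ?_
  rcases Nat.lt_or_ge (i + 1) Δ.mirrorBdry.length with h1 | h1
  · rw [Nat.mod_eq_of_lt h1, Nat.mod_eq_of_lt (by omega)]
    omega
  · rw [show i + 1 = Δ.mirrorBdry.length by omega, Nat.mod_self,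
      show Δ.bdry.length - 1 - 0 + 1 = Δ.bdry.length by omega, Nat.mod_self]
    omega

theorem mirrorBdry_base (e : Δ.E) (he : e ∈ Δ.mirrorBdry.head?) : Δ.src e = Δ.base := by
  have h := Δ.isWalk_walkRev_bdry
  change Δ.toDGraph.IsWalk Δ.base Δ.mirrorBdry at h
  generalize Δ.mirrorBdry = l at h he
  cases l with
  | nil => simp at he
  | cons d l =>
    obtain rfl : d = e := by simpa using he
    exact h.1

/-- The mirror image. -/
def mirror : LabelledMap.{v} A inv where
  toDGraph := Δ.toDGraph
  finV := Δ.finV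
  finE := Δ.finE
  rev_ne := Δ.rev_ne
  label := Δ.label
  label_rev := Δ.label_rev
  connected := Δ.connected
  next := Δ.mirrorNext
  src_next := Δ.src_mirrorNext
  rotation := Δ.rotation_mirror
  base := Δ.base
  bdry := Δ.mirrorBdry
  bdry_nodup := Δ.mirrorBdry_nodup
  bdry_next := Δ.mirrorBdry_next
  bdry_base := Δ.mirrorBdry_base
  bdry_nil h := Δ.bdry_nil (by simpa [mirrorBdry, DGraph.walkRev] using h)

theorem sameCycle_mirrorNext {e e' : Δ.E} :
    Δ.mirrorNext.SameCycle (Δ.rev e) (Δ.rev e') ↔ Δ.next.SameCycle e e' := by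
  rw [mirrorNext, Equiv.Perm.sameCycle_conj, Equiv.Perm.sameCycle_inv]
  simp only [Equiv.Perm.inv_def, ← revPerm_apply, Equiv.symm_apply_apply]

/-- The mirror image of a corner. -/
def mirrorCorner (c : Δ.Corner) : Δ.mirror.Corner :=
  ⟨Δ.rev c.1, fun h => c.2 (by have := Δ.mem_mirrorBdry.1 h; rwa [Δ.rev_rev] at this)⟩

theorem card_face_mirror : Nat.card Δ.mirror.Face = Nat.card Δ.Face := by
  refine (Nat.card_eq_of_bijective (Quotient.map Δ.mirrorCorner
    fun c c' h => Δ.sameCycle_mirrorNext.2 h) ⟨?_, ?_⟩).symm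
  · intro F F'
    induction F, F' using Quotient.inductionOn₂ with
    | h c c' => exact fun h => Quotient.sound (Δ.sameCycle_mirrorNext.1 (Quotient.exact h))
  · intro F
    induction F using Quotient.ind with
    | _ c =>
      refine ⟨Quotient.mk _ ⟨Δ.rev c.1, fun h => c.2 (Δ.mem_mirrorBdry.2 h)⟩, ?_⟩
      exact congrArg (Quotient.mk _) (Subtype.ext (Δ.rev_rev c.1))

/-- The canonical map to the mirror image. -/
def toMirror : Δ.Space → Δ.mirror.Space :=
  Quot.lift (Sum.elim (fun p => Δ.mirror.incl p)
    fun z => Δ.mirror.conePt (Δ.mirrorCorner z.1) (σ z.2.1) z.2.2) (by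
    rintro _ _ (⟨c, s⟩ | ⟨c, c', h, r⟩ | ⟨c, s, s'⟩)
    · change Δ.mirror.conePt _ _ _ = Δ.mirror.edgePt c.1 s
      rw [conePt_zero]
      refine (Δ.mirror.edgePt_rev _ _).trans ?_
      rw [unitInterval.symm_symm]
    · change Δ.mirror.conePt _ (σ 1) r = Δ.mirror.conePt _ (σ 0) r
      rw [unitInterval.symm_one, unitInterval.symm_zero]
      refine (Quot.sound (Glue.seam (Δ := Δ.mirror) (Δ.mirrorCorner c') (Δ.mirrorCorner c)
        ?_ r)).symm
      change Δ.rev c.1 = Δ.mirrorNext (Δ.rev c'.1)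
      rw [h, mirrorNext_rev_next]
    · exact Quot.sound (Glue.apex _ _ _))

theorem toMirror_conePt (c : Δ.Corner) (s r : I) :
    Δ.toMirror (Δ.conePt c s r) = Δ.mirror.conePt (Δ.mirrorCorner c) (σ s) r := rfl

theorem continuous_toMirror : Continuous Δ.toMirror :=
  continuous_of_cells (fun e => Δ.mirror.continuous_edgePt e) fun c => by
    simp only [toMirror_conePt]
    exact (continuous_conePt (Δ := Δ.mirror) (Δ.mirrorCorner c)).comp
      (by fun_prop : Continuous fun z : I × I => (σ z.1, z.2))

theorem le_faceLow {e d : Δ.E} (h : Δ.next.SameCycle e d) : Δ.edgeLow d ≤ Δ.faceLow e := by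
  classical
  exact Finset.le_sup (f := Δ.edgeLow) (Finset.mem_filter.2 ⟨Finset.mem_univ _, h⟩)

theorem faceLow_le {e : Δ.E} {n : ℕ} (h : ∀ d, Δ.next.SameCycle e d → Δ.edgeLow d ≤ n) :
    Δ.faceLow e ≤ n := by
  classical
  exact Finset.sup_le fun d hd => h d (Finset.mem_filter.1 hd).2

theorem faceLow_mirror (e : Δ.E) : Δ.mirror.faceLow (Δ.rev e) = Δ.faceLow e := by
  refine le_antisymm (Δ.mirror.faceLow_le fun (d : Δ.E) hd => ?_) (Δ.faceLow_le fun d hd => ?_)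
  · change Δ.edgeLow d ≤ _
    rw [← Δ.edgeLow_rev]
    refine Δ.le_faceLow (Δ.sameCycle_mirrorNext.1 ?_)
    rw [Δ.rev_rev]
    exact hd
  · rw [← Δ.edgeLow_rev]
    exact Δ.mirror.le_faceLow (Δ.sameCycle_mirrorNext.2 hd)

theorem coarseDist_toMirror (p : Δ.Space) : Δ.mirror.coarseDist (Δ.toMirror p) = Δ.coarseDist p := by
  refine Subtype.ext ?_
  change Δ.mirror.coarseRat _ = Δ.coarseRat _
  induction p using space_ind with
  | hv a => rfl
  | he e s => rfl
  | hc c s r =>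
    by_cases hr : r = 0
    · subst hr
      rw [conePt_zero]
      rfl
    · rw [coarseRat_conePt _ _ hr, ← Δ.faceLow_mirror]
      exact coarseRat_conePt _ _ hr

end LabelledMap

namespace VanKampenDiagram
variable {G : Type u} [Group G] {A : Type v} {P : SymmetrizedPresentation G A}
  (Δ : VanKampenDiagram P)

theorem mirrorNext_pow (n : ℕ) (e : Δ.E) :
    (Δ.mirrorNext ^ n) e = Δ.rev ((Δ.next⁻¹ ^ n) (Δ.rev e)) := by
  rw [LabelledMap.mirrorNext, conj_pow]
  rfl

/-- A face of the mirror image is an original face read backwards. Starting the original at the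
successor of `rev e` puts `rev e` last, so that the inverse word starts with the label of e. Closure
of the relators under inversion then applies. -/
theorem faceWord_mirror (e : Δ.E) :
    Δ.toLabelledMap.mirror.faceWord e = P.wordInv (Δ.faceWord (Δ.next (Δ.rev e))) := by
  have h1 : Function.minimalPeriod Δ.mirrorNext e =
      Function.minimalPeriod Δ.next (Δ.next (Δ.rev e)) := by
    refine Function.minimalPeriod_eq_minimalPeriod_iff.2 fun n => ?_
    unfold Function.IsPeriodicPt Function.IsFixedPt
    rw [Equiv.Perm.iterate_eq_pow, Equiv.Perm.iterate_eq_pow, mirrorNext_pow,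
      ← Equiv.Perm.mul_apply, ((Commute.refl Δ.next).pow_left n).eq, Equiv.Perm.mul_apply,
      Δ.next.injective.eq_iff, inv_pow, ← Δ.revPerm_apply, ← Δ.revPerm_apply, ← Equiv.eq_symm_apply]
    rw [Equiv.Perm.inv_eq_iff_eq, eq_comm]
    rfl
  unfold LabelledMap.faceWord SymmetrizedPresentation.wordInv
  change (List.iterate Δ.mirrorNext e (Function.minimalPeriod Δ.mirrorNext e)).map Δ.label = _
  rw [h1]
  have hp : (Δ.next ^ Function.minimalPeriod Δ.next (Δ.next (Δ.rev e))) (Δ.next (Δ.rev e)) = 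
      Δ.next (Δ.rev e) := by
    rw [← Equiv.Perm.iterate_eq_pow]
    exact Function.iterate_minimalPeriod
  generalize Function.minimalPeriod Δ.next (Δ.next (Δ.rev e)) = p at hp
  refine List.ext_getElem (by simp) fun i h2 h3 => ?_
  have hi : i < p := by simpa using h2
  simp only [List.getElem_map, List.getElem_iterate, List.getElem_reverse, List.length_map,
    List.length_iterate, Equiv.Perm.iterate_eq_pow, ← Δ.label_rev, mirrorNext_pow]
  congr 2
  have h4 : (Δ.next ^ i) ((Δ.next ^ (p - 1 - i)) (Δ.next (Δ.rev e))) = Δ.rev e := by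
    rw [← Equiv.Perm.mul_apply, ← pow_add, ← Δ.next.injective.eq_iff, ← Equiv.Perm.mul_apply,
      ← pow_succ', show i + (p - 1 - i) + 1 = p by omega, hp]
  rw [inv_pow, Equiv.Perm.inv_eq_iff_eq, h4]

/-- The mirror image of a van Kampen diagram. -/
def mirror : VanKampenDiagram P where
  toLabelledMap := Δ.toLabelledMap.mirror
  euler := by
    rw [LabelledMap.card_face_mirror]
    exact Δ.euler
  relator := fun (e : Δ.E) he => by
    rw [faceWord_mirror]
    refine P.rels_inverse _ (Δ.relator _ fun h => he ?_)
    exact Δ.mem_mirrorBdry.2 (LabelledMap.next_mem_bdry.1 h)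
  pos := Δ.pos
  pos_base := Δ.pos_base
  pos_tgt := Δ.pos_tgt

end VanKampenDiagram

/-! ### Gluing diagrams along a common geodesic -/

namespace VanKampenDiagram
variable {G : Type u} [Group G] {A : Type v} {P : SymmetrizedPresentation G A}

/-- Gluing of two diagrams along a geodesic from the base vertex, which ends the boundary path of
the first diagram and starts the one of the second diagram. -/
theorem exists_glue {Δ₁ Δ₂ : VanKampenDiagram P} {p q : List Δ₁.E} {z r : List Δ₂.E}
    (h₁ : Δ₁.bdry = p ++ q) (hp : p ≠ []) (h₂ : Δ₂.bdry = z ++ r) (hr : r ≠ [])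
    (hqz : (Δ₁.toDGraph.walkRev q).map Δ₁.label = z.map Δ₂.label)
    (hz : P.IsGeodesicWord (z.map Δ₂.label)) :
    ∃ (Δ : VanKampenDiagram P) (φ₁ : LabelledMap.CellMap Δ₁.toLabelledMap Δ.toLabelledMap)
      (φ₂ : LabelledMap.CellMap Δ₂.toLabelledMap Δ.toLabelledMap),
      φ₁.IsRadial ∧ φ₂.IsRadial ∧ Δ.bdry = p.map φ₁.onE ++ r.map φ₂.onE ∧
      (Δ₁.toDGraph.walkRev q).map φ₁.onE = z.map φ₂.onE := by
  obtain ⟨x₁, m₁, e₁⟩ := List.exists_cons_of_ne_nil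
    (show Δ₁.bdry ≠ [] by simp [h₁, hp])
  obtain ⟨x₂, m₂, e₂⟩ := List.exists_cons_of_ne_nil
    (show Δ₂.bdry ≠ [] by simp [h₂, hr])
  let W : WedgeData P := ⟨Δ₁, Δ₂, x₁, m₁, e₁, x₂, m₂, e₂⟩
  let iE : Δ₁.E → W.diagram.E := W.cellLeft.onE
  let jE : Δ₂.E → W.diagram.E := W.cellRight.onE
  have hlen : q.length = z.length := by
    simpa [DGraph.walkRev] using congrArg List.length hqz
  have wq : Δ₁.toDGraph.IsWalk Δ₁.base (Δ₁.toDGraph.walkRev q) := by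
    have := isWalk_walkRev_drop_bdry (Δ := Δ₁) p.length
    rwa [h₁, List.drop_left] at this
  have wz : Δ₂.toDGraph.IsWalk Δ₂.base z := by
    have := Δ₂.isWalk_bdry
    rw [h₂, DGraph.isWalk_append] at this
    exact this.1
  have hq' : (Δ₁.toDGraph.walkRev q).length = q.length := by simp [DGraph.walkRev]
  -- The boundary circuit of the wedge is p q z r. The pairs to be folded are listed from the
  -- meeting point of q and z, the base vertex, outwards.
  let L : List (W.diagram.E × W.diagram.E) :=
    (q.reverse.map iE).zip (z.map jE)
  have hL : L.length = z.length := by simp [L, hlen]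
  have hL1 : L.map Prod.fst = q.reverse.map iE :=
    List.map_fst_zip (by simp [hlen])
  have hL2 : L.map Prod.snd = z.map jE :=
    List.map_snd_zip (by simp [hlen])
  have hsrc : ∀ j (hj : j < q.length), Δ₁.src (q.reverse[j]'(by simpa using hj)) =
      Δ₁.toDGraph.walkEnd Δ₁.base ((Δ₁.toDGraph.walkRev q).take (j + 1)) := fun j hj => by
    rw [← wq.tgt_getElem (by omega)]
    simp [DGraph.walkRev, DGraph.tgt_rev]
  have htgt : ∀ j (hj : j < z.length), Δ₂.toDGraph.tgt z[j] =
      Δ₂.toDGraph.walkEnd Δ₂.base (z.take (j + 1)) := fun j hj => wz.tgt_getElem hj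
  have hpos1 : ∀ j (hj : j < q.length), Δ₁.pos (Δ₁.src (q.reverse[j]'(by simpa using hj))) =
      P.wordVal ((z.map Δ₂.label).take (j + 1)) := fun j hj => by
    rw [hsrc j hj, pos_walkEnd (wq.take _), Δ₁.pos_base, one_mul, List.map_take, hqz]
  have hpos2 : ∀ j (hj : j < z.length), Δ₂.pos (Δ₂.toDGraph.tgt z[j]) =
      P.wordVal ((z.map Δ₂.label).take (j + 1)) := fun j hj => by
    rw [htgt j hj, pos_walkEnd (wz.take _), Δ₂.pos_base, one_mul, List.map_take]
  have hgetL : ∀ j (hj : j < L.length), L[j] = (iE (q.reverse[j]'(by simp; omega)),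
      jE (z[j]'(by omega))) := fun j hj => by simp [L]
  -- A nonempty prefix of a geodesic word is nontrivial, so the outer ends of a pair differ from the
  -- base vertex and are distinct vertices of the wedge.
  have hone : ∀ j < z.length, P.wordVal ((z.map Δ₂.label).take (j + 1)) ≠ 1 := fun j hj h => by
    have := hz.take_injOn (i := j + 1) (j := 0) (by simp; omega) (by simp) (h.trans (by rfl))
    omega
  obtain ⟨Δ, φ, k1, k2, k3, k4⟩ := exists_zip L.length W.diagram L (p.map iE)
    (r.map jE) rfl (by
      rw [hL1, hL2]
      change Δ₁.bdry.map iE ++ Δ₂.bdry.map jE = _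
      rw [h₁, h₂]
      simp) (by simpa using hp) (by
      intro pr hpr
      obtain ⟨j, hj, rfl⟩ := List.getElem_of_mem hpr
      rw [hgetL]
      have hjz : j < z.length := by omega
      have hjq : j < q.length := by omega
      refine ⟨?_, ?_, ?_, ?_⟩
      · change Δ₂.label z[j] = P.inv (Δ₁.label (q.reverse[j]'(by simp; omega)))
        have := congrArg (fun l => l[j]?) hqz
        simp only [List.getElem?_map] at this
        rw [List.getElem?_eq_getElem hjz, List.getElem?_eq_getElem (by omega)] at this
        have h3 := Option.some.inj this
        rw [← h3, ← Δ₁.label_rev]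
        simp [DGraph.walkRev]
      · change (Sum.inl (Δ₁.src (q.reverse[j]'(by simp; omega))) : W.V') ≠
          W.inrV (Δ₂.toDGraph.tgt z[j])
        intro h
        have h4 := (W.inrV_eq_inl h.symm).1
        refine hone j hjz ?_
        rw [← hpos2 j hjz, h4]
        exact Δ₂.pos_base
      · change W.graph.simple.dist _ (Sum.inl (Δ₁.src (q.reverse[j]'(by simp; omega))) : W.V') =
          W.graph.simple.dist _ (W.inrV (Δ₂.toDGraph.tgt z[j]))
        refine (W.isRadial_left _).trans (Eq.trans ?_ (W.isRadial_right _).symm)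
        change Δ₁.toDGraph.simple.dist Δ₁.base _ = Δ₂.toDGraph.simple.dist Δ₂.base _
        rw [hsrc j hjq, htgt j hjz, dist_of_isGeodesicWord wq (by rwa [hqz]) (by omega),
          dist_of_isGeodesicWord wz hz (by omega)]
      · change Δ₁.pos (Δ₁.src (q.reverse[j]'(by simp; omega))) =
          W.pos' (W.inrV (Δ₂.toDGraph.tgt z[j]))
        rw [W.pos'_inrV, hpos1 j hjq]
        exact (hpos2 j hjz).symm) (by
      rw [List.nodup_iff_injective_getElem]
      rintro ⟨i, hi⟩ ⟨j, hj⟩ h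
      simp only [List.length_map] at hi hj
      have h0 : ∀ i (hi : i < L.length), W.diagram.pos (W.diagram.src L[i].1) =
          P.wordVal ((z.map Δ₂.label).take (i + 1)) := fun i hi => by
        rw [hgetL]
        exact hpos1 i (by omega)
      simp only [List.getElem_map, h0] at h
      have := hz.take_injOn (by simp; omega) (by simp; omega) h
      simp only [Fin.mk.injEq]
      omega)
  refine ⟨Δ, φ.comp W.cellLeft, φ.comp W.cellRight, k3.comp W.isRadial_left,
    k3.comp W.isRadial_right, ?_, ?_⟩
  · rw [k1]
    simp only [List.map_append, List.map_map]
    rfl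
  · refine List.ext_getElem (by simp [hq', hlen]) fun j hj hj' => ?_
    have hjz : j < z.length := by simpa using hj'
    have h5 := k2 L[j] (List.getElem_mem (by omega))
    rw [hgetL j (by omega)] at h5
    have h6 : Δ.rev (φ.onE (iE (q.reverse[j]'(by simp; omega)))) =
        φ.onE (jE z[j]) := by
      rw [h5, Δ.rev_rev]
    rw [φ.rev_onE] at h6
    rw [List.getElem_map, List.getElem_map]
    refine Eq.trans ?_ h6
    simp only [DGraph.walkRev, List.getElem_reverse, List.getElem_map, List.length_map]
    rfl

end VanKampenDiagram

/-! ### Uniqueness of the parametrizations in a combed normal filling -/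

namespace VanKampenDiagram
variable {G : Type u} [Group G] {A : Type v} {P : SymmetrizedPresentation G A}
  {Δ Δ' : VanKampenDiagram P}

/-- Two lifts of the same path along a simple word have the same parametrization. -/
theorem eq_of_proj_map_eq {l : List Δ.E} {l' : List Δ'.E} (h : Δ.toDGraph.IsWalk Δ.base l)
    (h' : Δ'.toDGraph.IsWalk Δ'.base l') (hl : l.map Δ.label = l'.map Δ'.label)
    (hs : P.IsSimpleWord (l.map Δ.label)) {t t' : ℝ} (ht : t ∈ Set.Icc (0 : ℝ) l.length)
    (ht' : t' ∈ Set.Icc (0 : ℝ) l'.length)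
    (heq : Δ.proj.map (Δ.toDGraph.walkPoint Δ.base l t) =
      Δ'.proj.map (Δ'.toDGraph.walkPoint Δ'.base l' t')) : t = t' := by
  have hlen : l'.length = l.length := by simpa using (congrArg List.length hl).symm
  rw [proj_map_walkPoint h, proj_map_walkPoint h', ← hl] at heq
  have hw := Δ.proj.isWalk h
  rw [map_proj_onE h, Δ.pos_base] at hw
  change P.cayleyGraph.IsWalk (Δ.pos Δ.base) _ at hw
  rw [Δ.pos_base] at hw
  have hlen' : (P.cayleyPath 1 (l.map Δ.label)).length = l.length := by
    rw [← Δ.pos_base, ← map_proj_onE h, List.length_map]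
  have hend : ∀ i, P.cayleyGraph.walkEnd (1 : G) ((P.cayleyPath 1 (l.map Δ.label)).take i) =
      P.wordVal ((l.map Δ.label).take i) := fun i => by
    have h1 := Δ.proj.walkEnd Δ.base (l.take i)
    rw [List.map_take, map_proj_onE h, Δ.pos_base] at h1
    change P.cayleyGraph.walkEnd (Δ.pos Δ.base) _ = Δ.pos _ at h1
    rw [Δ.pos_base, pos_walkEnd (h.take i), Δ.pos_base, one_mul, List.map_take] at h1
    exact h1
  refine DGraph.walkPoint_injOn hw ?_ (by rwa [hlen']) (by rwa [hlen', ← hlen]) heq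
  intro i hi j hj hij
  rw [hend, hend] at hij
  rw [hlen'] at hi hj
  exact SymmetrizedPresentation.isSimpleWord_iff.1 hs i (by simpa) j (by simpa) hij

end VanKampenDiagram

namespace CombedNormalFilling
variable {G : Type u} [Group G] {A : Type v} {P : SymmetrizedPresentation G A}
  (F : CombedNormalFilling P)

/-- The two ends of the chosen direction of an edge. -/
def endpoint (e : CayleyEdge P) : Bool → G
  | true => P.cayleyGraph.src (F.dir e)
  | false => P.cayleyGraph.tgt (F.dir e)

/-- The two ends of the distinguished edge of the diagram of an edge. -/
def endPt (e : CayleyEdge P) :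
    Bool → (F.diagram e).closedEdge (F.diagram e).bdry[F.index e]
  | true => ⟨_, (F.diagram e).src_mem_closedEdge _⟩
  | false => ⟨_, (F.diagram e).tgt_mem_closedEdge _⟩

/-- The two parts of the boundary path of the diagram of an edge. -/
def side (e : CayleyEdge P) : Bool → List (F.diagram e).E
  | true => (F.diagram e).bdry.take (F.index e)
  | false => (F.diagram e).toDGraph.walkRev ((F.diagram e).bdry.drop (F.index e + 1))

theorem follows_side (e : CayleyEdge P) (b : Bool) :
    (F.diagram e).Follows (fun t => F.homotopy e (F.endPt e b, t)) (F.side e b) := by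
  cases b
  · exact (F.isEdgeHomotopy e).follows_tgt
  · exact (F.isEdgeHomotopy e).follows_src

theorem isWalk_side (e : CayleyEdge P) (b : Bool) :
    (F.diagram e).toDGraph.IsWalk (F.diagram e).base (F.side e b) := by
  cases b
  · exact VanKampenDiagram.isWalk_walkRev_drop_bdry _
  · exact (F.diagram e).isWalk_bdry.take _

theorem label_side (e : CayleyEdge P) (b : Bool) :
    (F.side e b).map (F.diagram e).label = F.y (F.endpoint e b) := by
  cases b
  · have := VanKampenDiagram.label_walkRev_drop_bdry (F.bdryWord_eq e)
    rwa [← F.index_eq e] at this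
  · have := VanKampenDiagram.label_take_bdry (F.bdryWord_eq e)
    rwa [← F.index_eq e] at this

/-- The parametrizations of the homotopy paths to the endpoints of edges depend only on these
endpoints. -/
theorem exists_param : ∃ ρ : G → I → ℝ, ∀ e b t,
    F.homotopy e (F.endPt e b, t) = (F.diagram e).walkPt (F.side e b) (ρ (F.endpoint e b) t) := by
  choose ρ _ hmono h0 h1 hρ using F.follows_side
  have hmem : ∀ e b t, ρ e b t ∈ Set.Icc (0 : ℝ) (F.side e b).length := fun e b t =>
    ⟨h0 e b ▸ hmono e b t.2.1, h1 e b ▸ hmono e b t.2.2⟩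
  -- By consistency the two paths have the same projection to the Cayley graph, and the path
  -- labelled by a simple word is injective, so the parameters agree.
  have key : ∀ e b e' b', F.endpoint e b = F.endpoint e' b' → ∀ t, ρ e b t = ρ e' b' t := by
    intro e b e' b' h t
    obtain ⟨q, q', hq, hq', hqq⟩ := F.consistent e e' (F.endpoint e b) (F.endPt e b)
      (F.endPt e' b') (by cases b <;> [exact Or.inr ⟨rfl, rfl⟩; exact Or.inl ⟨rfl, rfl⟩])
      (by rw [h]; cases b' <;> [exact Or.inr ⟨rfl, rfl⟩; exact Or.inl ⟨rfl, rfl⟩]) t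
    rw [LabelledMap.incl_injective (hq.trans (hρ e b t)),
      LabelledMap.incl_injective (hq'.trans (hρ e' b' t))] at hqq
    refine VanKampenDiagram.eq_of_proj_map_eq (F.isWalk_side e b) (F.isWalk_side e' b') ?_ ?_
      (hmem e b t) (hmem e' b' t) hqq
    · rw [F.label_side, F.label_side, h]
    · rw [F.label_side]
      exact F.y_simple _
  classical
  -- The value 0 at elements that are not the end of any edge is never used.
  refine ⟨fun g t => if h : ∃ z : CayleyEdge P × Bool, F.endpoint z.1 z.2 = g then
    ρ h.choose.1 h.choose.2 t else 0, fun e b t => ?_⟩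
  have h : ∃ z : CayleyEdge P × Bool, F.endpoint z.1 z.2 = F.endpoint e b := ⟨(e, b), rfl⟩
  simp only [dif_pos h]
  exact (hρ e b t).trans (by rw [key e b _ _ h.choose_spec.symm t])

end CombedNormalFilling

/-! ### The seashell construction -/

section Fan
variable {G : Type u} [Group G] {A : Type v}

/-- A diagram with boundary word `y_g a y_{ga}⁻¹` and a tame homotopy to the edge labelled `a`,
whose two sides are the sides of the diagram, parametrized by `ρ`. -/
def HasEdgeFan (P : SymmetrizedPresentation G A) (f : QuarterNat → QuarterNat) (y : G → List A)
    (ρ : G → I → ℝ) (g : G) (a : A) : Prop :=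
  ∃ (Δ : VanKampenDiagram P) (z : List Δ.E) (d : Δ.E) (q : List Δ.E) (Φ : C(I × I, Δ.Space)),
    Δ.bdry = z ++ d :: q ∧ z.map Δ.label = y g ∧ Δ.label d = a ∧
    (Δ.toDGraph.walkRev q).map Δ.label = y (g * P.val a) ∧ Δ.IsTame f Φ ∧
    (∀ s, Φ (s, 0) = Δ.basePt) ∧ (∀ s, Φ (s, 1) = Δ.edgePt d s) ∧
    (∀ t, Φ (0, t) = Δ.walkPt z (ρ g t)) ∧
    ∀ t, Φ (1, t) = Δ.walkPt (Δ.toDGraph.walkRev q) (ρ (g * P.val a) t)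

variable {P : SymmetrizedPresentation G A} {f : QuarterNat → QuarterNat} {y : G → List A}
  {ρ : G → I → ℝ}

theorem DGraph.walkRev_walkRev {Γ : DGraph.{u, v}} (l : List Γ.E) :
    Γ.walkRev (Γ.walkRev l) = l := by
  simp [DGraph.walkRev, Function.comp_def, Γ.rev_rev]

/-- A filling provides a diagram for one direction of each edge only. The other direction is served
by the mirror image, with the position on the edge reversed and the two sides exchanged. -/
theorem HasEdgeFan.symm {g : G} {a : A} (h : HasEdgeFan P f y ρ g a) :
    HasEdgeFan P f y ρ (g * P.val a) (P.inv a) := by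
  obtain ⟨Δ, z, d, q, Φ, hb, hz, hd, hq, ht, h0, h1, hl, hr⟩ := h
  have hg : g * P.val a * P.val (P.inv a) = g := by rw [P.val_inv, mul_inv_cancel_right]
  refine ⟨Δ.mirror, Δ.toDGraph.walkRev q, Δ.rev d, Δ.toDGraph.walkRev z,
    ⟨fun x => Δ.toMirror (Φ (σ x.1, x.2)), Δ.continuous_toMirror.comp (by fun_prop)⟩,
    ?_, hq, ?_, ?_, ?_, ?_, ?_, ?_, ?_⟩
  · change Δ.toDGraph.walkRev Δ.bdry = _
    rw [hb]
    simp [DGraph.walkRev]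
    rfl
  · change Δ.label (Δ.rev d) = _
    rw [Δ.label_rev, hd]
  · rw [hg, ← hz]
    exact congrArg (List.map Δ.label) (DGraph.walkRev_walkRev z)
  · intro s t t' htt'
    refine (Δ.coarseDist_toMirror _).le.trans ((ht (σ s) t t' htt').trans ?_)
    rw [← Δ.coarseDist_toMirror]
    exact le_refl _
  · intro s
    exact congrArg Δ.toMirror (h0 _)
  · intro s
    refine (congrArg Δ.toMirror (h1 _)).trans ?_
    exact (Δ.mirror.edgePt_rev d s).symm
  · intro t
    change Δ.toMirror (Φ (σ 0, t)) = _
    rw [unitInterval.symm_zero, hr]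
    rfl
  · intro t
    change Δ.toMirror (Φ (σ 1, t)) = _
    rw [unitInterval.symm_one, hl, hg]
    exact congrArg (fun l => Δ.mirror.walkPt l (ρ g t)) (DGraph.walkRev_walkRev z).symm

/-- The set consisting of an edge and its reversal is an invariant of the class. -/
theorem CayleyEdge.eq_or_eq_rev {e e' : P.cayleyGraph.E}
    (h : (Quot.mk _ e : CayleyEdge P) = Quot.mk _ e') : e = e' ∨ e = P.cayleyGraph.rev e' := by
  let F : CayleyEdge P → Set P.cayleyGraph.E :=
    Quot.lift (fun e => {e, P.cayleyGraph.rev e}) (by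
      rintro a b rfl
      rw [P.cayleyGraph.rev_rev, Set.pair_comm])
  have h1 : e ∈ F (Quot.mk _ e') := by
    rw [← h]
    exact Or.inl rfl
  exact h1

theorem CombedNormalFilling.exists_hasEdgeFan (F : CombedNormalFilling P)
    (hF : ∀ e, (F.diagram e).IsTame f (F.homotopy e)) :
    ∃ ρ : G → I → ℝ, ∀ g a, HasEdgeFan P f F.y ρ g a := by
  obtain ⟨ρ, hρ⟩ := F.exists_param
  have key : ∀ e, HasEdgeFan P f F.y ρ (F.dir e).1 (F.dir e).2 := by
    intro e
    have hE := F.isEdgeHomotopy e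
    refine ⟨F.diagram e, F.side e true, (F.diagram e).bdry[F.index e],
      (F.diagram e).bdry.drop (F.index e + 1),
      ⟨fun x => F.homotopy e (⟨(F.diagram e).edgePt _ x.1, x.1, rfl⟩, x.2),
        (F.homotopy e).continuous.comp (((LabelledMap.continuous_edgePt _).comp
          continuous_fst).subtype_mk _ |>.prodMk continuous_snd)⟩, ?_, ?_, ?_, ?_, ?_, ?_, ?_, ?_, ?_⟩
    · simp [CombedNormalFilling.side]
    · exact F.label_side e true
    · have h := F.bdryWord_eq e
      have h2 : (F.diagram e).bdryWord[(F.index e : ℕ)]? = some (F.dir e).2 := by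
        rw [h, F.index_eq]
        exact (List.getElem?_append_right le_rfl).trans (by simp)
      simpa [VanKampenDiagram.bdryWord] using h2
    · exact F.label_side e false
    · intro s t t' h
      exact hF e _ t t' h
    · intro s
      exact hE.map_zero _
    · intro s
      exact hE.map_one _
    · intro t
      refine Eq.trans (congrArg (fun p => F.homotopy e (p, t)) (Subtype.ext ?_)) (hρ e true t)
      exact LabelledMap.edgePt_zero _
    · intro t
      refine Eq.trans (congrArg (fun p => F.homotopy e (p, t)) (Subtype.ext ?_)) (hρ e false t)
      exact LabelledMap.edgePt_one _
  refine ⟨ρ, fun g a => ?_⟩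
  rcases CayleyEdge.eq_or_eq_rev (F.dir_mk (Quot.mk _ (g, a))) with h | h
  · have := key (Quot.mk _ (g, a))
    rwa [h] at this
  · have := (key (Quot.mk _ (g, a))).symm
    rw [h] at this
    change HasEdgeFan P f F.y ρ (g * P.val a * P.val (P.inv a)) (P.inv (P.inv a)) at this
    rwa [P.inv_inv, P.val_inv, mul_inv_cancel_right] at this

/-- A diagram with boundary word `l y_g⁻¹`, where `l` represents `g`, and compatible tame homotopies
to the edges of the part of the boundary labelled `l`, which start and end with geodesics. -/
def HasFan (P : SymmetrizedPresentation G A) (f : QuarterNat → QuarterNat) (y : G → List A)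
    (ρ : G → I → ℝ) (l : List A) : Prop :=
  ∃ (Δ : VanKampenDiagram P) (es q : List Δ.E) (p : ℕ → List Δ.E) (Φ : ℕ → C(I × I, Δ.Space)),
    Δ.bdry = es ++ q ∧ es.map Δ.label = l ∧
    (∀ k ≤ es.length, Δ.toDGraph.IsWalk Δ.base (p k) ∧
      Δ.toDGraph.walkEnd Δ.base (p k) = Δ.toDGraph.walkEnd Δ.base (Δ.bdry.take k) ∧
      (p k).map Δ.label = y (P.wordVal (l.take k))) ∧
    p es.length = Δ.toDGraph.walkRev q ∧
    ∀ k (hk : k < es.length), Δ.IsTame f (Φ k) ∧ (∀ s, Φ k (s, 0) = Δ.basePt) ∧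
      (∀ s, Φ k (s, 1) = Δ.edgePt es[k] s) ∧
      (∀ t, Φ k (0, t) = Δ.walkPt (p k) (ρ (P.wordVal (l.take k)) t)) ∧
      ∀ t, Φ k (1, t) = Δ.walkPt (p (k + 1)) (ρ (P.wordVal (l.take (k + 1))) t)

/-- A fan for a one-letter word. -/
theorem HasEdgeFan.hasFan (hy : y 1 = []) {a : A} (h : HasEdgeFan P f y ρ 1 a) :
    HasFan P f y ρ [a] := by
  obtain ⟨Δ, z, d, q, Φ, hb, hz, hd, hq, ht, h0, h1, hl, hr⟩ := h
  obtain rfl : z = [] := by simpa [hy] using hz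
  have h1a : P.wordVal [a] = 1 * P.val a := by simp [SymmetrizedPresentation.wordVal]
  refine ⟨Δ, [d], q, fun k => if k = 0 then [] else Δ.toDGraph.walkRev q, fun _ => Φ, hb,
    by simp [hd], ?_, by simp, ?_⟩
  · intro k hk
    rcases Nat.eq_zero_or_pos k with rfl | hk0
    · exact ⟨trivial, rfl, hy.symm⟩
    · obtain rfl : k = 1 := le_antisymm hk hk0
      have hq' : Δ.bdry.drop 1 = q := by rw [hb]; rfl
      simp only [one_ne_zero, if_false]
      rw [← hq'] at hq ⊢
      refine ⟨VanKampenDiagram.isWalk_walkRev_drop_bdry _,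
        VanKampenDiagram.walkEnd_walkRev_drop_bdry _, hq.trans ?_⟩
      rw [List.take_of_length_le (by simp), h1a]
  · intro k hk
    obtain rfl : k = 0 := by simpa using hk
    refine ⟨ht, h0, h1, hl, fun t => ?_⟩
    rw [List.take_of_length_le (by simp), h1a]
    exact hr t

/-- The last side of the fan and the first side of the new diagram carry the same geodesic normal
form, so `exists_glue` applies. Both maps into the glued diagram are radial, hence f does not
change. Along the common side the old and the new homotopy agree, being parametrized by ρ at the
same group element. -/
theorem HasFan.append {l : List A} (hl : l ≠ []) {a : A} (hg : ∀ g, P.IsGeodesicWord (y g))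
    (h : HasFan P f y ρ l) (ha : HasEdgeFan P f y ρ (P.wordVal l) a) :
    HasFan P f y ρ (l ++ [a]) := by
  obtain ⟨Δ₁, es, q, p, Φ, hb, hes, hp, hpq, hΦ⟩ := h
  obtain ⟨Δ₂, z, d, q', Θ, hb', hz, hd, hq', ht, h0, h1, hl', hr⟩ := ha
  have hlen : es.length = l.length := by rw [← hes, List.length_map]
  have hqz : (Δ₁.toDGraph.walkRev q).map Δ₁.label = z.map Δ₂.label := by
    rw [← hpq, (hp _ le_rfl).2.2, hz, hlen, List.take_length]
  have hes0 : es ≠ [] := fun h => hl (by rw [← hes, h]; rfl)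
  obtain ⟨Δ, φ₁, φ₂, r₁, r₂, hbd, hqq⟩ := VanKampenDiagram.exists_glue hb hes0 hb' (by simp) hqz
    (hz ▸ hg _)
  have hval : P.wordVal (l ++ [a]) = P.wordVal l * P.val a := by
    simp [SymmetrizedPresentation.wordVal]
  have htake : ∀ k ≤ l.length, (l ++ [a]).take k = l.take k := fun k hk =>
    List.take_append_of_le_length hk
  have hlast : (l ++ [a]).take (l.length + 1) = l ++ [a] := List.take_of_length_le (by simp)
  have hbd' : Δ.bdry = (es.map φ₁.onE ++ [φ₂.onE d]) ++ q'.map φ₂.onE := by simp [hbd]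
  let p' : ℕ → List Δ.E := fun k => if k ≤ l.length then (p k).map φ₁.onE else
    Δ.toDGraph.walkRev (q'.map φ₂.onE)
  have hp1 : ∀ k ≤ l.length, p' k = (p k).map φ₁.onE := fun k hk => if_pos hk
  have hp2 : p' (l.length + 1) = Δ.toDGraph.walkRev (q'.map φ₂.onE) := if_neg (by omega)
  let Φ' : ℕ → C(I × I, Δ.Space) := fun k => if k < l.length then
    ⟨fun x => φ₁.map (Φ k x), φ₁.continuous_map.comp (Φ k).continuous⟩ else
    ⟨fun x => φ₂.map (Θ x), φ₂.continuous_map.comp Θ.continuous⟩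
  have hΦ1 : ∀ k < l.length, Φ' k = ⟨fun x => φ₁.map (Φ k x),
    φ₁.continuous_map.comp (Φ k).continuous⟩ := fun k hk => if_pos hk
  have hΦ2 : Φ' l.length = ⟨fun x => φ₂.map (Θ x), φ₂.continuous_map.comp Θ.continuous⟩ :=
    if_neg (by omega)
  have hlen' : (es.map φ₁.onE ++ [φ₂.onE d]).length = l.length + 1 := by simp [hlen]
  refine ⟨Δ, es.map φ₁.onE ++ [φ₂.onE d], q'.map φ₂.onE, p', Φ', hbd', ?_, ?_, ?_, ?_⟩
  · rw [List.map_append, φ₁.map_label, hes]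
    simp [φ₂.label_onE, hd]
  · intro k hk
    rw [hlen'] at hk
    rcases Nat.lt_or_ge l.length k with h2 | h2
    · obtain rfl : k = l.length + 1 := by omega
      have h3 : Δ.bdry.drop (l.length + 1) = q'.map φ₂.onE := by
        rw [hbd', ← hlen', List.drop_left]
      rw [hp2, hlast, ← h3]
      refine ⟨VanKampenDiagram.isWalk_walkRev_drop_bdry _,
        VanKampenDiagram.walkEnd_walkRev_drop_bdry _, ?_⟩
      rw [h3, ← φ₂.map_walkRev, φ₂.map_label, hq', hval]
    · obtain ⟨w1, w2, w3⟩ := hp k (by omega)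
      rw [hp1 k h2, htake k h2]
      refine ⟨φ₁.isWalk w1, ?_, by rw [φ₁.map_label, w3]⟩
      rw [← φ₁.onV_base, φ₁.toHom.walkEnd, w2, ← φ₁.toHom.walkEnd]
      congr 1
      rw [hb, hbd, List.take_append_of_le_length (by omega),
        List.take_append_of_le_length (by simp; omega), List.map_take]
  · rw [hlen', hp2]
  · intro k hk
    rw [hlen'] at hk
    rcases Nat.lt_or_ge k l.length with h2 | h2
    · obtain ⟨w1, w2, w3, w4, w5⟩ := hΦ k (by omega)
      rw [hΦ1 k h2, hp1 k h2.le, hp1 (k + 1) h2, htake k h2.le, htake (k + 1) h2]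
      refine ⟨fun s t t' htt' => ?_, fun s => ?_, fun s => ?_, fun t => ?_, fun t => ?_⟩
      · exact r₁.isTamePath (w1 s) t t' htt'
      · exact (congrArg φ₁.map (w2 s)).trans φ₁.map_basePt
      · refine (congrArg φ₁.map (w3 s)).trans ((φ₁.map_edgePt _ _).trans ?_)
        rw [List.getElem_append_left (by simp; omega), List.getElem_map]
      · exact (congrArg φ₁.map (w4 t)).trans (φ₁.map_walkPt _ _)
      · exact (congrArg φ₁.map (w5 t)).trans (φ₁.map_walkPt _ _)
    · obtain rfl : k = l.length := by omega
      rw [hΦ2, hp1 _ le_rfl, hp2, htake _ le_rfl, List.take_length, hlast, hval,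
        show p l.length = _ by rw [← hlen, hpq], hqq, ← φ₂.map_walkRev]
      refine ⟨fun s t t' htt' => ?_, fun s => ?_, fun s => ?_, fun t => ?_, fun t => ?_⟩
      · exact r₂.isTamePath (ht s) t t' htt'
      · exact (congrArg φ₂.map (h0 s)).trans φ₂.map_basePt
      · refine (congrArg φ₂.map (h1 s)).trans ((φ₂.map_edgePt _ _).trans ?_)
        simp [hlen]
      · exact (congrArg φ₂.map (hl' t)).trans (φ₂.map_walkPt _ _)
      · exact (congrArg φ₂.map (hr t)).trans (φ₂.map_walkPt _ _)

theorem exists_hasFan (hg : ∀ g, P.IsGeodesicWord (y g)) (hv : ∀ g, P.wordVal (y g) = g)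
    (h : ∀ g a, HasEdgeFan P f y ρ g a) (l : List A) (hl : l ≠ []) : HasFan P f y ρ l := by
  have hy : y 1 = [] := by
    have := hg 1 [] (by rw [hv]; rfl)
    exact List.length_eq_zero_iff.1 (Nat.le_zero.1 this)
  induction l using List.reverseRecOn with
  | nil => exact absurd rfl hl
  | append_singleton l a ih =>
    -- The induction has to start with one letter, since gluing needs nonempty remaining boundary
    -- paths.
    by_cases h0 : l = []
    · subst h0
      exact (h 1 a).hasFan hy
    · exact (ih h0).append h0 hg (h _ a)

end Fan

/-! ### Cohomology of a diagram modulo 2 -/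

namespace LabelledMap
variable {A : Type v} {inv : A → A} (Δ : LabelledMap.{v} A inv)

/-- A function on the vertices of a diagram that is constant along edges is constant. -/
theorem eq_of_forall_edge {α : Type*} {φ : Δ.V → α} (h : ∀ e, φ (Δ.toDGraph.tgt e) = φ (Δ.src e))
    (a b : Δ.V) : φ a = φ b := by
  obtain ⟨p⟩ := Δ.connected.preconnected a b
  induction p with
  | nil => rfl
  | cons hadj p ih =>
    obtain ⟨_, e, rfl, rfl⟩ := DGraph.simple_adj.1 hadj
    rw [← h, ih]

/-- A function on the directed edges that is invariant under reversal and under passage to the next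
edge of a face is constant. -/
theorem eq_of_forall_next {α : Type*} {x : Δ.E → α} (hrev : ∀ e, x (Δ.rev e) = x e)
    (hnext : ∀ e, x (Δ.next e) = x e) (d e : Δ.E) : x d = x e := by
  have hturn : ∀ d e, Δ.src d = Δ.src e → x d = x e := by
    intro d e h
    obtain ⟨n, rfl⟩ := exists_turn_iterate h
    clear h
    induction n with
    | zero => rfl
    | succ n ih =>
      rw [Function.iterate_succ_apply', turn_apply, hnext, hrev]
      exact ih
  classical
  let φ : Δ.V → Option α := fun a => if h : ∃ e, Δ.src e = a then some (x h.choose) else none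
  have hφ : ∀ e, φ (Δ.src e) = some (x e) := fun e => by
    have h : ∃ d, Δ.src d = Δ.src e := ⟨e, rfl⟩
    simp only [φ, dif_pos h]
    rw [hturn _ e h.choose_spec]
  have := Δ.eq_of_forall_edge (φ := φ) (fun e => by
    rw [← DGraph.src_rev, hφ, hφ, hrev]) (Δ.src d) (Δ.src e)
  rw [hφ, hφ] at this
  exact Option.some.inj this

section Cohomology
open Classical

noncomputable instance : Fintype Δ.Corner := inferInstanceAs (Fintype {e : Δ.E // e ∉ Δ.bdry})

noncomputable instance : Fintype Δ.Face := inferInstanceAs (Fintype (Quotient Δ.faceSetoid))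

/-- The passage to the next corner of a face. -/
def nextCorner : Equiv.Perm Δ.Corner := Δ.next.subtypePerm fun _ => next_mem_bdry.not

/-- The face of a corner. -/
def faceOf (c : Δ.Corner) : Δ.Face := Quotient.mk _ c

theorem faceOf_nextCorner (c : Δ.Corner) : Δ.faceOf (Δ.nextCorner c) = Δ.faceOf c :=
  Quotient.sound (Equiv.Perm.sameCycle_apply_left.2 (Equiv.Perm.SameCycle.refl _ _))

/-- The coboundary from edges to faces, modulo `2`. -/
noncomputable def faceSum : (Δ.E → ZMod 2) →ₗ[ZMod 2] (Δ.Face → ZMod 2) where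
  toFun x F := ∑ c with Δ.faceOf c = F, x c.1
  map_add' x y := by ext F; simp [Finset.sum_add_distrib]
  map_smul' r x := by ext F; simp [Finset.mul_sum]

/-- The coboundary from vertices to edges, modulo `2`. -/
def edgeSum : (Δ.V → ZMod 2) →ₗ[ZMod 2] (Δ.E → ZMod 2) where
  toFun φ e := φ (Δ.src e) + φ (Δ.toDGraph.tgt e)
  map_add' x y := by ext e; simp; ring
  map_smul' r x := by ext e; simp; ring

/-- The functions on undirected edges, as a kernel. -/
def revSum : (Δ.E → ZMod 2) →ₗ[ZMod 2] (Δ.E → ZMod 2) where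
  toFun x e := x e + x (Δ.rev e)
  map_add' x y := by ext e; simp; ring
  map_smul' r x := by ext e; simp; ring

theorem zmod_two_add_eq_zero {a b : ZMod 2} : a + b = 0 ↔ b = a := by
  revert a b; decide

theorem mem_ker_revSum {x : Δ.E → ZMod 2} :
    x ∈ LinearMap.ker Δ.revSum ↔ ∀ e, x (Δ.rev e) = x e := by
  rw [LinearMap.mem_ker, funext_iff]
  exact forall_congr' fun e => zmod_two_add_eq_zero

/-- In the sum around a face every value of y occurs twice. -/
theorem faceSum_eq_zero {x y : Δ.E → ZMod 2} (h : ∀ e ∉ Δ.bdry, x e = y e + y (Δ.next e)) :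
    Δ.faceSum x = 0 := by
  ext F
  change ∑ c with Δ.faceOf c = F, x c.1 = 0
  rw [Finset.sum_congr rfl fun c _ => h c.1 c.2, Finset.sum_add_distrib, zmod_two_add_eq_zero]
  refine Finset.sum_equiv Δ.nextCorner (fun c => ?_) fun c _ => rfl
  simp [faceOf_nextCorner]

theorem edgeSum_mem (φ : Δ.V → ZMod 2) :
    Δ.edgeSum φ ∈ LinearMap.ker Δ.revSum ⊓ LinearMap.ker Δ.faceSum := by
  refine ⟨Δ.mem_ker_revSum.2 fun e => ?_, Δ.faceSum_eq_zero (y := fun e => φ (Δ.src e)) ?_⟩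
  · change φ (Δ.src (Δ.rev e)) + φ (Δ.toDGraph.tgt (Δ.rev e)) = _
    rw [DGraph.tgt_rev, add_comm]
    rfl
  · intro e _
    rw [Δ.src_next]
    rfl

/-- A symmetric function is the symmetrization of its restriction to one direction of each edge. So
the kernel lies in the range, and rank-nullity gives the bound. -/
theorem two_mul_finrank_ker_revSum :
    2 * Module.finrank (ZMod 2) (LinearMap.ker Δ.revSum) ≤ Nat.card Δ.E := by
  have h1 : LinearMap.ker Δ.revSum ≤ LinearMap.range Δ.revSum := by
    intro x hx
    rw [mem_ker_revSum] at hx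
    let i := Fintype.equivFin Δ.E
    refine ⟨fun e => if i e < i (Δ.rev e) then x e else 0, ?_⟩
    ext e
    change (if i e < i (Δ.rev e) then x e else 0) +
      (if i (Δ.rev e) < i (Δ.rev (Δ.rev e)) then x (Δ.rev e) else 0) = x e
    rw [Δ.rev_rev, hx]
    rcases lt_trichotomy (i e) (i (Δ.rev e)) with h | h | h
    · simp [h, h.not_gt]
    · exact absurd (i.injective h).symm (Δ.rev_ne e)
    · simp [h, h.not_gt]
  have h2 := LinearMap.finrank_range_add_finrank_ker Δ.revSum
  have h3 := Submodule.finrank_mono h1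
  rw [Module.finrank_fintype_fun_eq_card, ← Nat.card_eq_fintype_card] at h2
  omega

/-- By connectedness only constant functions have zero coboundary. -/
theorem card_le_finrank_range_edgeSum :
    Nat.card Δ.V ≤ Module.finrank (ZMod 2) (LinearMap.range Δ.edgeSum) + 1 := by
  have h1 : LinearMap.ker Δ.edgeSum ≤ Submodule.span (ZMod 2) {fun _ => 1} := by
    intro φ hφ
    rw [LinearMap.mem_ker, funext_iff] at hφ
    have := Δ.eq_of_forall_edge (φ := φ) fun e => zmod_two_add_eq_zero.1 (hφ e)
    refine Submodule.mem_span_singleton.2 ⟨φ Δ.base, ?_⟩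
    ext a
    simpa using this _ _
  have h2 := LinearMap.finrank_range_add_finrank_ker Δ.edgeSum
  have h3 := Submodule.finrank_mono h1
  have h4 := finrank_span_le_card (R := ZMod 2) (M := Δ.V → ZMod 2) {fun _ => 1}
  rw [Module.finrank_fintype_fun_eq_card, ← Nat.card_eq_fintype_card] at h2
  simp only [Set.toFinset_singleton, Finset.card_singleton] at h4
  omega

/-- Surjectivity of the coboundary onto face functions, by duality. A functional that kills the
image gives a function x on directed edges that is constant along each face and zero on the outer
one. Testing on single undirected edges shows that x is invariant under reversal, so x is constant
because the surface is connected, and therefore zero. -/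
theorem map_faceSum_ker_revSum : (LinearMap.ker Δ.revSum).map Δ.faceSum = ⊤ := by
  by_contra hne
  obtain ⟨ψ, hψ, hle⟩ := Submodule.exists_le_ker_of_lt_top _ (lt_top_iff_ne_top.2 hne)
  let a : Δ.Face → ZMod 2 := fun F => ψ (Pi.single F 1)
  let x : Δ.E → ZMod 2 := fun e => if h : e ∉ Δ.bdry then a (Δ.faceOf ⟨e, h⟩) else 0
  have hx : ∀ c : Δ.Corner, x c.1 = a (Δ.faceOf c) := fun c => dif_pos c.2
  have hx0 : ∀ e ∈ Δ.bdry, x e = 0 := fun e he => dif_neg (not_not.2 he)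
  have hnext : ∀ e, x (Δ.next e) = x e := by
    intro e
    by_cases he : e ∈ Δ.bdry
    · rw [hx0 _ he, hx0 _ (next_mem_bdry.2 he)]
    · have h1 := hx (Δ.nextCorner ⟨e, he⟩)
      exact h1.trans ((congrArg a (Δ.faceOf_nextCorner _)).trans (hx ⟨e, he⟩).symm)
  have hsum : ∀ y : Δ.E → ZMod 2, ψ (Δ.faceSum y) = ∑ e, y e * x e := by
    intro y
    have h1 : ψ (Δ.faceSum y) = ∑ F, Δ.faceSum y F * a F := by
      rw [LinearMap.pi_apply_eq_sum_univ ψ (Δ.faceSum y)]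
      refine Finset.sum_congr rfl fun F _ => ?_
      rw [smul_eq_mul]
      congr 2
      ext F'
      simp [Pi.single_apply, eq_comm]
    have h2 : ∀ F, Δ.faceSum y F * a F = ∑ c with Δ.faceOf c = F, y c.1 * x c.1 := by
      intro F
      change (∑ c with Δ.faceOf c = F, y c.1) * a F = _
      rw [Finset.sum_mul]
      refine Finset.sum_congr rfl fun c hc => ?_
      rw [hx, (Finset.mem_filter.1 hc).2]
    rw [h1, Finset.sum_congr rfl fun F _ => h2 F]
    refine (Finset.sum_fiberwise Finset.univ Δ.faceOf fun c => y c.1 * x c.1).trans ?_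
    refine (Finset.sum_subtype (Finset.univ.filter fun e => e ∉ Δ.bdry) (by simp)
      fun e => y e * x e).symm.trans (Finset.sum_filter_of_ne fun e _ he hb => he ?_)
    rw [hx0 e hb, mul_zero]
  have hrev : ∀ e, x (Δ.rev e) = x e := by
    intro e
    -- The indicator of an undirected edge; the functional takes the value x e + x (rev e) on its
    -- coboundary.
    have h1 : (fun d => if d = e ∨ d = Δ.rev e then 1 else 0 : Δ.E → ZMod 2) ∈
        LinearMap.ker Δ.revSum := Δ.mem_ker_revSum.2 fun d => by
      have : (Δ.rev d = e ∨ Δ.rev d = Δ.rev e) ↔ (d = e ∨ d = Δ.rev e) := by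
        constructor
        · rintro (rfl | h)
          · exact Or.inr (Δ.rev_rev d).symm
          · exact Or.inl (Δ.revPerm.injective h)
        · rintro (rfl | rfl)
          · exact Or.inr rfl
          · exact Or.inl (Δ.rev_rev e)
      simp only [this]
    have h2 := hle ⟨_, h1, rfl⟩
    rw [LinearMap.mem_ker, hsum] at h2
    simp only [ite_mul, one_mul, zero_mul, ← Finset.sum_filter] at h2
    have h3 : (Finset.univ.filter fun d => d = e ∨ d = Δ.rev e) = {e, Δ.rev e} := by
      ext d; simp
    rw [h3, Finset.sum_pair (Δ.rev_ne e).symm] at h2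
    exact zmod_two_add_eq_zero.1 h2
  have hzero : ∀ e, x e = 0 := by
    intro e
    obtain ⟨d, hd⟩ := List.exists_mem_of_ne_nil _ fun h => (Δ.bdry_nil h).elim e
    rw [← hx0 d hd]
    exact Δ.eq_of_forall_next hrev hnext _ _
  refine hψ (LinearMap.ext fun y => ?_)
  rw [LinearMap.pi_apply_eq_sum_univ ψ y, LinearMap.zero_apply]
  refine Finset.sum_eq_zero fun F _ => ?_
  have : a F = 0 := by
    induction F using Quotient.ind with
    | _ c => exact (hx c).symm.trans (hzero _)
  rw [show (ψ fun F' => if F = F' then 1 else 0) = a F by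
    congr 1; ext F'; simp [Pi.single_apply, eq_comm], this, smul_zero]

end Cohomology
end LabelledMap

namespace VanKampenDiagram
variable {G : Type u} [Group G] {A : Type v} {P : SymmetrizedPresentation G A}
  (Δ : VanKampenDiagram P)

/-- The first cohomology of a van Kampen diagram, modulo `2`, is trivial. -/
theorem exists_potential {x y : Δ.E → ZMod 2} (hrev : ∀ e, x (Δ.rev e) = x e)
    (h : ∀ e ∉ Δ.bdry, x e = y e + y (Δ.next e)) :
    ∃ φ : Δ.V → ZMod 2, ∀ e, x e = φ (Δ.src e) + φ (Δ.toDGraph.tgt e) := by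
  have h1 : LinearMap.range Δ.edgeSum ≤
      LinearMap.ker Δ.revSum ⊓ LinearMap.ker Δ.faceSum := by
    rintro _ ⟨φ, rfl⟩
    exact Δ.edgeSum_mem φ
  have h2 : Module.finrank (ZMod 2)
      ↥(LinearMap.ker Δ.revSum ⊓ LinearMap.ker Δ.faceSum) + Nat.card Δ.Face =
      Module.finrank (ZMod 2) (LinearMap.ker Δ.revSum) := by
    have h3 := LinearMap.finrank_range_add_finrank_ker (Δ.faceSum.domRestrict (LinearMap.ker Δ.revSum))
    rw [LinearMap.range_domRestrict, Δ.map_faceSum_ker_revSum, finrank_top,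
      Module.finrank_fintype_fun_eq_card, ← Nat.card_eq_fintype_card, LinearMap.ker_domRestrict,
      ← Submodule.finrank_map_subtype_eq, Submodule.map_comap_subtype] at h3
    omega
  have h4 := Δ.two_mul_finrank_ker_revSum
  have h5 := Δ.card_le_finrank_range_edgeSum
  have h6 := Δ.euler
  -- With V, E, F the numbers of vertices, directed edges and inner faces, the space of cocycles has
  -- dimension at most E/2 - F, which is V - 1 by the Euler formula, and the coboundaries already
  -- have dimension at least V - 1.
  have h7 := Submodule.eq_of_le_of_finrank_le h1 (by omega)
  have h8 : x ∈ LinearMap.range Δ.edgeSum := by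
    rw [h7]
    exact ⟨Δ.mem_ker_revSum.2 hrev, Δ.faceSum_eq_zero h⟩
  obtain ⟨φ, hφ⟩ := h8
  exact ⟨φ, fun e => (congrFun hφ e).symm⟩

end VanKampenDiagram

/-! ### Separation of a diagram at a repeated boundary vertex -/

namespace VanKampenDiagram
variable {G : Type u} [Group G] {A : Type v} {P : SymmetrizedPresentation G A}

/-- Two edges of the boundary circuit with the same initial vertex. -/
structure CutData (P : SymmetrizedPresentation G A) where
  Δ : VanKampenDiagram P
  i : ℕ
  j : ℕ
  i_lt : i < j
  j_lt : j < Δ.bdry.length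
  src_eq : Δ.src (Δ.bdry[i]'(i_lt.trans j_lt)) = Δ.src Δ.bdry[j]

namespace CutData
variable (C : CutData P)
open Classical

/-- The cut vertex. -/
def v : C.Δ.V := C.Δ.src (C.Δ.bdry[C.j]'C.j_lt)

/-- The first edge. -/
def b : C.Δ.E := C.Δ.bdry[C.i]'(C.i_lt.trans C.j_lt)

/-- The second edge. -/
def c : C.Δ.E := C.Δ.bdry[C.j]'C.j_lt

theorem exists_turn : ∃ m : ℕ, C.Δ.turn^[m] C.b = C.c := LabelledMap.exists_turn_iterate C.src_eq

/-- The edges of the sector at the cut vertex from the first edge to the second one. -/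
def Sector (e : C.Δ.E) : Prop := ∃ k < Nat.find C.exists_turn, C.Δ.turn^[k] C.b = e

theorem b_ne_c : C.b ≠ C.c := fun h =>
  C.i_lt.ne ((List.Nodup.getElem_inj_iff C.Δ.bdry_nodup).1 h)

theorem sector_b : C.Sector C.b := by
  refine ⟨0, Nat.pos_of_ne_zero fun h => C.b_ne_c ?_, rfl⟩
  have := Nat.find_spec C.exists_turn
  rwa [h] at this

theorem not_sector_c : ¬C.Sector C.c := fun ⟨_, hk, h⟩ => Nat.find_min C.exists_turn hk h

theorem Sector.src {C : CutData P} {e : C.Δ.E} (h : C.Sector e) : C.Δ.src e = C.v := by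
  obtain ⟨k, -, rfl⟩ := h
  induction k with
  | zero => exact C.src_eq
  | succ k ih => rw [Function.iterate_succ_apply', LabelledMap.src_turn, ih]

/-- In the turn around the cut vertex, membership in the sector changes only on arrival at `b` or
`c`. The edges `rev e` and `next e` are consecutive in the turn. -/
theorem sector_next {e : C.Δ.E} (hb : C.Δ.next e ≠ C.b) (hc : C.Δ.next e ≠ C.c) :
    C.Sector (C.Δ.next e) ↔ C.Sector (C.Δ.rev e) := by
  rw [← LabelledMap.turn_rev] at hb hc ⊢
  constructor
  · rintro ⟨_ | k, hk, h⟩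
    · exact absurd h.symm hb
    · rw [Function.iterate_succ_apply'] at h
      exact ⟨k, by omega, C.Δ.turn.injective h⟩
  · rintro ⟨k, hk, h⟩
    rw [← h, ← Function.iterate_succ_apply' (f := C.Δ.turn)] at hc ⊢
    refine ⟨k + 1, lt_of_le_of_ne hk fun h' => hc ?_, rfl⟩
    have := Nat.find_spec C.exists_turn
    rwa [← h'] at this

/-- The indicator function of the sector. -/
noncomputable def ind (e : C.Δ.E) : ZMod 2 := if C.Sector e then 1 else 0

/-- The cochain that counts, modulo 2, the ends of an edge in the sector is a cocycle: at a corner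
of an inner face the indicator agrees on `rev e` and `next e`, because `b` and `c` lie on the outer
face. -/
theorem exists_potential : ∃ φ : C.Δ.V → ZMod 2, ∀ e,
    C.ind e + C.ind (C.Δ.rev e) = φ (C.Δ.src e) + φ (C.Δ.toDGraph.tgt e) := by
  refine C.Δ.exists_potential (x := fun e => C.ind e + C.ind (C.Δ.rev e)) (y := C.ind)
    (fun e => ?_) fun e he => ?_
  · rw [C.Δ.rev_rev, add_comm]
  · have he' : C.Δ.next e ∉ C.Δ.bdry := LabelledMap.next_mem_bdry.not.2 he
    have := C.sector_next (e := e) (fun h => he' (h ▸ List.getElem_mem _))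
      fun h => he' (h ▸ List.getElem_mem _)
    simp only [ind, this]

/-- A potential of the sector. -/
noncomputable def pot : C.Δ.V → ZMod 2 := C.exists_potential.choose

theorem pot_spec (e : C.Δ.E) :
    C.ind e + C.ind (C.Δ.rev e) = C.pot (C.Δ.src e) + C.pot (C.Δ.toDGraph.tgt e) :=
  C.exists_potential.choose_spec e

/-- The vertices that are cut off. -/
def In (a : C.Δ.V) : Prop := a ≠ C.v ∧ C.pot a ≠ C.pot C.v

/-- The edges that are cut off. -/
def EdgeIn (e : C.Δ.E) : Prop := C.In (C.Δ.src e) ∨ C.In (C.Δ.toDGraph.tgt e)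

theorem ind_of_src {e : C.Δ.E} (h : C.Δ.src e ≠ C.v) : C.ind e = 0 := if_neg fun h' => h h'.src

theorem in_src_iff {e : C.Δ.E} (h : C.Δ.src e ≠ C.v) (h' : C.Δ.toDGraph.tgt e ≠ C.v) :
    C.In (C.Δ.src e) ↔ C.In (C.Δ.toDGraph.tgt e) := by
  have h1 := C.pot_spec e
  rw [C.ind_of_src h, C.ind_of_src (e := C.Δ.rev e) h', add_zero, eq_comm,
    LabelledMap.zmod_two_add_eq_zero] at h1
  simp [In, h, h', h1]

/-- Only one end of such an edge is at the cut vertex, so the potential changes along the edge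
exactly when the edge is in the sector. -/
theorem in_tgt_iff {e : C.Δ.E} (h : C.Δ.src e = C.v) :
    C.In (C.Δ.toDGraph.tgt e) ↔ C.Sector e := by
  have h0 : C.Δ.toDGraph.tgt e ≠ C.v := fun h' => src_ne_tgt e (h.trans h'.symm)
  have h1 := C.pot_spec e
  rw [C.ind_of_src (e := C.Δ.rev e) h0, add_zero, h] at h1
  have h2 : ∀ a b : ZMod 2, 1 = a + b ↔ b ≠ a := by decide
  by_cases hs : C.Sector e
  · rw [ind, if_pos hs, h2] at h1
    simp [In, h0, h1, hs]
  · rw [ind, if_neg hs, eq_comm, LabelledMap.zmod_two_add_eq_zero] at h1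
    simp [In, h1, hs]

theorem edgeIn_rev (e : C.Δ.E) : C.EdgeIn (C.Δ.rev e) ↔ C.EdgeIn e := by
  rw [EdgeIn, EdgeIn, DGraph.tgt_rev, DGraph.src_rev, or_comm]

theorem not_in_v : ¬C.In C.v := fun h => h.1 rfl

theorem edgeIn_of_src_ne {e : C.Δ.E} (h : C.Δ.src e ≠ C.v) :
    C.EdgeIn e ↔ C.In (C.Δ.src e) := by
  by_cases h' : C.Δ.toDGraph.tgt e = C.v
  · rw [EdgeIn, h', or_iff_left C.not_in_v]
  · rw [EdgeIn, C.in_src_iff h h', or_self]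

theorem edgeIn_of_src_eq {e : C.Δ.E} (h : C.Δ.src e = C.v) : C.EdgeIn e ↔ C.Sector e := by
  rw [EdgeIn, h, or_iff_right C.not_in_v, C.in_tgt_iff h]

theorem edgeIn_next {e : C.Δ.E} (hb : C.Δ.next e ≠ C.b) (hc : C.Δ.next e ≠ C.c) :
    C.EdgeIn (C.Δ.next e) ↔ C.EdgeIn e := by
  rw [← C.edgeIn_rev e]
  have h := C.Δ.src_next e
  by_cases h' : C.Δ.src (C.Δ.rev e) = C.v
  · rw [C.edgeIn_of_src_eq h', C.edgeIn_of_src_eq (h.trans h'), C.sector_next hb hc]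
  · rw [C.edgeIn_of_src_ne h', C.edgeIn_of_src_ne (h ▸ h'), h]

/-- Along the boundary circuit, membership in the cut-off part can change only at the indices i and
j. At i it is true because `b` is in the sector, at j false because `c` is not. -/
theorem edgeIn_bdry_succ {l : ℕ} (hl : l + 1 < C.Δ.bdry.length) (hi : l + 1 ≠ C.i)
    (hj : l + 1 ≠ C.j) : C.EdgeIn C.Δ.bdry[l + 1] ↔ C.EdgeIn C.Δ.bdry[l] := by
  have h := C.Δ.bdry_next l (by omega)
  simp only [Nat.mod_eq_of_lt hl] at h
  rw [← h]
  refine C.edgeIn_next (fun h' => hi ?_) fun h' => hj ?_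
  · exact (List.Nodup.getElem_inj_iff C.Δ.bdry_nodup).1 (h.symm.trans h')
  · exact (List.Nodup.getElem_inj_iff C.Δ.bdry_nodup).1 (h.symm.trans h')

theorem edgeIn_bdry {l : ℕ} (hi : C.i ≤ l) (hj : l < C.j) :
    C.EdgeIn (C.Δ.bdry[l]'(hj.trans C.j_lt)) := by
  induction l, hi using Nat.le_induction with
  | base => exact (C.edgeIn_of_src_eq C.src_eq).2 C.sector_b
  | succ l hl ih =>
    exact (C.edgeIn_bdry_succ (hj.trans C.j_lt) (by omega) (by omega)).2 (ih (by omega))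

theorem not_edgeIn_bdry {l : ℕ} (hj : C.j ≤ l) (hl : l < C.Δ.bdry.length) :
    ¬C.EdgeIn C.Δ.bdry[l] := by
  induction l, hj using Nat.le_induction with
  | base => exact fun h => C.not_sector_c ((C.edgeIn_of_src_eq rfl).1 h)
  | succ l hl' ih =>
    have := C.i_lt
    rw [C.edgeIn_bdry_succ hl (by omega) (by omega)]
    exact ih (by omega)

/-- The last edge of the boundary circuit is not cut off, and it ends at the base vertex. -/
theorem not_in_base : ¬C.In C.Δ.base := by
  have hj := C.j_lt
  have h1 := C.not_edgeIn_bdry (l := C.Δ.bdry.length - 1) (by omega) (by omega)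
  have h2 := C.Δ.isWalk_bdry.tgt_getElem (k := C.Δ.bdry.length - 1) (by omega)
  rw [Nat.sub_add_cancel (by omega), List.take_length, C.Δ.walkEnd_bdry] at h2
  exact fun h => h1 (Or.inr (h2 ▸ h))

/-- The level of a vertex: positive if it is cut off, and `0` for the cut vertex. -/
noncomputable def level (a : C.Δ.V) : ℝ := if C.In a then 1 else if a = C.v then 0 else -1

/-- The level of a face. -/
noncomputable def faceLevel (e : C.Δ.E) : ℝ := if C.EdgeIn e then 1 else -1

theorem faceLevel_next (e : C.Δ.E) (he : e ∉ C.Δ.bdry) :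
    C.faceLevel (C.Δ.next e) = C.faceLevel e := by
  have he' : C.Δ.next e ∉ C.Δ.bdry := LabelledMap.next_mem_bdry.not.2 he
  simp only [faceLevel, C.edgeIn_next (e := e) (fun h => he' (h ▸ List.getElem_mem _))
    fun h => he' (h ▸ List.getElem_mem _)]

/-- A continuous function that is positive exactly on the part that is cut off, and vanishes only at
the cut vertex. -/
noncomputable def side : C.Δ.Space → ℝ :=
  C.Δ.height C.level (fun _ => 0) C.faceLevel (fun _ => rfl) C.faceLevel_next

theorem continuous_side : Continuous C.side := LabelledMap.continuous_height ..

theorem side_edgePt (e : C.Δ.E) (s : I) : C.side (C.Δ.edgePt e s) =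
    (1 - s) * C.level (C.Δ.src e) + s * C.level (C.Δ.toDGraph.tgt e) := by
  refine (LabelledMap.height_edgePt ..).trans ?_
  ring

theorem level_v : C.level C.v = 0 := by simp [level, C.not_in_v]

theorem level_eq {a : C.Δ.V} {e : C.Δ.E} (ha : a ≠ C.v) (h : C.In a ↔ C.EdgeIn e) :
    C.level a = C.faceLevel e := by
  simp [level, faceLevel, ha, h]

/-- On an edge, the function `side` is constant, or linear with a zero at the cut vertex. -/
theorem exists_side_edgePt (e : C.Δ.E) (s : I) : ∃ r : ℝ, 0 ≤ r ∧
    C.side (C.Δ.edgePt e s) = r * C.faceLevel e ∧ (r = 0 → C.Δ.edgePt e s = C.Δ.vertexPt C.v) := by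
  rw [side_edgePt]
  have h0 := s.2.1
  have h1 := s.2.2
  by_cases hs : C.Δ.src e = C.v
  · have ht : C.Δ.toDGraph.tgt e ≠ C.v := fun h' => src_ne_tgt e (hs.trans h'.symm)
    refine ⟨s, h0, ?_, fun h => ?_⟩
    · rw [hs, C.level_v, C.level_eq ht (e := e)
        ((C.in_tgt_iff hs).trans (C.edgeIn_of_src_eq hs).symm)]
      ring
    · obtain rfl : s = 0 := Subtype.ext h
      rw [LabelledMap.edgePt_zero, hs]
  · have h2 := C.level_eq hs (C.edgeIn_of_src_ne hs).symm
    by_cases ht : C.Δ.toDGraph.tgt e = C.v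
    · refine ⟨1 - s, by linarith, ?_, fun h => ?_⟩
      · rw [ht, C.level_v, h2]
        ring
      · obtain rfl : s = 1 := Subtype.ext (by simpa using (sub_eq_zero.1 h).symm)
        rw [LabelledMap.edgePt_one, ht]
    · refine ⟨1, zero_le_one, ?_, fun h => absurd h one_ne_zero⟩
      rw [h2, C.level_eq ht (e := e)
        ((C.in_src_iff hs ht).symm.trans (C.edgeIn_of_src_ne hs).symm)]
      ring

theorem faceLevel_ne_zero (e : C.Δ.E) : C.faceLevel e ≠ 0 := by
  unfold faceLevel
  split_ifs <;> norm_num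

/-- Every cell other than the cut vertex lies strictly on one side: the boundary of an inner face
has a single sign away from the cut vertex, and so has its apex. -/
theorem eq_of_side_eq_zero (p : C.Δ.Space) (h : C.side p = 0) : p = C.Δ.vertexPt C.v := by
  induction p using LabelledMap.space_ind with
  | hv a =>
    change C.level a = 0 at h
    unfold level at h
    split_ifs at h with h1 h2
    · norm_num at h
    · rw [h2]
    · norm_num at h
  | he e s =>
    obtain ⟨r, hr, h1, h2⟩ := C.exists_side_edgePt e s
    rw [h1] at h
    exact h2 ((mul_eq_zero.1 h).resolve_right (C.faceLevel_ne_zero e))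
  | hc c s r =>
    obtain ⟨q, hq, h1, h2⟩ := C.exists_side_edgePt c.1 s
    have h3 : C.side (C.Δ.conePt c s r) =
        (1 - r) * C.side (C.Δ.edgePt c.1 s) + r * C.faceLevel c.1 := rfl
    rw [h3, h1, ← mul_assoc, ← add_mul] at h
    have h4 := (mul_eq_zero.1 h).resolve_right (C.faceLevel_ne_zero _)
    have h5 : (r : ℝ) = 0 := by nlinarith [r.2.1, r.2.2, mul_nonneg (sub_nonneg.2 r.2.2) hq]
    obtain rfl : r = 0 := Subtype.ext h5
    rw [LabelledMap.conePt_zero]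
    exact h2 (by simpa using h4)

theorem side_bdry_nonneg {l : ℕ} (hi : C.i ≤ l) (hj : l < C.j) (s : I) :
    0 ≤ C.side (C.Δ.edgePt (C.Δ.bdry[l]'(hj.trans C.j_lt)) s) := by
  obtain ⟨r, hr, h1, -⟩ := C.exists_side_edgePt (C.Δ.bdry[l]'(hj.trans C.j_lt)) s
  rw [h1, faceLevel, if_pos (C.edgeIn_bdry hi hj), mul_one]
  exact hr

theorem level_nonpos {a : C.Δ.V} (h : ¬C.In a) : C.level a ≤ 0 := by
  unfold level
  rw [if_neg h]
  split_ifs <;> norm_num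

/-- Edges that avoid the cut vertex do not connect the two parts, and the base vertex is not cut
off. A path that can meet the cut vertex only at its end never gets into the cut-off part. -/
theorem side_walkPt_nonpos {p : List C.Δ.E} (hp : C.Δ.toDGraph.IsWalk C.Δ.base p)
    (hv : ∀ k < p.length, C.Δ.toDGraph.walkEnd C.Δ.base (p.take k) ≠ C.v) (t : ℝ) :
    C.side (C.Δ.walkPt p t) ≤ 0 := by
  have key : ∀ k ≤ p.length, ¬C.In (C.Δ.toDGraph.walkEnd C.Δ.base (p.take k)) := by
    intro k hk
    induction k with
    | zero => exact C.not_in_base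
    | succ k ih =>
      have h1 := hp.src_getElem (k := k) hk
      have h2 := hp.tgt_getElem (k := k) hk
      rw [← h2]
      intro h3
      have h4 := hv k hk
      rw [← h1] at h4
      exact ih (by omega) (h1 ▸ (C.in_src_iff h4 h3.1).2 h3)
  rcases le_total t 0 with h0 | h0
  · rw [LabelledMap.walkPt, DGraph.walkPoint_of_nonpos hp h0]
    exact C.level_nonpos C.not_in_base
  rcases le_total (p.length : ℝ) t with h1 | h1
  · rw [LabelledMap.walkPt, DGraph.walkPoint_of_length_le _ h1]
    have := key _ le_rfl
    rw [List.take_length] at this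
    exact C.level_nonpos this
  rcases Nat.eq_zero_or_pos p.length with hp0 | hp0
  · obtain rfl := List.length_eq_zero_iff.1 hp0
    exact C.level_nonpos C.not_in_base
  obtain ⟨k, hk, s, rfl⟩ := DGraph.exists_natCast_add hp0 h0 h1
  rw [LabelledMap.walkPt_natCast_add hp hk, side_edgePt, hp.src_getElem hk, hp.tgt_getElem hk]
  have h2 := C.level_nonpos (key k hk.le)
  have h3 := C.level_nonpos (key (k + 1) hk)
  nlinarith [mul_nonneg s.2.1 (neg_nonneg.2 h3), mul_nonneg (sub_nonneg.2 s.2.2) (neg_nonneg.2 h2)]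

/-- The retraction that collapses the part that is cut off to the cut vertex. -/
noncomputable def retract (p : C.Δ.Space) : C.Δ.Space :=
  if C.side p ≤ 0 then p else C.Δ.vertexPt C.v

/-- The two formulas meet where `side` vanishes, that is, only at the cut vertex, which both of them
fix. -/
theorem continuous_retract : Continuous C.retract :=
  Continuous.if_le continuous_id continuous_const C.continuous_side continuous_const
    C.eq_of_side_eq_zero

theorem retract_of_nonpos {p : C.Δ.Space} (h : C.side p ≤ 0) : C.retract p = p := if_pos h

theorem retract_of_nonneg {p : C.Δ.Space} (h : 0 ≤ C.side p) :
    C.retract p = C.Δ.vertexPt C.v := by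
  rcases h.eq_or_lt with h | h
  · rw [C.retract_of_nonpos h.symm.le, C.eq_of_side_eq_zero _ h.symm]
  · exact if_neg (not_le.2 h)

/-- The retraction preserves tameness. -/
theorem isTamePath_retract {f : QuarterNat → QuarterNat} (hf : Monotone f) {γ : I → C.Δ.Space}
    (hc : Continuous γ) (ht : C.Δ.IsTamePath f γ)
    (hv : (C.Δ.coarseRat (C.Δ.vertexPt C.v)) ≤ f (C.Δ.coarseDist (C.Δ.vertexPt C.v)) + 2) :
    C.Δ.IsTamePath (shift f) fun t => C.retract (γ t) := by
  -- Needed when both points have been collapsed: the cut vertex is then compared with itself, which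
  -- tameness of γ alone does not cover.
  have hv' : C.Δ.coarseDist (C.Δ.vertexPt C.v) ≤ shift f (C.Δ.coarseDist (C.Δ.vertexPt C.v)) := by
    change C.Δ.coarseRat _ ≤ (shift f (C.Δ.coarseDist (C.Δ.vertexPt C.v)) : ℚ)
    linarith [le_shift hf (C.Δ.coarseDist (C.Δ.vertexPt C.v))]
  have hle : ∀ n, f n ≤ shift f n := fun n => by
    change (f n : ℚ) ≤ shift f n
    linarith [le_shift hf n]
  -- Between points on different sides the path passes through the cut vertex, by the intermediate
  -- value theorem. Comparing with that time handles the cases in which just one of the two points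
  -- is collapsed.
  have hcross : ∀ s t, s ≤ t → C.side (γ s) * C.side (γ t) ≤ 0 →
      ∃ r, s ≤ r ∧ r ≤ t ∧ γ r = C.Δ.vertexPt C.v := by
    intro s t hst h
    have hcont : ContinuousOn (fun r => C.side (γ r)) (Set.Icc s t) :=
      (C.continuous_side.comp hc).continuousOn
    rcases mul_nonpos_iff.1 h with h | h
    · obtain ⟨r, hr, h0⟩ := intermediate_value_Icc' hst hcont ⟨h.2, h.1⟩
      exact ⟨r, hr.1, hr.2, C.eq_of_side_eq_zero _ h0⟩
    · obtain ⟨r, hr, h0⟩ := intermediate_value_Icc hst hcont ⟨h.1, h.2⟩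
      exact ⟨r, hr.1, hr.2, C.eq_of_side_eq_zero _ h0⟩
  have hweak : ∀ s t, s ≤ t → C.Δ.coarseDist (γ s) ≤ f (C.Δ.coarseDist (γ t)) ∨ s = t :=
    fun s t hst => hst.eq_or_lt.symm.imp (ht s t) id
  intro s t hst
  rcases le_total (C.side (γ s)) 0 with hs | hs <;> rcases le_total (C.side (γ t)) 0 with h | h
  · simp only [C.retract_of_nonpos hs, C.retract_of_nonpos h]
    exact (ht s t hst).trans (hle _)
  · simp only [C.retract_of_nonpos hs, C.retract_of_nonneg h]
    obtain ⟨r, hr, -, h0⟩ := hcross s t hst.le (mul_nonpos_of_nonpos_of_nonneg hs h)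
    rw [← h0] at hv' ⊢
    rcases hweak s r hr with h1 | rfl
    · exact h1.trans (hle _)
    · exact hv'
  · simp only [C.retract_of_nonneg hs, C.retract_of_nonpos h]
    obtain ⟨r, -, hr, h0⟩ := hcross s t hst.le (mul_nonpos_of_nonneg_of_nonpos hs h)
    rw [← h0] at hv' ⊢
    rcases hweak r t hr with h1 | rfl
    · exact h1.trans (hle _)
    · exact hv'
  · simp only [C.retract_of_nonneg hs, C.retract_of_nonneg h]
    exact hv'

end CutData
end VanKampenDiagram

/-! ### Tame strips between paths -/

namespace LabelledMap
variable {A : Type v} {inv : A → A} {Δ : LabelledMap.{v} A inv}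

/-- Two paths from the basepoint to points of the edge `e` are joined by a family of `f`-tame paths
from the basepoint to points of `e`. -/
def TameStrip (Δ : LabelledMap.{v} A inv) (f : QuarterNat → QuarterNat) (e : Δ.E) (c₀ c₁ : I)
    (γ₀ γ₁ : I → Δ.Space) : Prop :=
  ∃ K : C(I × I, Δ.Space × I), (∀ s, (K (s, 0)).1 = Δ.basePt) ∧
    (∀ s, (K (s, 1)).1 = Δ.edgePt e (K (s, 1)).2) ∧ (∀ t, K (0, t) = (γ₀ t, c₀)) ∧
    (∀ t, K (1, t) = (γ₁ t, c₁)) ∧ ∀ s, Δ.IsTamePath f fun t => (K (s, t)).1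

variable {f : QuarterNat → QuarterNat} {e : Δ.E} {c₀ c₁ c₂ : I} {γ₀ γ₁ γ₂ : I → Δ.Space}

theorem TameStrip.symm (h : Δ.TameStrip f e c₀ c₁ γ₀ γ₁) : Δ.TameStrip f e c₁ c₀ γ₁ γ₀ := by
  obtain ⟨K, h1, h2, h3, h4, h5⟩ := h
  refine ⟨⟨fun z => K (σ z.1, z.2), K.continuous.comp
    ((unitInterval.continuous_symm.comp continuous_fst).prodMk continuous_snd)⟩, fun s => h1 (σ s),
    fun s => h2 (σ s), fun t => ?_, fun t => ?_, fun s => h5 (σ s)⟩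
  · exact (congrArg (fun s => K (s, t)) unitInterval.symm_zero).trans (h4 t)
  · exact (congrArg (fun s => K (s, t)) unitInterval.symm_one).trans (h3 t)

theorem TameStrip.trans (h : Δ.TameStrip f e c₀ c₁ γ₀ γ₁) (h' : Δ.TameStrip f e c₁ c₂ γ₁ γ₂) :
    Δ.TameStrip f e c₀ c₂ γ₀ γ₂ := by
  obtain ⟨K, h1, h2, h3, h4, h5⟩ := h
  obtain ⟨K', k1, k2, k3, k4, k5⟩ := h'
  -- The strips are placed side by side in the first variable, whereas `pathConcat` joins in the
  -- second.
  let sw : C(I × I, I × I) := ⟨Prod.swap, continuous_swap⟩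
  have hK : ∀ t, K.comp sw (t, 1) = K'.comp sw (t, 0) := fun t => (h4 t).trans (k3 t).symm
  let H := (pathConcat (K.comp sw) (K'.comp sw) hK).comp sw
  have key : ∀ s, (∃ s', ∀ t, H (s, t) = K (s', t)) ∨ ∃ s', ∀ t, H (s, t) = K' (s', t) := by
    intro s
    rcases le_total (s : ℝ) (1 / 2) with hs | hs
    · exact Or.inl ⟨_, fun t => pathConcat_of_le (h := hK) (z := t) hs⟩
    · exact Or.inr ⟨_, fun t => pathConcat_of_ge (h := hK) (z := t) hs⟩
  refine ⟨H, fun s => ?_, fun s => ?_, fun t => ?_, fun t => ?_, fun s => ?_⟩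
  · rcases key s with ⟨s', h⟩ | ⟨s', h⟩ <;> rw [h]
    exacts [h1 _, k1 _]
  · rcases key s with ⟨s', h⟩ | ⟨s', h⟩ <;> rw [h]
    exacts [h2 _, k2 _]
  · exact (pathConcat_zero (h := hK) t).trans (h3 t)
  · exact (pathConcat_one (h := hK) t).trans (k4 t)
  · rcases key s with ⟨s', h⟩ | ⟨s', h⟩ <;> simp only [h]
    exacts [h5 _, k5 _]

/-- A homotopy to the points of an edge is a strip. -/
theorem tameStrip_of_homotopy {H : C(I × I, Δ.Space)} {c : I → I} (hc : Continuous c)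
    (h0 : ∀ s, H (s, 0) = Δ.basePt) (h1 : ∀ s, H (s, 1) = Δ.edgePt e (c s))
    (ht : ∀ s, Δ.IsTamePath f fun t => H (s, t)) :
    Δ.TameStrip f e (c 0) (c 1) (fun t => H (0, t)) fun t => H (1, t) :=
  ⟨⟨fun z => (H z, c z.1), by fun_prop⟩, h0, h1, fun _ => rfl, fun _ => rfl, ht⟩

/-- The constant strip. -/
theorem tameStrip_refl {γ : I → Δ.Space} (hγ : Continuous γ) (h0 : γ 0 = Δ.basePt)
    (h1 : γ 1 = Δ.edgePt e c₀) (ht : Δ.IsTamePath f γ) : Δ.TameStrip f e c₀ c₀ γ γ :=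
  tameStrip_of_homotopy (H := ⟨fun z => γ z.2, by fun_prop⟩) (c := fun _ => c₀) continuous_const
    (fun _ => h0) (fun _ => h1) fun _ => ht

/-- The path that runs along `γ` at double speed and then stays at its end. -/
noncomputable def delay {X : Type*} (γ : I → X) (t : I) : X :=
  γ (Set.projIcc 0 1 zero_le_one (2 * t : ℝ))

/-- A strip along a whole edge can be straightened. -/
theorem TameStrip.exists_homotopy (hf : Monotone f)
    (he : (Δ.edgeLow e : ℚ) ≤ f (QuarterNat.ofNat (Δ.edgeLow e)) + 2)
    (h : Δ.TameStrip f e 0 1 γ₀ γ₁) :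
    ∃ M : C(I × I, Δ.Space), (∀ s, M (s, 0) = Δ.basePt) ∧ (∀ s, M (s, 1) = Δ.edgePt e s) ∧
      (∀ t, M (0, t) = delay γ₀ t) ∧ (∀ t, M (1, t) = delay γ₁ t) ∧ Δ.IsTame (shift f) M := by
  obtain ⟨K, h1, h2, h3, h4, h5⟩ := h
  have hmem : ∀ a b t : I, (1 - (t : ℝ)) * a + t * b ∈ Set.Icc (0 : ℝ) 1 := fun a b t =>
    convex_Icc 0 1 a.2 b.2 (sub_nonneg.2 t.2.2) t.2.1 (by ring)
  -- The path with parameter s ends at some point of the edge, not necessarily at the one with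
  -- coordinate s. A second stretch moves linearly inside the edge to that point. It is constant for
  -- s = 0 and s = 1, which explains `delay`.
  let κ : I × I → I := fun z => ⟨_, hmem (K (z.1, 1)).2 z.1 z.2⟩
  have hκ : Continuous κ := by
    refine Continuous.subtype_mk ?_ _
    have : Continuous fun z : I × I => (K (z.1, 1)).2 := by fun_prop
    fun_prop
  let Q : C(I × I, Δ.Space) := ⟨fun z => (K z).1, by fun_prop⟩
  let W : C(I × I, Δ.Space) := ⟨fun z => Δ.edgePt e (κ z), (continuous_edgePt e).comp hκ⟩
  have hQW : ∀ s, Q (s, 1) = W (s, 0) := fun s => (h2 s).trans (congrArg (Δ.edgePt e)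
    (Subtype.ext (by simp [κ])))
  have hend : ∀ (s : I) (γ : I → Δ.Space), (∀ t, K (s, t) = (γ t, s)) →
      ∀ t, pathConcat Q W hQW (s, t) = delay γ t := by
    intro s γ hγ t
    rcases le_total (t : ℝ) (1 / 2) with ht | ht
    · rw [pathConcat_of_le ht]
      exact congrArg Prod.fst (hγ _)
    · rw [pathConcat_of_ge ht, delay, Set.projIcc_of_right_le (x := (2 * t : ℝ)) _ (by linarith)]
      have h6 := h2 s
      rw [hγ] at h6
      refine Eq.trans (congrArg (Δ.edgePt e) (Subtype.ext ?_)) h6.symm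
      simp only [κ, hγ]
      ring
  refine ⟨pathConcat Q W hQW, fun s => ?_, fun s => ?_, hend 0 γ₀ h3, hend 1 γ₁ h4, ?_⟩
  · rw [pathConcat_zero]
    exact h1 s
  · rw [pathConcat_one]
    exact congrArg (Δ.edgePt e) (Subtype.ext (by simp [κ]))
  · refine isTame_pathConcat hf h5 fun s t => ⟨Δ.edgeLow e, edgeLow_le_coarse _ _, he, fun s' _ => ?_⟩
    exact (coarse_le_edgeLow _ _).trans (by linarith)

end LabelledMap

/-! ### Joining the paths to repeated boundary vertices -/

namespace VanKampenDiagram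
variable {G : Type u} [Group G] {A : Type v} {P : SymmetrizedPresentation G A}

/-- Compatible tame homotopies to the edges of the boundary circuit, which start and end with
geodesics. -/
structure ClosedFan (Δ : VanKampenDiagram P) (f : QuarterNat → QuarterNat) where
  path : ℕ → List Δ.E
  time : ℕ → I → ℝ
  homotopy : ℕ → C(I × I, Δ.Space)
  isWalk : ∀ k ≤ Δ.bdry.length, Δ.toDGraph.IsWalk Δ.base (path k)
  walkEnd : ∀ k ≤ Δ.bdry.length,
    Δ.toDGraph.walkEnd Δ.base (path k) = Δ.toDGraph.walkEnd Δ.base (Δ.bdry.take k)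
  geodesic : ∀ k ≤ Δ.bdry.length, P.IsGeodesicWord ((path k).map Δ.label)
  tame : ∀ k < Δ.bdry.length, Δ.IsTame f (homotopy k)
  zero : ∀ k < Δ.bdry.length, ∀ s, homotopy k (s, 0) = Δ.basePt
  one : ∀ k (hk : k < Δ.bdry.length) s, homotopy k (s, 1) = Δ.edgePt Δ.bdry[k] s
  left : ∀ k < Δ.bdry.length, ∀ t, homotopy k (0, t) = Δ.walkPt (path k) (time k t)
  right : ∀ k < Δ.bdry.length, ∀ t, homotopy k (1, t) = Δ.walkPt (path (k + 1)) (time (k + 1) t)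

namespace ClosedFan
variable {Δ : VanKampenDiagram P} {f : QuarterNat → QuarterNat} (F : ClosedFan Δ f)

/-- The path to the start of the `k`-th edge of the boundary circuit. -/
noncomputable def line (k : ℕ) (t : I) : Δ.Space := Δ.walkPt (F.path k) (F.time k t)

/-- The `k`-th vertex of the boundary circuit. -/
def vert (Δ : VanKampenDiagram P) (k : ℕ) : Δ.V := Δ.toDGraph.walkEnd Δ.base (Δ.bdry.take k)

theorem src_bdry {k : ℕ} (hk : k < Δ.bdry.length) : Δ.src Δ.bdry[k] = vert Δ k :=
  Δ.isWalk_bdry.src_getElem hk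

theorem tgt_bdry {k : ℕ} (hk : k < Δ.bdry.length) : Δ.toDGraph.tgt Δ.bdry[k] = vert Δ (k + 1) :=
  Δ.isWalk_bdry.tgt_getElem hk

theorem dist_vert {k : ℕ} (hk : k ≤ Δ.bdry.length) :
    Δ.toDGraph.simple.dist Δ.base (vert Δ k) = (F.path k).length := by
  have := dist_of_isGeodesicWord (F.isWalk k hk) (F.geodesic k hk) le_rfl
  rwa [List.take_length, F.walkEnd k hk] at this

/-- A geodesic to the base vertex has length 0. -/
theorem line_eq_basePt {k : ℕ} (hk : k ≤ Δ.bdry.length) (h : vert Δ k = Δ.base) (t : I) :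
    F.line k t = Δ.basePt := by
  have h1 := F.dist_vert hk
  rw [h, SimpleGraph.dist_self] at h1
  rw [line, List.length_eq_zero_iff.1 h1.symm]
  rfl

theorem continuous_line {k : ℕ} (hk : k < Δ.bdry.length) : Continuous (F.line k) := by
  have : F.line k = fun t => F.homotopy k (0, t) := funext fun t => (F.left k hk t).symm
  rw [this]
  fun_prop

theorem line_zero {k : ℕ} (hk : k < Δ.bdry.length) : F.line k 0 = Δ.basePt :=
  (F.left k hk 0).symm.trans (F.zero k hk 0)

theorem line_one {k : ℕ} (hk : k < Δ.bdry.length) : F.line k 1 = Δ.vertexPt (vert Δ k) := by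
  refine (F.left k hk 1).symm.trans ((F.one k hk 0).trans ?_)
  rw [LabelledMap.edgePt_zero, src_bdry]

theorem isTamePath_line {k : ℕ} (hk : k < Δ.bdry.length) : Δ.IsTamePath f (F.line k) := by
  intro s t hst
  rw [line, line, ← F.left k hk, ← F.left k hk]
  exact F.tame k hk 0 s t hst

theorem dist_vert_le (F : ClosedFan Δ f) {k : ℕ} (hk : k ≤ Δ.bdry.length) :
    (Δ.toDGraph.simple.dist Δ.base (vert Δ k) : ℚ) ≤
      f (QuarterNat.ofNat (Δ.toDGraph.simple.dist Δ.base (vert Δ k))) + 2 := by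
  rcases hk.eq_or_lt with rfl | hk
  · rw [vert, List.take_length, Δ.walkEnd_bdry, SimpleGraph.dist_self, Nat.cast_zero]
    exact add_nonneg (QuarterNat.coe_nonneg _) zero_le_two
  · exact LabelledMap.dist_le_of_isTamePath (F.continuous_line hk)
      (fun t => LabelledMap.walkPt_mem_oneSkeleton _ _) (F.line_one hk) (F.isTamePath_line hk)

theorem edgeLow_le (F : ClosedFan Δ f) {k : ℕ} (hk : k < Δ.bdry.length) : (Δ.edgeLow Δ.bdry[k] : ℚ) ≤
    f (QuarterNat.ofNat (Δ.edgeLow Δ.bdry[k])) + 2 := by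
  rw [LabelledMap.edgeLow, src_bdry, tgt_bdry]
  rcases min_choice (Δ.toDGraph.simple.dist Δ.base (vert Δ k))
    (Δ.toDGraph.simple.dist Δ.base (vert Δ (k + 1))) with h | h <;> rw [h]
  · exact F.dist_vert_le hk.le
  · exact F.dist_vert_le hk

/-- A geodesic meets its final vertex only at its end; this is the hypothesis of
`side_walkPt_nonpos`. -/
theorem walkEnd_ne {k : ℕ} (hk : k ≤ Δ.bdry.length) {m : ℕ} (hm : m < (F.path k).length) :
    Δ.toDGraph.walkEnd Δ.base ((F.path k).take m) ≠ vert Δ k := by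
  intro h
  have h1 := dist_of_isGeodesicWord (F.isWalk k hk) (F.geodesic k hk) hm.le
  rw [h, F.dist_vert hk] at h1
  omega

/-- The paths to two occurrences of a vertex on the boundary circuit are joined by a strip. -/
theorem tameStrip_line_of_lt (hf : Monotone f) {i j : ℕ} (hij : i < j) (hj : j < Δ.bdry.length)
    (h : vert Δ i = vert Δ j) {e : Δ.E} {c : I}
    (hc : Δ.edgePt e c = Δ.vertexPt (vert Δ j)) :
    Δ.TameStrip (shift f) e c c (F.line i) (F.line j) := by
  let C : CutData P := ⟨Δ, i, j, hij, hj, by rw [src_bdry, src_bdry, h]⟩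
  have hv : C.v = vert Δ j := src_bdry hj
  -- Geodesics to the cut vertex stay outside the cut-off part, so the retraction fixes them.
  have hfix : ∀ k, k ≤ Δ.bdry.length → vert Δ k = vert Δ j →
      ∀ t, C.retract (F.line k t) = F.line k t := by
    intro k hk hkj t
    refine C.retract_of_nonpos (C.side_walkPt_nonpos (F.isWalk k hk) (fun m hm => ?_) _)
    rw [hv, ← hkj]
    exact F.walkEnd_ne hk hm
  have hcv : Δ.edgePt e c = Δ.vertexPt C.v := by rw [hc, hv]
  have hbase : C.retract Δ.basePt = Δ.basePt := by
    rw [← F.line_zero hj]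
    exact hfix j hj.le rfl 0
  -- The boundary edges between the two visits are collapsed to the cut vertex, so the retracted
  -- homotopies become strips all of whose paths end there.
  have hstep : ∀ l, i ≤ l → l < j → Δ.TameStrip (shift f) e c c
      (fun t => C.retract (F.line l t)) fun t => C.retract (F.line (l + 1) t) := by
    intro l hil hlj
    have hl := hlj.trans hj
    have := LabelledMap.tameStrip_of_homotopy (e := e) (f := shift f) (c := fun _ => c)
      (H := ⟨fun z => C.retract (F.homotopy l z), C.continuous_retract.comp
        (F.homotopy l).continuous⟩) continuous_const
      (fun s => (congrArg C.retract (F.zero l hl s)).trans hbase)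
      (fun s => (congrArg C.retract (F.one l hl s)).trans
        ((C.retract_of_nonneg (C.side_bdry_nonneg hil hlj s)).trans hcv.symm))
      (fun s => C.isTamePath_retract hf (by fun_prop) (F.tame l hl s) (by
        rw [hv]
        exact F.dist_vert_le hj.le))
    have h1 : (fun t => C.retract (F.line l t)) = fun t => C.retract (F.homotopy l (0, t)) :=
      funext fun t => congrArg C.retract (F.left l hl t).symm
    have h2 : (fun t => C.retract (F.line (l + 1) t)) = fun t => C.retract (F.homotopy l (1, t)) :=
      funext fun t => congrArg C.retract (F.right l hl t).symm
    rw [h1, h2]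
    exact this
  have hall : ∀ l, i + 1 ≤ l → l ≤ j → Δ.TameStrip (shift f) e c c
      (fun t => C.retract (F.line i t)) fun t => C.retract (F.line l t) := by
    intro l hil
    induction l, hil using Nat.le_induction with
    | base => exact fun _ => hstep i le_rfl hij
    | succ l hl ih => exact fun h' => (ih (by omega)).trans (hstep l (by omega) (by omega))
  have := hall j hij le_rfl
  simp only [hfix i (hij.trans hj).le h, hfix j hj.le rfl] at this
  exact this

/-- The last index is not the start of a boundary edge, so the cutting argument does not cover it.
Its vertex is the base vertex, where the paths involved are constant. -/
theorem tameStrip_line (hf : Monotone f) {i j : ℕ} (hij : i ≤ j) (hj : j ≤ Δ.bdry.length)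
    (h : vert Δ i = vert Δ j) {e : Δ.E} {c : I} (hc : Δ.edgePt e c = Δ.vertexPt (vert Δ j)) :
    Δ.TameStrip (shift f) e c c (F.line i) (F.line j) := by
  by_cases hb : vert Δ j = Δ.base
  · have h1 : F.line i = fun _ => Δ.basePt := funext (F.line_eq_basePt (hij.trans hj) (h.trans hb))
    have h2 : F.line j = fun _ => Δ.basePt := funext (F.line_eq_basePt hj hb)
    rw [h1, h2]
    refine LabelledMap.tameStrip_refl continuous_const rfl (by rw [hc, hb]; rfl) fun s t _ => ?_
    change Δ.coarseRat Δ.basePt ≤ (shift f (Δ.coarseDist Δ.basePt) : ℚ)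
    rw [LabelledMap.coarseRat_basePt]
    exact QuarterNat.coe_nonneg _
  · have hj' : j < Δ.bdry.length := lt_of_le_of_ne hj fun h' => hb (by
      rw [vert, h', List.take_length, Δ.walkEnd_bdry])
    rcases hij.eq_or_lt with rfl | hij
    · exact LabelledMap.tameStrip_refl (F.continuous_line hj') (F.line_zero hj')
        ((F.line_one hj').trans hc.symm) ((F.isTamePath_line hj').mono (self_le_shift hf))
    · exact F.tameStrip_line_of_lt hf hij hj' h hc

open Classical in
/-- The path to the first occurrence of a vertex on the boundary circuit. -/
noncomputable def spoke (a : Δ.V) : I → Δ.Space :=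
  if h : ∃ k, k ≤ Δ.bdry.length ∧ vert Δ k = a then F.line (Nat.find h) else fun _ => Δ.basePt

theorem spoke_mem_oneSkeleton (a : Δ.V) (t : I) : F.spoke a t ∈ Δ.oneSkeleton := by
  unfold spoke
  split_ifs
  · exact LabelledMap.walkPt_mem_oneSkeleton _ _
  · exact ⟨_, rfl⟩

theorem spoke_base (t : I) : F.spoke Δ.base t = Δ.basePt := by
  classical
  have h : ∃ k, k ≤ Δ.bdry.length ∧ vert Δ k = Δ.base := ⟨0, Nat.zero_le _, rfl⟩
  rw [spoke, dif_pos h]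
  exact F.line_eq_basePt (Nat.find_spec h).1 (Nat.find_spec h).2 t

theorem tameStrip_spoke (hf : Monotone f) {k : ℕ} (hk : k ≤ Δ.bdry.length) {e : Δ.E} {c : I}
    (hc : Δ.edgePt e c = Δ.vertexPt (vert Δ k)) :
    Δ.TameStrip (shift f) e c c (F.spoke (vert Δ k)) (F.line k) := by
  classical
  have h : ∃ i, i ≤ Δ.bdry.length ∧ vert Δ i = vert Δ k := ⟨k, hk, rfl⟩
  rw [spoke, dif_pos h]
  exact F.tameStrip_line hf (Nat.find_min' h ⟨hk, rfl⟩) hk (Nat.find_spec h).2 hc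

/-- The strip to an edge of the boundary circuit, with sides that only depend on the vertices. -/
theorem tameStrip_edge (hf : Monotone f) {k : ℕ} (hk : k < Δ.bdry.length) :
    Δ.TameStrip (shift f) Δ.bdry[k] 0 1 (F.spoke (Δ.src Δ.bdry[k]))
      (F.spoke (Δ.toDGraph.tgt Δ.bdry[k])) := by
  have h0 := F.tameStrip_spoke hf hk.le (e := Δ.bdry[k]) (c := 0)
    (by rw [LabelledMap.edgePt_zero, src_bdry])
  have h1 := F.tameStrip_spoke hf (Nat.succ_le_of_lt hk) (e := Δ.bdry[k]) (c := 1)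
    (by rw [LabelledMap.edgePt_one, tgt_bdry])
  have h2 := LabelledMap.tameStrip_of_homotopy (e := Δ.bdry[k]) (f := shift f) (c := id)
    (H := F.homotopy k) continuous_id (F.zero k hk) (F.one k hk)
    fun s => LabelledMap.IsTamePath.mono (F.tame k hk s) (self_le_shift hf)
  simp only [F.left k hk, F.right k hk] at h2
  rw [src_bdry, tgt_bdry]
  exact (h0.trans h2).trans h1.symm

end ClosedFan
end VanKampenDiagram

/-! ### Assembling a van Kampen homotopy from strips -/

namespace VanKampenDiagram
variable {G : Type u} [Group G] {A : Type v} {P : SymmetrizedPresentation G A}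
  {Δ : VanKampenDiagram P} {f : QuarterNat → QuarterNat}

/-- Tame homotopies to the edges of the boundary that agree at the vertices. -/
structure BoundaryStrips (Δ : VanKampenDiagram P) (f : QuarterNat → QuarterNat) where
  spoke : Δ.V → I → Δ.Space
  spoke_mem : ∀ a t, spoke a t ∈ Δ.oneSkeleton
  spoke_base : ∀ t, spoke Δ.base t = Δ.basePt
  strip : Δ.E → C(I × I, Δ.Space)
  strip_zero : ∀ e ∈ Δ.bdry, ∀ s, strip e (s, 0) = Δ.basePt
  strip_one : ∀ e ∈ Δ.bdry, ∀ s, strip e (s, 1) = Δ.edgePt e s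
  strip_left : ∀ e ∈ Δ.bdry, ∀ t, strip e (0, t) = spoke (Δ.src e) t
  strip_right : ∀ e ∈ Δ.bdry, ∀ t, strip e (1, t) = spoke (Δ.toDGraph.tgt e) t
  tame : ∀ e ∈ Δ.bdry, Δ.IsTame f (strip e)

namespace BoundaryStrips
variable (S : BoundaryStrips Δ f)
open Classical

/-- The chosen directions of the edges of the boundary. -/
def Chosen (e : Δ.E) : Prop :=
  -- If the outer face lies on both sides of an edge, the boundary circuit traverses it in both
  -- directions and the two strips may differ. An arbitrary numbering selects one of them.
  e ∈ Δ.bdry ∧ (Δ.rev e ∈ Δ.bdry → Fintype.equivFin Δ.E e < Fintype.equivFin Δ.E (Δ.rev e))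

theorem Chosen.not_rev {e : Δ.E} (h : Chosen e) : ¬Chosen (Δ.rev e) := fun h' => by
  have h1 := h.2 h'.1
  have h2 := h'.2 (by rw [Δ.rev_rev]; exact h.1)
  rw [Δ.rev_rev] at h2
  exact lt_asymm h1 h2

theorem chosen_or {e : Δ.E} (h : e ∈ Δ.bdry) : Chosen e ∨ Chosen (Δ.rev e) := by
  rcases lt_trichotomy (Fintype.equivFin Δ.E e) (Fintype.equivFin Δ.E (Δ.rev e)) with h1 | h1 | h1
  · exact Or.inl ⟨h, fun _ => h1⟩
  · exact absurd ((Fintype.equivFin Δ.E).injective h1).symm (Δ.rev_ne e)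
  · by_cases h2 : Δ.rev e ∈ Δ.bdry
    · exact Or.inr ⟨h2, fun _ => by rwa [Δ.rev_rev]⟩
    · exact Or.inl ⟨h, fun h3 => absurd h3 h2⟩

/-- The path to a point of an edge. -/
noncomputable def ray (e : Δ.E) (s t : I) : Δ.Space :=
  if Chosen e then S.strip e (s, t) else if Chosen (Δ.rev e) then S.strip (Δ.rev e) (σ s, t)
  -- These values concern edges off the boundary and only make the definition compatible with the
  -- gluing of edges to vertices.
  else if s = 0 then S.spoke (Δ.src e) t else if s = 1 then S.spoke (Δ.toDGraph.tgt e) t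
  else Δ.basePt

theorem ray_zero (e : Δ.E) (t : I) : S.ray e 0 t = S.spoke (Δ.src e) t := by
  unfold ray
  split_ifs with h1 h2 h3
  · exact S.strip_left e h1.1 t
  · rw [unitInterval.symm_zero, S.strip_right _ h2.1, DGraph.tgt_rev]
  · rfl
  · exact absurd rfl h3
  · exact absurd rfl h3

theorem ray_rev (e : Δ.E) (s t : I) : S.ray (Δ.rev e) (σ s) t = S.ray e s t := by
  have h0 : σ s = 0 ↔ s = 1 := by
    rw [← unitInterval.symm_one, unitInterval.symm_inj]
  have h1 : σ s = 1 ↔ s = 0 := by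
    rw [← unitInterval.symm_zero, unitInterval.symm_inj]
  unfold ray
  rw [Δ.rev_rev, unitInterval.symm_symm]
  by_cases he : Chosen e
  · rw [if_neg he.not_rev, if_pos he, if_pos he]
  · by_cases hr : Chosen (Δ.rev e)
    · rw [if_pos hr, if_neg he, if_pos hr]
    · rw [if_neg hr, if_neg he, if_neg he, if_neg hr, DGraph.src_rev, DGraph.tgt_rev]
      simp only [h0, h1]
      by_cases hs : s = 0
      · subst hs
        simp
      · simp [hs]

/-- The path to a point of the 1-skeleton. -/
noncomputable def rayPoint (t : I) : Δ.toDGraph.Point → Δ.Space :=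
  Quot.lift (Sum.elim (fun a => S.spoke a t) fun z => S.ray z.1 z.2 t) (by
    rintro _ _ (e | ⟨e, s⟩)
    · exact S.ray_zero e t
    · exact (S.ray_rev e s t).symm)

/-- The path to a point of the boundary. -/
noncomputable def homotopyFun (z : Δ.boundary × I) : Δ.Space :=
  (Δ.toPoint z.1).elim Δ.basePt (S.rayPoint z.2)

theorem homotopyFun_edgePt {p : Δ.boundary} {e : Δ.E} {s : I} (h : (p : Δ.Space) = Δ.edgePt e s)
    (t : I) : S.homotopyFun (p, t) = S.ray e s t := by
  change (Δ.toPoint (p : Δ.Space)).elim Δ.basePt (S.rayPoint t) = _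
  rw [h]
  rfl

theorem homotopyFun_vertexPt {p : Δ.boundary} {a : Δ.V} (h : (p : Δ.Space) = Δ.vertexPt a)
    (t : I) : S.homotopyFun (p, t) = S.spoke a t := by
  change (Δ.toPoint (p : Δ.Space)).elim Δ.basePt (S.rayPoint t) = _
  rw [h]
  rfl

theorem exists_edgePt (hne : Δ.bdry ≠ []) (p : Δ.boundary) :
    ∃ e ∈ Δ.bdry, ∃ s, (p : Δ.Space) = Δ.edgePt e s := by
  rcases p.2 with h | ⟨e, he, s, h⟩
  · obtain ⟨x, m, hx⟩ := List.exists_cons_of_ne_nil hne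
    refine ⟨x, by simp [hx], 0, ?_⟩
    rw [LabelledMap.edgePt_zero, Δ.bdry_base x (by simp [hx])]
    exact h
  · exact ⟨e, he, s, h⟩

theorem exists_ray {e : Δ.E} (he : e ∈ Δ.bdry) : ∃ d ∈ Δ.bdry, ∃ r : I → I, Continuous r ∧
    (∀ s, Δ.edgePt d (r s) = Δ.edgePt e s) ∧ ∀ s t, S.ray e s t = S.strip d (r s, t) := by
  by_cases h : Chosen e
  · exact ⟨e, he, id, continuous_id, fun _ => rfl, fun s t => if_pos h⟩
  · have h' := (chosen_or he).resolve_left h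
    refine ⟨Δ.rev e, h'.1, σ, unitInterval.continuous_symm, fun s => ?_, fun s t => ?_⟩
    · rw [LabelledMap.edgePt_rev, unitInterval.symm_symm]
    · exact (if_neg h).trans (if_pos h')

/-- The boundary is a finite union of closed edges. On each of them the map is a strip composed with
the coordinate, so the pieces can be pasted. -/
theorem continuous_homotopyFun (hne : Δ.bdry ≠ []) : Continuous S.homotopyFun := by
  let T : {e // e ∈ Δ.bdry} → Set (Δ.boundary × I) := fun e =>
    {z | (z.1 : Δ.Space) ∈ Δ.closedEdge e}
  refine (locallyFinite_of_finite T).continuous ?_ ?_ ?_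
  · refine Set.eq_univ_of_forall fun z => ?_
    obtain ⟨e, he, s, h⟩ := exists_edgePt hne z.1
    exact Set.mem_iUnion.2 ⟨⟨e, he⟩, s, h.symm⟩
  · intro e
    exact (LabelledMap.isClosed_closedEdge e.1).preimage (by fun_prop)
  · rintro ⟨e, he⟩
    obtain ⟨d, hd, r, hr, -, h2⟩ := S.exists_ray he
    have hc : Continuous fun z : Δ.boundary × I =>
        S.strip d (r (Δ.coord e (z.1 : Δ.Space)), z.2) := by
      refine (S.strip d).continuous.comp ?_
      exact (hr.comp ((LabelledMap.continuous_coord e).comp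
        (continuous_subtype_val.comp continuous_fst))).prodMk continuous_snd
    refine hc.continuousOn.congr ?_
    rintro ⟨p, t⟩ ⟨s, hs⟩
    rw [S.homotopyFun_edgePt hs.symm, h2]
    change _ = S.strip d (r (Δ.coord e (p : Δ.Space)), t)
    rw [← hs, LabelledMap.coord_edgePt (src_ne_tgt e).symm]

/-- The van Kampen homotopy that is made of the strips. -/
theorem exists_vanKampenHomotopy (S : BoundaryStrips Δ f) (hne : Δ.bdry ≠ []) :
    ∃ Ψ : C(Δ.boundary × I, Δ.Space), Δ.IsVanKampenHomotopy Ψ ∧ Δ.IsTame f Ψ := by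
  have key : ∀ p : Δ.boundary, ∃ d ∈ Δ.bdry, ∃ s, (p : Δ.Space) = Δ.edgePt d s ∧
      ∀ t, S.homotopyFun (p, t) = S.strip d (s, t) := by
    intro p
    obtain ⟨e, he, s, h⟩ := exists_edgePt hne p
    obtain ⟨d, hd, r, -, h1, h2⟩ := S.exists_ray he
    exact ⟨d, hd, r s, h.trans (h1 s).symm, fun t => (S.homotopyFun_edgePt h t).trans (h2 s t)⟩
  refine ⟨⟨S.homotopyFun, S.continuous_homotopyFun hne⟩, ⟨fun p => ?_, fun p => ?_, fun t => ?_,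
    fun p a h t => ?_⟩, fun p => ?_⟩
  · obtain ⟨d, hd, s, -, h⟩ := key p
    exact (h 0).trans (S.strip_zero d hd s)
  · obtain ⟨d, hd, s, hp, h⟩ := key p
    exact (h 1).trans ((S.strip_one d hd s).trans hp.symm)
  · exact (S.homotopyFun_vertexPt (p := ⟨Δ.basePt, Δ.basePt_mem_boundary⟩) rfl t).trans
      (S.spoke_base t)
  · change S.homotopyFun (p, t) ∈ _
    rw [S.homotopyFun_vertexPt h]
    exact S.spoke_mem a t
  · obtain ⟨d, hd, s, -, h⟩ := key p
    intro t t' htt'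
    change Δ.coarseDist (S.homotopyFun (p, t)) ≤ f (Δ.coarseDist (S.homotopyFun (p, t')))
    rw [h, h]
    exact S.tame d hd s t t' htt'

end BoundaryStrips

/-- One `shift` is the cost of the retractions, which make the strips depend only on vertices; the
other is the cost of straightening the strips. -/
theorem ClosedFan.exists_vanKampenHomotopy (F : ClosedFan Δ f) (hf : Monotone f)
    (hne : Δ.bdry ≠ []) : ∃ Ψ : C(Δ.boundary × I, Δ.Space),
      Δ.IsVanKampenHomotopy Ψ ∧ Δ.IsTame (shift (shift f)) Ψ := by
  have h : ∀ e, ∃ M : C(I × I, Δ.Space), e ∈ Δ.bdry → (∀ s, M (s, 0) = Δ.basePt) ∧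
      (∀ s, M (s, 1) = Δ.edgePt e s) ∧
      (∀ t, M (0, t) = LabelledMap.delay (F.spoke (Δ.src e)) t) ∧
      (∀ t, M (1, t) = LabelledMap.delay (F.spoke (Δ.toDGraph.tgt e)) t) ∧
      Δ.IsTame (shift (shift f)) M := by
    intro e
    by_cases he : e ∈ Δ.bdry
    · obtain ⟨k, hk, rfl⟩ := List.getElem_of_mem he
      obtain ⟨M, hM⟩ := (F.tameStrip_edge hf hk).exists_homotopy (monotone_shift hf)
        ((F.edgeLow_le hk).trans (by
          have : (f (QuarterNat.ofNat (Δ.edgeLow Δ.bdry[k])) : ℚ) ≤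
            shift f (QuarterNat.ofNat (Δ.edgeLow Δ.bdry[k])) := self_le_shift hf _
          linarith))
      exact ⟨M, fun _ => hM⟩
    · exact ⟨ContinuousMap.const _ Δ.basePt, fun h => absurd h he⟩
  choose M hM using h
  let S : BoundaryStrips Δ (shift (shift f)) :=
    { spoke := fun a => LabelledMap.delay (F.spoke a)
      spoke_mem := fun a t => F.spoke_mem_oneSkeleton a _
      spoke_base := fun t => F.spoke_base _
      strip := M
      strip_zero := fun e he => (hM e he).1
      strip_one := fun e he => (hM e he).2.1
      strip_left := fun e he => (hM e he).2.2.1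
      strip_right := fun e he => (hM e he).2.2.2.1
      tame := fun e he => (hM e he).2.2.2.2 }
  exact S.exists_vanKampenHomotopy hne

/-- The diagram that consists of a single vertex. -/
def point (P : SymmetrizedPresentation G A) : VanKampenDiagram P where
  V := Unit
  E := Empty
  src := Empty.elim
  rev := id
  rev_rev e := e.elim
  finV := inferInstance
  finE := inferInstance
  rev_ne e := e.elim
  label := Empty.elim
  label_rev e := e.elim
  connected := ⟨fun a b => by
    rw [Subsingleton.elim a b]⟩
  next := 1
  src_next e := e.elim
  rotation e := e.elim
  base := ()
  bdry := []
  bdry_nodup := List.nodup_nil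
  bdry_next i h := absurd h (Nat.not_lt_zero i)
  bdry_base e := e.elim
  bdry_nil _ := inferInstanceAs (IsEmpty Empty)
  euler := by
    have : ∀ Δ : LabelledMap.{v} A P.inv, IsEmpty Δ.E → Nat.card Δ.Face = 0 := fun Δ h => by
      have : IsEmpty Δ.Face := ⟨fun F => Quotient.inductionOn F fun c => h.elim c.1⟩
      exact Nat.card_of_isEmpty
    rw [this _ (inferInstanceAs (IsEmpty Empty))]
    simp
  relator e := e.elim
  pos _ := 1
  pos_base := rfl
  pos_tgt e := e.elim

theorem exists_vanKampenHomotopy_of_nil (h : Δ.bdry = []) :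
    ∃ Ψ : C(Δ.boundary × I, Δ.Space), Δ.IsVanKampenHomotopy Ψ ∧ Δ.IsTame f Ψ := by
  have hp : ∀ p : Δ.boundary, (p : Δ.Space) = Δ.basePt := by
    rintro ⟨p, hp | ⟨e, he, -⟩⟩
    · exact hp
    · simp [h] at he
  refine ⟨⟨fun _ => Δ.basePt, continuous_const⟩, ⟨fun _ => rfl, fun p => (hp p).symm,
    fun _ => rfl, fun _ _ _ _ => ⟨_, rfl⟩⟩, fun p s t _ => ?_⟩
  change Δ.coarseRat Δ.basePt ≤ (f (Δ.coarseDist Δ.basePt) : ℚ)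
  rw [LabelledMap.coarseRat_basePt]
  exact QuarterNat.coe_nonneg _

end VanKampenDiagram

/-- An intrinsic geodesic tame normal inequality implies an intrinsic tame filling inequality. -/
theorem IntrinsicGeodesicTameNormal.filling {G : Type u} [Group G] {A : Type v}
    {P : SymmetrizedPresentation G A} {f : QuarterNat → QuarterNat} (hf : Monotone f)
    (h : IntrinsicGeodesicTameNormal P f) : IntrinsicTameFilling P (shift (shift f)) := by
  obtain ⟨N, hN, ht⟩ := h
  obtain ⟨ρ, hρ⟩ := N.exists_hasEdgeFan ht
  intro l hl
  rcases eq_or_ne l [] with rfl | hne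
  -- Fans exist for nonempty words only; the empty word bounds a single vertex.
  · exact ⟨VanKampenDiagram.point P, rfl, VanKampenDiagram.exists_vanKampenHomotopy_of_nil rfl⟩
  obtain ⟨Δ, es, q, p, Φ, hb, hes, hp, hpq, hΦ⟩ := exists_hasFan hN N.y_val hρ l hne
  have hy : N.y 1 = [] := by
    have := hN 1 [] (by rw [N.y_val]; rfl)
    exact List.length_eq_zero_iff.1 (Nat.le_zero.1 this)
  have hlen : es.length = l.length := by rw [← hes, List.length_map]
  -- The word represents the identity, whose geodesic normal form is empty, so the fan closes up and
  -- its edges make up the whole boundary circuit.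
  have hq : q = [] := by
    have h1 := (hp _ le_rfl).2.2
    rw [hpq, hlen, List.take_length, hl, hy] at h1
    simpa [DGraph.walkRev] using h1
  subst hq
  rw [List.append_nil] at hb
  subst hb
  refine ⟨Δ, hes, ?_⟩
  let F : VanKampenDiagram.ClosedFan Δ f :=
    { path := p
      time := fun k => ρ (P.wordVal (l.take k))
      homotopy := Φ
      isWalk := fun k hk => (hp k hk).1
      walkEnd := fun k hk => (hp k hk).2.1
      geodesic := fun k hk => by
        rw [(hp k hk).2.2]
        exact hN _
      tame := fun k hk => (hΦ k hk).1
      zero := fun k hk => (hΦ k hk).2.1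
      one := fun k hk => (hΦ k hk).2.2.1
      left := fun k hk => (hΦ k hk).2.2.2.1
      right := fun k hk => (hΦ k hk).2.2.2.2 }
  exact F.exists_vanKampenHomotopy hf fun h0 => hne (by rw [← hes, h0]; rfl)

end TameFilling

/-! ### The equivalence of the three inequalities -/

theorem proposition3p2 {G : Type*} [Group G] {A : Type*} [Finite A]
    (P : TameFilling.SymmetrizedPresentation G A)
    (f : TameFilling.QuarterNat → TameFilling.QuarterNat) (hf : Monotone f) :
    List.TFAE [
      ∃ g : TameFilling.QuarterNat → TameFilling.QuarterNat, Monotone g ∧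
        TameFilling.LipschitzEquivalent f g ∧ TameFilling.IntrinsicTameFilling P g,
      ∃ g : TameFilling.QuarterNat → TameFilling.QuarterNat, Monotone g ∧
        TameFilling.LipschitzEquivalent f g ∧ TameFilling.IntrinsicRelaxedTameFilling P g,
      ∃ g : TameFilling.QuarterNat → TameFilling.QuarterNat, Monotone g ∧
        TameFilling.LipschitzEquivalent f g ∧ TameFilling.IntrinsicGeodesicTameNormal P g] := by
  tfae_have 1 → 2 := fun ⟨g, hg, hfg, h⟩ => ⟨g, hg, hfg, h.relaxed⟩
  tfae_have 2 → 3 := fun ⟨g, hg, hfg, h⟩ => ⟨_, TameFilling.monotone_shift hg,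
    hfg.shift hf hg, h.geodesic hg⟩
  tfae_have 3 → 1 := fun ⟨g, hg, hfg, h⟩ => ⟨_,
    TameFilling.monotone_shift (TameFilling.monotone_shift hg),
    (hfg.shift hf hg).shift hf (TameFilling.monotone_shift hg), h.filling hg⟩
  tfae_finish
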